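/- Let $k$ be an algebraically closed field of characteristic $2$ and let $b\ge 4$ be an even integer. For a homogeneous polynomial $G\in k[X_0,X_1,X_2]$ of degree $b$, let $dG$ be the global section of $\Omega^1_{\mathbb P^2}(b)$ obtained by differentiating $G$ in local trivializations of $\mathcal O(b)\cong\mathcal O(b/2)^{\otimes 2}$ whose transition functions are squares; its components under $\Omega^1(b)\subset\mathcal O(b-1)^{\oplus 3}$ are the partial derivatives of $G$. Assume that the subscheme $Z(dG)\subset\mathbb P^2$ is reduced of dimension $0$. Put $V_{2,b}=\{H^2: H \text{ homogeneous of degree } b/2\}$ and $k^\times G+V_{2,b}=\{cG+H^2: c\in k^\times,\ H^2\in V_{2,b}\}$. Let $Y_G$ be the double cover $w^2=G$ of $\mathbb P^2$, let $X_G\to Y_G$ be its minimal resolution and $\phi_G:X_G\to\mathbb P^2$ the composite. The singular points of $Y_G$ are ordinary double points, one over each point of $Z(dG)$; for $P\in Z(dG)$ let $\Gamma_P\subset X_G$ be the curve contracted to $P$. A reduced irreducible plane curve is *splitting in $X_G$* if its proper transform in $X_G$ is of the form $2F$ with $F$ a reduced irreducible curve; a reduced plane curve is splitting if each of its irreducible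 components is. If $C$ is a reduced splitting curve, let $F_C$ be the reduced divisor on $X_G$ such that $2F_C$ is the proper transform of $C$. Let $S_G$ be the numerical Néron–Severi lattice of $X_G$ and $S_G^0\subset S_G$ the sublattice of finite index with basis the classes $[\Gamma_P]$ $(P\in Z(dG))$ and the class $[H_G]$ of the pull-back of a line. The dual lattice $(S_G^0)^\vee$ has the basis $[\Gamma_P]/2$, $[H_G]/2$, so that $S_G/S_G^0\subset (S_G^0)^\vee/S_G^0=\mathrm{Pow}(Z(dG))\oplus\mathbb F_2$, where $\mathrm{Pow}(Z(dG))$ is the set of subsets of $Z(dG)$ with symmetric difference as addition. The word $w_G(C)\subset Z(dG)$ is the image of $[F_C]$ in $\mathrm{Pow}(Z(dG))$, that is, the set of all $P\in Z(dG)$ such that the coefficient of $[F_C]$ at $[\Gamma_P]/2$ is odd. A point of a plane curve is an *ordinary node* if the curve is given by $\eta(\eta+\xi)=0$ for some formal parameter system $(\xi,\eta)$ of $\mathbb P^2$ at that point. (1) Let $G_C$ and $G_D$ be homogeneous polynomials with $\deg G_C+\deg G_D=b$ and $G_C G_D\in k^\times G+V_{2,b}$, and let $C$ and $D$ be the plane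 curves defined by $G_C=0$ and $G_D=0$. Then * (i) $C$ and $D$ are reduced and have no common irreducible component; * (ii) $C\cup D$ has only ordinary nodes as its singularities; * (iii) $C$ and $D$ are splitting in $X_G$; * (iv) $w_G(C)=w_G(D)=C\cap D$. (2) Conversely, let $C$ be a reduced plane curve defined by a homogeneous polynomial $G_C$, which has only ordinary nodes as its singularities and is splitting in $X_G$. Then $\deg G_C\le b$, and there is a homogeneous polynomial $G_D$ of degree $b-\deg G_C$ such that $G_C G_D\in k^\times G+V_{2,b}$. -/

import Mathlib

open MvPolynomial

open scoped LinearAlgebra.Projectivization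

namespace InsepCover

noncomputable section

/-! ### Purely inseparable double covers of affine schemes -/

/-- The ring `R[w] / (w ^ 2 - g)`. -/
abbrev Cover {R : Type*} [CommRing R] (g : R) : Type _ :=
  AdjoinRoot ((Polynomial.X : Polynomial R) ^ 2 - Polynomial.C g)

section Cover

variable {R : Type*} [CommRing R] (g : R)

/-- The coordinate `w` of the double cover `w ^ 2 = g`. -/
def Cover.w : Cover g := AdjoinRoot.root _

theorem Cover.w_sq : Cover.w g ^ 2 = algebraMap R (Cover g) g := by
  have h := AdjoinRoot.eval₂_root ((Polynomial.X : Polynomial R) ^ 2 - Polynomial.C g)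
  rw [Polynomial.eval₂_sub, Polynomial.eval₂_X_pow, Polynomial.eval₂_C, sub_eq_zero] at h
  exact h

theorem Cover.monic [Nontrivial R] :
    ((Polynomial.X : Polynomial R) ^ 2 - Polynomial.C g).Monic :=
  Polynomial.monic_X_pow_sub_C g two_ne_zero

theorem Cover.two_eq_zero [CharP R 2] : (2 : Cover g) = 0 := by
  have h : (2 : R) = 0 := by exact_mod_cast CharP.cast_eq_zero R 2
  have h' := congrArg (algebraMap R (Cover g)) h
  rw [map_ofNat, map_zero] at h'
  exact h'

/-- In characteristic two the square of a function on the cover is a function on the base. -/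
theorem Cover.exists_sq_eq [CharP R 2] (x : Cover g) :
    ∃ c : R, x ^ 2 = algebraMap R (Cover g) c := by
  induction x using AdjoinRoot.induction_on with
  | ih p =>
    induction p using Polynomial.induction_on' with
    | add p q hp hq =>
      obtain ⟨c, hc⟩ := hp
      obtain ⟨d, hd⟩ := hq
      refine ⟨c + d, ?_⟩
      rw [map_add, map_add, ← hc, ← hd, add_sq, Cover.two_eq_zero]
      ring
    | monomial n a =>
      refine ⟨a ^ 2 * g ^ n, ?_⟩
      rw [← Polynomial.C_mul_X_pow_eq_monomial, map_mul, map_pow, AdjoinRoot.mk_X, AdjoinRoot.mk_C,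
        mul_pow, ← pow_mul, mul_comm n 2, pow_mul, map_mul, map_pow, map_pow, ← Cover.w_sq]
      rfl

/-- The reduced inverse image in the double cover `w ^ 2 = g` of the closed subscheme defined by
`I`. -/
def above (I : Ideal R) : Ideal (Cover g) := (I.map (algebraMap R (Cover g))).radical

/-- The double cover is a homeomorphism in characteristic two: the reduced inverse image of an
irreducible closed subset is irreducible. -/
instance above_isPrime [CharP R 2] (I : Ideal R) [hI : I.IsPrime] : (above g I).IsPrime := by
  have : Nontrivial R := CharP.nontrivial_of_char_ne_one (R := R) (v := 2) (by norm_num)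
  have : Module.Free R (Cover g) := (Cover.monic g).free_adjoinRoot
  have : Nontrivial (Cover g) := by
    refine Ideal.Quotient.nontrivial_iff.mpr ?_
    rw [Ne, Ideal.span_singleton_eq_top]
    intro hu
    have h0 := congrArg Polynomial.natDegree ((Cover.monic g).eq_one_of_isUnit hu)
    rw [Polynomial.natDegree_X_pow_sub_C, Polynomial.natDegree_one] at h0
    exact two_ne_zero h0
  have hc : ∀ c : R, algebraMap R (Cover g) c ∈ I.map (algebraMap R (Cover g)) → c ∈ I := by
    intro c hc
    rw [← Ideal.mem_comap, Ideal.comap_map_eq_self_of_faithfullyFlat] at hc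
    exact hc
  refine ⟨?_, ?_⟩
  · intro h
    rw [above, Ideal.radical_eq_top] at h
    apply hI.ne_top
    rw [Ideal.eq_top_iff_one]
    apply hc
    rw [h]
    trivial
  · intro x y hxy
    obtain ⟨c, hcx⟩ := Cover.exists_sq_eq g x
    obtain ⟨d, hdy⟩ := Cover.exists_sq_eq g y
    obtain ⟨n, hn⟩ := hxy
    have h1 : algebraMap R (Cover g) ((c * d) ^ n) ∈ I.map (algebraMap R (Cover g)) := by
      have : algebraMap R (Cover g) ((c * d) ^ n) = (x * y) ^ n * (x * y) ^ n := by
        rw [map_pow, map_mul, ← hcx, ← hdy]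
        ring
      rw [this]
      exact Ideal.mul_mem_left _ _ hn
    rcases hI.mem_or_mem (hI.mem_of_pow_mem n (hc _ h1)) with h | h
    · left
      exact ⟨2, by rw [hcx]; exact Ideal.mem_map_of_mem _ h⟩
    · right
      exact ⟨2, by rw [hdy]; exact Ideal.mem_map_of_mem _ h⟩

/-- The order of vanishing of a function `h` on the double cover `w ^ 2 = g` along the reduced
inverse image of the prime divisor with ideal `I`, that is, the length of `𝒪 / (h)`, where `𝒪` is
the local ring of the double cover at the generic point of this inverse image. -/
def ordAbove [CharP R 2] (I : Ideal R) [I.IsPrime] (h : Cover g) : ℕ :=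
  (Ring.ord (Localization.AtPrime (above g I))
    (algebraMap (Cover g) (Localization.AtPrime (above g I)) h)).toNat

end Cover

/-! ### Plane curves and their singularities -/

section Plane

variable {k : Type*} [Field k]

/-- The point `P` of the plane lies on the curve `F = 0`. -/
def OnCurve (F : MvPolynomial (Fin 3) k) (P : ℙ k (Fin 3 → k)) : Prop :=
  eval P.rep F = 0

/-- The point `P` is a singular point of the curve `F = 0`. -/
def IsSingularPoint (F : MvPolynomial (Fin 3) k) (P : ℙ k (Fin 3 → k)) : Prop :=
  OnCurve F P ∧ ∀ j, eval P.rep (pderiv j F) = 0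

/-- `(ξ, η)` is a formal parameter system: both series vanish at the origin, and their linear
parts are linearly independent. -/
def IsFormalParameterSystem (ξ η : MvPowerSeries (Fin 2) k) : Prop :=
  MvPowerSeries.constantCoeff ξ = 0 ∧ MvPowerSeries.constantCoeff η = 0 ∧
    MvPowerSeries.coeff (Finsupp.single 0 1) ξ * MvPowerSeries.coeff (Finsupp.single 1 1) η -
      MvPowerSeries.coeff (Finsupp.single 1 1) ξ * MvPowerSeries.coeff (Finsupp.single 0 1) η ≠ 0

/-- The polynomial `F (v + x • a + y • b)` in the affine coordinates `x = X 0` and `y = X 1`.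
If `v, a, b` is a basis, it is the local equation of the curve `F = 0` at the point `[v]`. -/
def localEq (F : MvPolynomial (Fin 3) k) (v a b : Fin 3 → k) : MvPolynomial (Fin 2) k :=
  aeval (fun i => C (v i) + X 0 * C (a i) + X 1 * C (b i)) F

/-- `P` is an ordinary node of the curve `F = 0`: locally at `P` the curve is defined by
`η * (η + ξ) = 0` for a formal parameter system `(ξ, η)` of the plane at `P`. -/
def IsOrdinaryNode (F : MvPolynomial (Fin 3) k) (P : ℙ k (Fin 3 → k)) : Prop :=
  ∃ a b : Fin 3 → k, LinearIndependent k ![P.rep, a, b] ∧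
    ∃ ξ η u : MvPowerSeries (Fin 2) k, IsFormalParameterSystem ξ η ∧ IsUnit u ∧
      (localEq F P.rep a b : MvPowerSeries (Fin 2) k) = u * (η * (η + ξ))

/-- The curve `F = 0` has only ordinary nodes as its singularities. -/
def HasOnlyOrdinaryNodes (F : MvPolynomial (Fin 3) k) : Prop :=
  ∀ P, IsSingularPoint F P → IsOrdinaryNode F P

variable (k) in
/-- A reduced irreducible plane curve, given by its homogeneous ideal. -/
structure IrredCurve where
  /-- The homogeneous ideal of the curve. -/
  ideal : Ideal (MvPolynomial (Fin 3) k)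
  exists_eqn : ∃ (n : ℕ) (F : MvPolynomial (Fin 3) k),
    F.IsHomogeneous n ∧ Irreducible F ∧ ideal = Ideal.span {F}

instance (E : IrredCurve k) : E.ideal.IsPrime := by
  obtain ⟨n, F, -, hF, h⟩ := E.exists_eqn
  rw [h, Ideal.span_singleton_prime hF.ne_zero]
  exact hF.prime

end Plane

/-! ### The scheme `Z(dG)` and the set of admissible `G` -/

section DG

variable {k : Type*} [Field k]

/-- The ideal of `Z(dG)` in the affine chart `X i ≠ 0`, inside the coordinate ring
`k[X 0, X 1, X 2] / (X i - 1)` of the chart. For `G` homogeneous, `∂G/∂X j` restricts to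
`∂g/∂x j` for `j ≠ i`, where `g` is the dehomogenization of `G`. -/
def chartIdeal (G : MvPolynomial (Fin 3) k) (i : Fin 3) : Ideal (MvPolynomial (Fin 3) k) :=
  Ideal.span (insert (X i - 1) {f | ∃ j, j ≠ i ∧ f = pderiv j G})

/-- The set of points of `Z(dG)`. The three partial derivatives are the components of `dG` under
the inclusion of `Ω¹(b)` in the direct sum of three copies of `𝒪(b - 1)`. -/
def zeroDG (G : MvPolynomial (Fin 3) k) : Set (ℙ k (Fin 3 → k)) :=
  {P | ∀ j, eval P.rep (pderiv j G) = 0}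

variable (k) in
/-- The set of homogeneous polynomials `G` of degree `b` such that the scheme `Z(dG)` is reduced of
dimension `0` (the scheme is never empty, since `c₂(Ω¹(b)) = b² - 3b + 3 > 0`). -/
def U (b : ℕ) : Set (MvPolynomial (Fin 3) k) :=
  {G | G.IsHomogeneous b ∧
    ∀ i, IsReduced (MvPolynomial (Fin 3) k ⧸ chartIdeal G i) ∧
      Ring.KrullDimLE 0 (MvPolynomial (Fin 3) k ⧸ chartIdeal G i)}

/-- The set `k^× G + V_{2,b}`, where `V_{2,b}` consists of the squares of homogeneous polynomials
of degree `b / 2`. -/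
def affineClass (b : ℕ) (G : MvPolynomial (Fin 3) k) : Set (MvPolynomial (Fin 3) k) :=
  {F | ∃ (c : k) (H : MvPolynomial (Fin 3) k),
    c ≠ 0 ∧ H.IsHomogeneous (b / 2) ∧ F = C c * G + H ^ 2}

end DG

/-! ### The surface `X_G`

The normal surface `Y_G : w ^ 2 = G` over the plane has the homogeneous coordinate ring `Cover G`,
in which `w` has degree `b / 2`. Its singular points are ordinary double points lying over
the points of `Z(dG)`, and its minimal resolution `X_G` is the blow-up of these points. -/

section Surface

variable {k : Type*} [Field k] [CharP k 2] (b : ℕ) (G : MvPolynomial (Fin 3) k)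

/-- An affine open part of the blow-up of `Y_G` at the singular point over `P`. In the affine
coordinates `(x, y)` of the plane given by `X = v + x • e₁ + y • e₂`, with `P = [v]`, the surface
`Y_G` is `w ^ 2 = g(x, y)`, and its singular point is `x = y = w - s = 0`, where `s ^ 2 = g(0, 0)`.
The blow-up of this point is given by `y = x t`, `w = s + x u`, so that its equation is
`u ^ 2 = γ(x, t)` with `x ^ 2 * γ(x, t) = g(x, x t) - s ^ 2`. In the ring of polynomials in `x` and
`t` we have `x = X 0` and `t = X 1`. The exceptional curve is `x = 0`. -/
structure BlowupChart (P : ℙ k (Fin 3 → k)) where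
  /-- The first coordinate direction. -/
  e₁ : Fin 3 → k
  /-- The second coordinate direction. -/
  e₂ : Fin 3 → k
  linearIndependent : LinearIndependent k ![P.rep, e₁, e₂]
  /-- The value of `w` at the singular point. -/
  s : k
  /-- The equation of the blow-up. -/
  γ : MvPolynomial (Fin 2) k
  eqn : X 0 ^ 2 * γ =
    aeval ![X 0, X 0 * X 1] (localEq G P.rep e₁ e₂) - (C s ^ 2 : MvPolynomial (Fin 2) k)

variable {G} in
/-- The pull-back of functions from `Y_G` to the affine open part of the blow-up. -/
def BlowupChart.pullback {P : ℙ k (Fin 3 → k)} (c : BlowupChart G P) : Cover G →+* Cover c.γ :=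
  AdjoinRoot.lift
    ((algebraMap (MvPolynomial (Fin 2) k) (Cover c.γ)).comp
      ((aeval (R := k) ![(X 0 : MvPolynomial (Fin 2) k), X 0 * X 1]).toRingHom.comp
        (aeval (R := k) (fun i => (C (P.rep i) + X 0 * C (c.e₁ i) + X 1 * C (c.e₂ i) :
          MvPolynomial (Fin 2) k))).toRingHom))
    (algebraMap (MvPolynomial (Fin 2) k) (Cover c.γ) (C c.s) +
      algebraMap (MvPolynomial (Fin 2) k) (Cover c.γ) (X 0) * Cover.w c.γ)
    (by
      rw [Polynomial.eval₂_sub, Polynomial.eval₂_X_pow, Polynomial.eval₂_C, sub_eq_zero]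
      have h := congrArg (algebraMap (MvPolynomial (Fin 2) k) (Cover c.γ))
        (eq_sub_iff_add_eq.mp c.eqn)
      rw [map_add, map_mul, map_pow, map_pow, ← Cover.w_sq] at h
      refine Eq.trans ?_ h
      rw [add_sq, Cover.two_eq_zero]
      ring)

instance : (Ideal.span {(X 0 : MvPolynomial (Fin 2) k)}).IsPrime := by
  rw [Ideal.span_singleton_prime (X_ne_zero _)]
  exact X_prime

variable {G} in
/-- The order of vanishing along the exceptional curve `x = 0` of the pull-back of `h`. -/
def BlowupChart.ord {P : ℙ k (Fin 3 → k)} (c : BlowupChart G P) (h : Cover G) : ℕ :=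
  ordAbove c.γ (Ideal.span {X 0}) (c.pullback h)

open scoped Classical in
/-- The order of vanishing of a homogeneous `h` along the exceptional curve `Γ_P`, computed in any
chart; a chart exists if `P` is a point of `Z(dG)`. -/
def ordExc (P : ℙ k (Fin 3 → k)) (h : Cover G) : ℕ :=
  if hc : Nonempty (BlowupChart G P) then hc.some.ord h else 0

/-- The prime divisors of `X_G`: for each reduced irreducible plane curve `E` the reduced
irreducible curve dominating `E`, and for each point `P` of `Z(dG)` the curve `Γ_P`. -/
inductive PrimeDivisor : Type _
  | strict (E : IrredCurve k)
  | exc (P : ℙ k (Fin 3 → k)) (hP : P ∈ zeroDG G)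

/-- A divisor on `X_G`, as the family of its multiplicities along the prime divisors. -/
abbrev Divisor : Type _ := PrimeDivisor G → ℤ

/-- The divisor on `X_G` of a homogeneous element `h ≠ 0` of the homogeneous coordinate ring of
`Y_G`. The order along the curve dominating `E` is computed in `Cover G` itself, that is, on the cone
over `Y_G`, which is a line bundle over `Y_G` minus its zero section away from the vertex. -/
def divisorOf (h : Cover G) : Divisor G
  | .strict E => ordAbove G E.ideal h
  | .exc P _ => ordExc G P h

variable {G} in
/-- `h` is homogeneous of degree `n`, where `w` has degree `b / 2`. -/
def Cover.IsHomogeneous (n : ℕ) (h : Cover G) : Prop :=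
  ∃ p q : MvPolynomial (Fin 3) k, p.IsHomogeneous n ∧
    (q = 0 ∨ ∃ m, m + b / 2 = n ∧ q.IsHomogeneous m) ∧
    h = algebraMap (MvPolynomial (Fin 3) k) (Cover G) p + algebraMap (MvPolynomial (Fin 3) k) (Cover G) q * Cover.w G

variable {G} in
/-- Linear equivalence of divisors on `X_G`: the difference is the divisor of a non-zero rational
function, that is, of a quotient of homogeneous elements of the same degree. -/
def LinEquiv (D D' : Divisor G) : Prop :=
  ∃ (n : ℕ) (f f' : Cover G), f ≠ 0 ∧ f' ≠ 0 ∧ Cover.IsHomogeneous b n f ∧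
    Cover.IsHomogeneous b n f' ∧ D - D' = divisorOf G f - divisorOf G f'

/-- The pull-back to `X_G` of a line; its class does not depend on the line. -/
def lineDivisor : Divisor G := divisorOf G (algebraMap (MvPolynomial (Fin 3) k) (Cover G) (X 0))

/-- The divisor `∑ a P • Γ_P`, where `P` runs through `Z(dG)`. -/
def excDivisor (a : ℙ k (Fin 3 → k) → ℤ) : Divisor G
  | .strict _ => 0
  | .exc P _ => a P

variable {G} in
/-- The word of the class of a divisor `D`, as a set of points of `Z(dG)`. Let `S` be the numerical
Néron-Severi lattice and `S⁰` its sublattice generated by the linearly independent classes of the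
curves `Γ_P` and of the pull-back `H` of a line, so that the dual of `S⁰` has the basis
`Γ_P / 2`, `H / 2`. The word is the image of the class of `D` under
`S → S / S⁰ ⊆ (S⁰)^∨ / S⁰ = Pow(Z(dG)) ⊕ 𝔽₂ → Pow(Z(dG))`: it is the set of all `P` such that the
coordinate `a P` of `D` at `Γ_P / 2` is odd, where the coordinates are read off from a relation
`2 D ∼ ∑ a P • Γ_P + c • H`. Such a linear equivalence exists for every `D`, since
the cover is purely inseparable of degree two, and it implies the numerical equivalence. -/
def word (D : Divisor G) : Set (ℙ k (Fin 3 → k)) :=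
  {P | P ∈ zeroDG G ∧ ∃ (a : ℙ k (Fin 3 → k) → ℤ) (c : ℤ),
    LinEquiv b (2 • D) (excDivisor G a + c • lineDivisor G) ∧ Odd (a P)}

/-- The proper transform in `X_G` of the plane curve `F = 0`: its inverse image with the components
`Γ_P` removed. -/
def properTransform (F : MvPolynomial (Fin 3) k) : Divisor G
  | .strict E => ordAbove G E.ideal (algebraMap (MvPolynomial (Fin 3) k) (Cover G) F)
  | .exc _ _ => 0

open scoped Classical in
/-- The proper transform in `X_G` of the plane curve `F = 0` with the reduced structure. -/
def reducedTransform (F : MvPolynomial (Fin 3) k) : Divisor G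
  | .strict E => if F ∈ E.ideal then 1 else 0
  | .exc _ _ => 0

/-- The plane curve `F = 0` is splitting in `X_G`: the proper transform of each of its irreducible
components is twice a reduced irreducible curve. -/
def IsSplitting (F : MvPolynomial (Fin 3) k) : Prop :=
  ∀ F', Irreducible F' → F' ∣ F → properTransform G F' = 2 • reducedTransform G F'

/-- The word `w_G(C)` of the splitting curve `C` defined by `F = 0`: the word of the reduced divisor
of which the proper transform of `C` is the double. -/
def curveWord (F : MvPolynomial (Fin 3) k) : Set (ℙ k (Fin 3 → k)) :=
  word b (reducedTransform G F)

end Surface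

end

end InsepCover

/-! In characteristic 2 squares are constants for differentiation, so F = cG + H² satisfies dF = c
dG. Two facts carry both directions. First, at a zero v of dG the matrix of second derivatives is
alternating and, by Euler, has v in its kernel, so it is governed by the single mixed derivative in
two directions independent of v; reducedness of Z(dG) makes this number non-zero (`hess_ne_zero`).
Second, a curve π = 0 splits exactly when G restricts to the square of a rational function on it
(`IsSquareOn`): along the curve π then has order 2 on the double cover, and otherwise order 1
(`ringOrd_of_isSquareOn`, `ringOrd_of_not_isSquareOn`).

For (1), put F = G_C G_D. A multiple factor of F would make dG vanish to second order along it, so F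
is squarefree. A singular point of F lies in Z(dG), where the non-degenerate quadratic part lets F
factor over power series into two transversal branches. Modulo any factor of F, a non-zero multiple
of G equals H², so the factor splits. The divisor of G_C yields a relation 2F_C ∼ -∑ ord_P(G_C) Γ_P
+ deg(G_C) H whose coefficients are forced (`mem_curveWord_iff`), so the word records the parity of
ord_P(G_C). When F passes through P in Z(dG) its order along Γ_P is exactly 2
(`BlowupChart.ord_eq_two`); it is shared as 1 + 1 if both curves contain P and as 2 + 0 otherwise.

For (2), splitting provides forms A, B with A prime to G_C and G_C dividing A²G - B²: on C the
fraction B/A is a square root of G. It is regular on each smooth branch. At a node its values on the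
two branches have the same square, hence agree in characteristic 2, so it is regular there too
(`IsFormalParameterSystem.mem_span_of_node`). Thus B lies in (A, G_C) locally, and then globally,
because a complete intersection ideal is saturated (`mem_span_of_pow_mul_mem`). Writing B = HA +
eG_C gives G_C ∣ G - H². The part of degree b produces G_D; if deg G_C > b, it would make G a
square, which is impossible. -/

namespace InsepCover

set_option linter.unusedSectionVars false

noncomputable section

/-! ### Homogeneous components and factors of forms. -/

section Homogeneous

variable {σ K : Type*} [Field K]

/-- The substitution `X i ↦ T * X i`, which records the degree in the variable `T`. -/
def gradingHom : MvPolynomial σ K →ₐ[K] Polynomial (MvPolynomial σ K) :=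
  aeval fun i => Polynomial.C (X i) * Polynomial.X

theorem aeval_mul_of_isHomogeneous {S : Type*} [CommRing S] [Algebra K S] {Z : MvPolynomial σ K}
    {n : ℕ} (hZ : Z.IsHomogeneous n) (s : σ → S) (c : S) :
    aeval (fun i => s i * c) Z = aeval s Z * c ^ n := by
  rw [aeval_def, aeval_def, eval₂_eq, eval₂_eq, Finset.sum_mul]
  refine Finset.sum_congr rfl fun d hd => ?_
  rw [mul_assoc]
  congr 1
  have hdn : d.degree = n := by
    by_contra h
    exact (mem_support_iff.mp hd) (hZ.coeff_eq_zero h)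
  simp_rw [mul_pow]
  rw [Finset.prod_mul_distrib, Finset.prod_pow_eq_pow_sum, ← hdn]
  rfl

theorem gradingHom_of_isHomogeneous {Z : MvPolynomial σ K} {n : ℕ} (hZ : Z.IsHomogeneous n) :
    gradingHom Z = Polynomial.C Z * Polynomial.X ^ n := by
  rw [gradingHom, aeval_mul_of_isHomogeneous hZ
    (fun i => (Polynomial.C (X i) : Polynomial (MvPolynomial σ K))) Polynomial.X]
  congr 1
  have : (aeval fun i => Polynomial.C (X i : MvPolynomial σ K)) =
      (Algebra.ofId (MvPolynomial σ K) (Polynomial (MvPolynomial σ K))).restrictScalars K := by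
    ext i
    simp [Algebra.ofId_apply]
  rw [this]
  rfl

theorem coeff_gradingHom (Z : MvPolynomial σ K) (n : ℕ) :
    (gradingHom Z).coeff n = homogeneousComponent n Z := by
  conv_lhs => rw [← sum_homogeneousComponent Z]
  rw [map_sum, Polynomial.finsetSum_coeff]
  simp_rw [gradingHom_of_isHomogeneous (homogeneousComponent_isHomogeneous _ Z),
    Polynomial.coeff_C_mul_X_pow]
  rw [Finset.sum_ite_eq (Finset.range (Z.totalDegree + 1)) n]
  split_ifs with h
  · rfl
  · rw [Finset.mem_range, not_lt] at h
    exact (homogeneousComponent_eq_zero _ _ (by omega)).symm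

/-- In the grading variable the product is a monomial, so its degree equals its trailing degree.
Both are additive, which forces the same equality for each factor. -/
theorem exists_isHomogeneous_of_mul {f g : MvPolynomial σ K} {n : ℕ}
    (h : (f * g).IsHomogeneous n) (h0 : f * g ≠ 0) : ∃ m, f.IsHomogeneous m := by
  have hf : f ≠ 0 := left_ne_zero_of_mul h0
  have hg : g ≠ 0 := right_ne_zero_of_mul h0
  have hinj : ∀ Z : MvPolynomial σ K, Z ≠ 0 → gradingHom Z ≠ 0 := by
    intro Z hZ h
    apply hZ
    rw [← sum_homogeneousComponent Z]
    exact Finset.sum_eq_zero fun i _ => by rw [← coeff_gradingHom, h, Polynomial.coeff_zero]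
  have key := gradingHom_of_isHomogeneous h
  rw [map_mul] at key
  have h1 := congrArg Polynomial.natDegree key
  have h2 := congrArg Polynomial.natTrailingDegree key
  rw [Polynomial.natDegree_mul (hinj f hf) (hinj g hg), Polynomial.natDegree_C_mul_X_pow _ _ h0] at h1
  rw [Polynomial.natTrailingDegree_mul (hinj f hf) (hinj g hg),
    Polynomial.natTrailingDegree_mul_X_pow (by simpa using h0),
    Polynomial.natTrailingDegree_C, zero_add] at h2
  have h3 := Polynomial.natTrailingDegree_le_natDegree (gradingHom f)
  have h4 := Polynomial.natTrailingDegree_le_natDegree (gradingHom g)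
  refine ⟨(gradingHom f).natDegree, ?_⟩
  have : f = homogeneousComponent (gradingHom f).natDegree f := by
    conv_lhs => rw [← sum_homogeneousComponent f]
    by_cases hm : (gradingHom f).natDegree ∈ Finset.range (f.totalDegree + 1)
    · refine Finset.sum_eq_single_of_mem _ hm fun j _ hj => ?_
      rw [← coeff_gradingHom]
      rcases lt_or_gt_of_ne hj with hj | hj
      · exact Polynomial.coeff_eq_zero_of_lt_natTrailingDegree (by omega)
      · exact Polynomial.coeff_eq_zero_of_natDegree_lt hj
    · rw [Finset.mem_range, not_lt] at hm
      exfalso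
      have := hinj f hf
      rw [← Polynomial.leadingCoeff_ne_zero, Polynomial.leadingCoeff, coeff_gradingHom] at this
      exact this (homogeneousComponent_eq_zero _ _ (by omega))
  have hc := homogeneousComponent_isHomogeneous (gradingHom f).natDegree f
  rwa [← this] at hc

theorem exists_isHomogeneous_of_dvd {f F : MvPolynomial σ K} {n : ℕ} (hF : F.IsHomogeneous n)
    (h0 : F ≠ 0) (h : f ∣ F) : ∃ m, f.IsHomogeneous m := by
  obtain ⟨g, rfl⟩ := h
  exact exists_isHomogeneous_of_mul hF h0

theorem homogeneousComponent_mul_of_isHomogeneous {f : MvPolynomial σ K} {m : ℕ}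
    (hf : f.IsHomogeneous m) (g : MvPolynomial σ K) (n : ℕ) :
    homogeneousComponent (m + n) (f * g) = f * homogeneousComponent n g := by
  rw [← coeff_gradingHom, map_mul, gradingHom_of_isHomogeneous hf, mul_assoc,
    Polynomial.coeff_C_mul, Polynomial.coeff_X_pow_mul', if_pos (Nat.le_add_right m n),
    coeff_gradingHom, Nat.add_sub_cancel_left]

theorem homogeneousComponent_mul_of_lt {f : MvPolynomial σ K} {m : ℕ}
    (hf : f.IsHomogeneous m) (g : MvPolynomial σ K) {n : ℕ} (h : n < m) :
    homogeneousComponent n (f * g) = 0 := by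
  rw [← coeff_gradingHom, map_mul, gradingHom_of_isHomogeneous hf, mul_assoc,
    Polynomial.coeff_C_mul, Polynomial.coeff_X_pow_mul', if_neg (by omega), mul_zero]

/-- Frobenius is additive, so the square of a sum of components has no cross terms. -/
theorem homogeneousComponent_sq [CharP K 2] (p : MvPolynomial σ K) (n : ℕ) :
    homogeneousComponent (2 * n) (p ^ 2) = homogeneousComponent n p ^ 2 := by
  have h : (gradingHom p) ^ 2 =
      ∑ i ∈ Finset.range (p.totalDegree + 1), gradingHom (homogeneousComponent i p) ^ 2 := by
    conv_lhs => rw [← sum_homogeneousComponent p, map_sum]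
    exact sum_pow_char 2 _ _
  rw [← coeff_gradingHom, map_pow, h, Polynomial.finsetSum_coeff]
  have : ∀ i, (gradingHom (homogeneousComponent i p) ^ 2).coeff (2 * n) =
      if n = i then homogeneousComponent i p ^ 2 else 0 := by
    intro i
    rw [gradingHom_of_isHomogeneous (homogeneousComponent_isHomogeneous _ p), mul_pow, ← pow_mul,
      ← Polynomial.C_pow, Polynomial.coeff_C_mul_X_pow]
    congr 1
    simp only [eq_iff_iff]
    omega
  simp_rw [this]
  rw [Finset.sum_ite_eq (Finset.range (p.totalDegree + 1)) n]
  split_ifs with h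
  · rfl
  · rw [Finset.mem_range, not_lt] at h
    rw [homogeneousComponent_eq_zero _ _ (by omega), zero_pow two_ne_zero]

end Homogeneous

/-! ### Partial derivatives in characteristic 2. -/

section Derivatives

variable {σ τ K : Type*} [Field K]

theorem pderiv_aeval [Fintype σ] (g : σ → MvPolynomial τ K) (i : τ) (r : MvPolynomial σ K) :
    pderiv i (aeval g r) = ∑ j, aeval g (pderiv j r) * pderiv i (g j) := by
  classical
  induction r using MvPolynomial.induction_on with
  | C c => simp [algebraMap_eq]
  | add p q hp hq => simp only [map_add, hp, hq, add_mul, Finset.sum_add_distrib]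
  | mul_X p n hp =>
    rw [map_mul, pderiv_mul, hp, aeval_X]
    simp only [pderiv_mul, map_add, map_mul, aeval_X, pderiv_X, add_mul, Finset.sum_add_distrib,
      Finset.sum_mul]
    congr 1
    · exact Finset.sum_congr rfl fun j _ => by ring
    · rw [Finset.sum_eq_single n]
      · simp
      · intro j _ hj
        rw [Pi.single_eq_of_ne hj.symm]; simp
      · simp

theorem pderiv_comm (i j : σ) (r : MvPolynomial σ K) :
    pderiv i (pderiv j r) = pderiv j (pderiv i r) := by
  classical
  induction r using MvPolynomial.induction_on with
  | C c => simp
  | add p q hp hq => simp [hp, hq]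
  | mul_X p n hp =>
    simp only [pderiv_mul, map_add, hp, pderiv_X]
    rcases eq_or_ne j n with rfl | hj <;> rcases eq_or_ne i j with rfl | hi <;>
      simp_all [Pi.single_apply] <;> split_ifs <;> simp

variable [CharP K 2]

theorem mvPolynomial_two_eq_zero : (2 : MvPolynomial σ K) = 0 := by
  exact_mod_cast CharP.cast_eq_zero (MvPolynomial σ K) 2

theorem pderiv_sq (i : σ) (r : MvPolynomial σ K) : pderiv i (r ^ 2) = 0 := by
  rw [sq, pderiv_mul, mul_comm, ← two_mul, mvPolynomial_two_eq_zero, zero_mul]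

/-- Differentiating xⁿ twice produces the factor n(n - 1), which is even. -/
theorem pderiv_pderiv_self (i : σ) (r : MvPolynomial σ K) : pderiv i (pderiv i r) = 0 := by
  classical
  induction r using MvPolynomial.induction_on with
  | C c => simp
  | add p q hp hq => simp [hp, hq]
  | mul_X p n hp =>
    simp only [pderiv_mul, map_add, hp, pderiv_X]
    rcases eq_or_ne n i with rfl | hn
    · simp [← two_mul, mvPolynomial_two_eq_zero]
    · simp [hn]

theorem pderiv_sq_mul (i : σ) (q r : MvPolynomial σ K) :
    pderiv i (q ^ 2 * r) = q ^ 2 * pderiv i r := by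
  rw [pderiv_mul, pderiv_sq, zero_mul, zero_add]

end Derivatives

/-! ### Linear coordinates adapted to a basis. -/

section DualForms

variable {K : Type*} [Field K]

/-- The linear forms dual to the basis `w` of `K ^ 3`. -/
def dualForm (w : Fin 3 → Fin 3 → K) (j : Fin 3) : MvPolynomial (Fin 3) K :=
  ∑ i, C ((Matrix.of w)⁻¹ i j) * X i

theorem dualForm_isHomogeneous (w : Fin 3 → Fin 3 → K) (j : Fin 3) :
    (dualForm w j).IsHomogeneous 1 :=
  IsHomogeneous.sum _ _ _ fun i _ => isHomogeneous_C_mul_X _ i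

variable {w : Fin 3 → Fin 3 → K} (hw : LinearIndependent K w)
include hw

theorem isUnit_det_of_linearIndependent : IsUnit (Matrix.of w).det := by
  rw [← Matrix.isUnit_iff_isUnit_det]
  exact Matrix.linearIndependent_rows_iff_isUnit.mp hw

theorem aeval_dualForm {S : Type*} [CommRing S] [Algebra K S] (s : Fin 3 → S) (j : Fin 3) :
    aeval (fun i => ∑ l, algebraMap K S (w l i) * s l) (dualForm w j) = s j := by
  have h := Matrix.mul_nonsing_inv _ (isUnit_det_of_linearIndependent hw)
  have hlj : ∀ l, ∑ i, w l i * (Matrix.of w)⁻¹ i j = if l = j then 1 else 0 := by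
    intro l
    have := congrFun (congrFun h l) j
    rwa [Matrix.mul_apply, Matrix.one_apply] at this
  simp only [dualForm, map_sum, map_mul, aeval_C, aeval_X, Finset.mul_sum]
  rw [Finset.sum_comm]
  calc ∑ l, ∑ i, algebraMap K S ((Matrix.of w)⁻¹ i j) * (algebraMap K S (w l i) * s l)
      = ∑ l, algebraMap K S (∑ i, w l i * (Matrix.of w)⁻¹ i j) * s l := by
        refine Finset.sum_congr rfl fun l _ => ?_
        rw [map_sum, Finset.sum_mul]
        exact Finset.sum_congr rfl fun i _ => by rw [map_mul]; ring
    _ = s j := by simp [hlj]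

theorem sum_C_mul_dualForm (i : Fin 3) : ∑ l, C (w l i) * dualForm w l = X i := by
  have h := Matrix.nonsing_inv_mul _ (isUnit_det_of_linearIndependent hw)
  have hil : ∀ m, ∑ l, (Matrix.of w)⁻¹ m l * w l i = if m = i then 1 else 0 := by
    intro m
    have := congrFun (congrFun h m) i
    rwa [Matrix.mul_apply, Matrix.one_apply] at this
  simp only [dualForm, Finset.mul_sum]
  rw [Finset.sum_comm]
  calc ∑ m, ∑ l, C (w l i) * (C ((Matrix.of w)⁻¹ m l) * X m)
      = ∑ m, C (∑ l, (Matrix.of w)⁻¹ m l * w l i) * (X m : MvPolynomial (Fin 3) K) := by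
        refine Finset.sum_congr rfl fun m _ => ?_
        rw [map_sum, Finset.sum_mul]
        exact Finset.sum_congr rfl fun l _ => by rw [map_mul]; ring
    _ = X i := by simp [hil]

theorem dualForm_ne_zero (j : Fin 3) : dualForm w j ≠ 0 := by
  intro h
  have := aeval_dualForm hw (fun _ => (1 : K)) j
  rw [h, map_zero] at this
  exact zero_ne_one this

/-- The change of coordinates sending `X j` to `dualForm w j`. -/
def dualEquiv : MvPolynomial (Fin 3) K ≃ₐ[K] MvPolynomial (Fin 3) K :=
  AlgEquiv.ofAlgHom (aeval (dualForm w)) (aeval fun i => ∑ l, C (w l i) * X l)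
    (by
      ext i : 1
      simp only [AlgHom.comp_apply, aeval_X, map_sum, map_mul, aeval_C, algebraMap_eq,
        AlgHom.id_apply]
      exact sum_C_mul_dualForm hw i)
    (by
      ext i : 1
      simp only [AlgHom.comp_apply, aeval_X, AlgHom.id_apply]
      exact aeval_dualForm hw X i)

theorem dualEquiv_X (j : Fin 3) : dualEquiv hw (X j) = dualForm w j := by
  simp [dualEquiv]

theorem dualForm_prime (j : Fin 3) : Prime (dualForm w j) := by
  rw [← dualEquiv_X hw j]
  exact (MulEquiv.prime_iff (dualEquiv hw)).mpr X_prime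

end DualForms

/-! ### Affine charts of the plane. -/

section Charts

variable {K : Type*} [Field K]

theorem exists_basis {v : Fin 3 → K} (hv : v ≠ 0) :
    ∃ a b : Fin 3 → K, LinearIndependent K ![v, a, b] := by
  obtain ⟨i, hi⟩ : ∃ i, v i ≠ 0 := Function.ne_iff.mp hv
  fin_cases i
  · refine ⟨Pi.single 1 1, Pi.single 2 1, ?_⟩
    have : IsUnit (Matrix.of ![v, Pi.single 1 1, Pi.single 2 1]) := by
      rw [Matrix.isUnit_iff_isUnit_det, Matrix.det_fin_three]
      simpa using hi
    exact Matrix.linearIndependent_rows_iff_isUnit.mpr this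
  · refine ⟨Pi.single 0 1, Pi.single 2 1, ?_⟩
    have : IsUnit (Matrix.of ![v, Pi.single 0 1, Pi.single 2 1]) := by
      rw [Matrix.isUnit_iff_isUnit_det, Matrix.det_fin_three]
      simpa using hi
    exact Matrix.linearIndependent_rows_iff_isUnit.mpr this
  · refine ⟨Pi.single 0 1, Pi.single 1 1, ?_⟩
    have : IsUnit (Matrix.of ![v, Pi.single 0 1, Pi.single 1 1]) := by
      rw [Matrix.isUnit_iff_isUnit_det, Matrix.det_fin_three]
      simpa using hi
    exact Matrix.linearIndependent_rows_iff_isUnit.mpr this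

/-- The restriction to the affine chart with origin `v` and axes `a`, `b`. -/
def chartHom (v a b : Fin 3 → K) : MvPolynomial (Fin 3) K →ₐ[K] MvPolynomial (Fin 2) K :=
  aeval fun i => C (v i) + X 0 * C (a i) + X 1 * C (b i)

theorem localEq_eq (F : MvPolynomial (Fin 3) K) (v a b : Fin 3 → K) :
    localEq F v a b = chartHom v a b F := rfl

theorem chartHom_dualForm {v a b : Fin 3 → K} (hw : LinearIndependent K ![v, a, b]) (j : Fin 3) :
    chartHom v a b (dualForm ![v, a, b] j) = ![1, X 0, X 1] j := by
  rw [← aeval_dualForm hw (![1, X 0, X 1] : Fin 3 → MvPolynomial (Fin 2) K) j, chartHom]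
  congr 2
  ext1 i
  simp [Fin.sum_univ_three, algebraMap_eq, mul_comm]

theorem eval_eq_aeval_chartHom (v a b : Fin 3 → K) (F : MvPolynomial (Fin 3) K) :
    eval (0 : Fin 2 → K) (chartHom v a b F) = eval v F := by
  have : ((aeval (0 : Fin 2 → K)).comp (chartHom v a b)) = aeval v := by
    ext i
    simp [chartHom]
  have h := DFunLike.congr_fun this F
  simpa [aeval_eq_eval] using h

/-- A homogeneous polynomial vanishes when it does so on a chart, relatively to an ideal generated
by homogeneous elements. -/
theorem exists_pow_mul_eq_of_chartHom {v a b : Fin 3 → K} (hw : LinearIndependent K ![v, a, b])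
    {Z A f : MvPolynomial (Fin 3) K} {n m l : ℕ} (hZ : Z.IsHomogeneous n) (hA : A.IsHomogeneous m)
    (hf : f.IsHomogeneous l) {u u' : MvPolynomial (Fin 2) K}
    (h : chartHom v a b Z = u * chartHom v a b A + u' * chartHom v a b f) :
    ∃ (N : ℕ) (r r' : MvPolynomial (Fin 3) K),
      dualForm ![v, a, b] 0 ^ N * Z = r * A + r' * f := by
  set L := dualForm ![v, a, b] 0 with hL
  have hL0 : L ≠ 0 := dualForm_ne_zero hw 0
  let Q := FractionRing (MvPolynomial (Fin 3) K)
  let ι := algebraMap (MvPolynomial (Fin 3) K) Q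
  have hιL : ι L ≠ 0 := by simpa [ι] using hL0
  have hC : ∀ c : K, ι (C c) = algebraMap K Q c := fun c =>
    (IsScalarTower.algebraMap_apply K (MvPolynomial (Fin 3) K) Q c).symm
  -- The inverse of dehomogenization: the affine coordinates go to L₁/L and L₂/L, so a form Z of
  -- degree n comes back as Z/Lⁿ, and denominators are powers of L.
  let ρ : MvPolynomial (Fin 2) K →ₐ[K] Q :=
    aeval ![ι (dualForm ![v, a, b] 1) * (ι L)⁻¹, ι (dualForm ![v, a, b] 2) * (ι L)⁻¹]
  have hρ : ∀ {Z : MvPolynomial (Fin 3) K} {n : ℕ}, Z.IsHomogeneous n →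
      ρ (chartHom v a b Z) = ι Z * (ι L)⁻¹ ^ n := by
    intro Z n hZ
    have h1 : ρ.comp (chartHom v a b) = aeval fun i => ι (X i) * (ι L)⁻¹ := by
      ext i
      simp only [AlgHom.comp_apply, chartHom, aeval_X, map_add, map_mul, ← algebraMap_eq,
        AlgHom.commutes, ρ]
      rw [← sum_C_mul_dualForm hw i]
      simp only [Fin.sum_univ_three, map_add, map_mul, Matrix.cons_val, hC]
      rw [← hL]
      linear_combination -algebraMap K Q (v i) * mul_inv_cancel₀ hιL
    have h2 := DFunLike.congr_fun h1 Z
    rw [AlgHom.comp_apply, aeval_mul_of_isHomogeneous hZ] at h2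
    rw [h2]
    congr 1
    have : (aeval fun i => ι (X i)) = (Algebra.ofId (MvPolynomial (Fin 3) K) Q).restrictScalars K := by
      ext i
      simp [ι, Algebra.ofId_apply]
    rw [this]; rfl
  have hden : ∀ u : MvPolynomial (Fin 2) K, ∃ (N : ℕ) (r : MvPolynomial (Fin 3) K),
      ρ u * ι L ^ N = ι r := by
    intro u
    induction u using MvPolynomial.induction_on with
    | C c => exact ⟨0, C c, by rw [hC, pow_zero, mul_one, ← algebraMap_eq, AlgHom.commutes]⟩
    | add p q hp hq =>
      obtain ⟨N, r, hr⟩ := hp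
      obtain ⟨M, s, hs⟩ := hq
      refine ⟨N + M, r * L ^ M + s * L ^ N, ?_⟩
      rw [map_add, map_add, map_mul, map_mul, ← hr, ← hs, map_pow, map_pow]
      ring
    | mul_X p i hp =>
      obtain ⟨N, r, hr⟩ := hp
      refine ⟨N + 1, r * dualForm ![v, a, b] (if i = 0 then 1 else 2), ?_⟩
      rw [map_mul, map_mul, ← hr, pow_succ]
      have hi : ρ (X i) * ι L = ι (dualForm ![v, a, b] (if i = 0 then 1 else 2)) := by
        fin_cases i <;> simp [ρ, inv_mul_cancel_right₀ hιL]
      rw [← hi]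
      ring
  have h' := congrArg ρ h
  rw [map_add, map_mul, map_mul, hρ hZ, hρ hA, hρ hf] at h'
  obtain ⟨N, r, hr⟩ := hden u
  obtain ⟨N', r', hr'⟩ := hden u'
  refine ⟨N + N' + m + l, r * L ^ (N' + n + l), r' * L ^ (N + n + m), ?_⟩
  have hι : Function.Injective ι := IsFractionRing.injective _ _
  apply hι
  simp only [map_add, map_mul, map_pow, ← hr, ← hr']
  have hk : ∀ j : ℕ, (ι L)⁻¹ ^ j * ι L ^ j = 1 := fun j => by
    rw [← mul_pow, inv_mul_cancel₀ hιL, one_pow]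
  linear_combination ι L ^ (N + N' + n + m + l) * h' - ι Z * ι L ^ (N + N' + m + l) * hk n +
    ρ u * ι A * ι L ^ (N + N' + n + l) * hk m + ρ u' * ι f * ι L ^ (N + N' + n + m) * hk l

end Charts

/-! ### Orders as lengths over local rings. -/

theorem ringOrd_eq_one {O : Type*} [CommRing O] [IsLocalRing O] {f : O}
    (hf : IsLocalRing.maximalIdeal O = Ideal.span {f}) : Ring.ord O f = 1 := by
  rw [Ring.ord, Module.length_eq_one_iff, isSimpleModule_iff_isCoatom, ← hf]
  exact Ideal.isMaximal_def.mp inferInstance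

/-- Multiplication by z embeds the residue field O/m in O/(f), and the quotient is again O/m; the
length is 1 + 1. -/
theorem ringOrd_eq_two {O : Type*} [CommRing O] [IsLocalRing O] {f z : O}
    (hm : IsLocalRing.maximalIdeal O = Ideal.span {f, z}) (hz2 : z ^ 2 ∈ Ideal.span {f})
    (hz : z ∉ Ideal.span {f}) : Ring.ord O f = 2 := by
  set m := IsLocalRing.maximalIdeal O with hmdef
  have hle : Ideal.span {f} ≤ m := by
    rw [hm]
    exact Ideal.span_mono (by simp)
  have hzm : m ≤ Submodule.comap (LinearMap.mul O O z) (Ideal.span {f}) := by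
    rw [hm, Ideal.span_le]
    rintro x hx
    rcases hx with rfl | rfl
    · change z * x ∈ Ideal.span {x}
      exact Ideal.mul_mem_left _ _ (Ideal.mem_span_singleton_self _)
    · change x * x ∈ Ideal.span {f}
      rwa [← sq]
  have hlen : Module.length O (O ⧸ m) = 1 := by
    rw [Module.length_eq_one_iff, isSimpleModule_iff_isCoatom]
    exact Ideal.isMaximal_def.mp inferInstance
  have key := Module.length_eq_add_of_exact (Submodule.mapQ m (Ideal.span {f}) (LinearMap.mul O O z) hzm)
    (Submodule.factor hle) ?_ (Submodule.factor_surjective hle) ?_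
  · rw [Ring.ord, key, hlen]
    norm_num
  · rw [← LinearMap.ker_eq_bot, LinearMap.ker_eq_bot']
    intro x hx
    obtain ⟨x, rfl⟩ := Submodule.Quotient.mk_surjective _ x
    rw [Submodule.mapQ_apply, Submodule.Quotient.mk_eq_zero] at hx
    rw [Submodule.Quotient.mk_eq_zero]
    by_contra hxm
    have hu : IsUnit x := by
      by_contra h
      exact hxm ((IsLocalRing.mem_maximalIdeal x).mpr h)
    exact hz ((Ideal.mul_unit_mem_iff_mem _ hu).mp hx)
  · intro y
    obtain ⟨y, rfl⟩ := Submodule.Quotient.mk_surjective _ y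
    constructor
    · intro hy
      have hy' : y ∈ m := (Submodule.Quotient.mk_eq_zero m).mp hy
      rw [hm, Ideal.mem_span_pair] at hy'
      obtain ⟨a, b, rfl⟩ := hy'
      refine ⟨Submodule.Quotient.mk b, ?_⟩
      rw [Submodule.mapQ_apply, Submodule.Quotient.eq]
      change z * b - (a * f + b * z) ∈ _
      rw [show z * b - (a * f + b * z) = -a * f by ring]
      exact Ideal.mul_mem_left _ _ (Ideal.mem_span_singleton_self _)
    · rintro ⟨b, hb⟩
      obtain ⟨b, rfl⟩ := Submodule.Quotient.mk_surjective _ b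
      rw [← hb]
      change (Submodule.Quotient.mk (z * b) : O ⧸ m) = 0
      rw [Submodule.Quotient.mk_eq_zero, hm]
      exact Ideal.mul_mem_right _ _ (Ideal.subset_span (by simp))

/-! ### The double cover and orders along its prime divisors. -/

section Cover

variable {R : Type*} [CommRing R] (g : R)

/-- The function `p + q * w` on the double cover. -/
def Cover.mk (p q : R) : Cover g := algebraMap R (Cover g) p + algebraMap R (Cover g) q * Cover.w g

theorem Cover.exists_eq_mk [Nontrivial R] (x : Cover g) : ∃ p q, x = Cover.mk g p q := by
  obtain ⟨f, rfl⟩ := AdjoinRoot.mk_surjective x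
  set m := (Polynomial.X : Polynomial R) ^ 2 - Polynomial.C g
  have h1 : AdjoinRoot.mk m f = AdjoinRoot.mk m (f %ₘ m) := by
    conv_lhs => rw [← Polynomial.modByMonic_add_div f m]
    rw [map_add, map_mul, AdjoinRoot.mk_self, zero_mul, add_zero]
  have h2 : (f %ₘ m).natDegree ≤ 1 := by
    have h := Polynomial.natDegree_modByMonic_lt f (Cover.monic g) (by
      intro h
      have := congrArg Polynomial.natDegree h
      rw [Polynomial.natDegree_X_pow_sub_C, Polynomial.natDegree_one] at this
      exact two_ne_zero this)
    rw [Polynomial.natDegree_X_pow_sub_C] at h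
    exact Nat.le_of_lt_succ h
  obtain ⟨q, p, hpq⟩ := Polynomial.exists_eq_X_add_C_of_natDegree_le_one h2
  refine ⟨p, q, ?_⟩
  rw [h1, hpq, map_add, map_mul, AdjoinRoot.mk_X, AdjoinRoot.mk_C, AdjoinRoot.mk_C, add_comm]
  rfl

theorem Cover.mk_eq_zero [Nontrivial R] {p q : R} (h : Cover.mk g p q = 0) : p = 0 ∧ q = 0 := by
  have h1 : AdjoinRoot.mk ((Polynomial.X : Polynomial R) ^ 2 - Polynomial.C g)
      (Polynomial.C q * Polynomial.X + Polynomial.C p) = 0 := by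
    rw [map_add, map_mul, AdjoinRoot.mk_X, AdjoinRoot.mk_C, AdjoinRoot.mk_C, add_comm]
    exact h
  rw [AdjoinRoot.mk_eq_zero] at h1
  have h2 : Polynomial.C q * Polynomial.X + Polynomial.C p = 0 := by
    by_contra h0
    refine (Cover.monic g).not_dvd_of_natDegree_lt h0 ?_ h1
    rw [Polynomial.natDegree_X_pow_sub_C]
    exact lt_of_le_of_lt Polynomial.natDegree_linear_le one_lt_two
  refine ⟨?_, ?_⟩
  · simpa using congrArg (fun r => Polynomial.coeff r 0) h2
  · simpa using congrArg (fun r => Polynomial.coeff r 1) h2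

theorem Cover.algebraMap_injective [Nontrivial R] : Function.Injective (algebraMap R (Cover g)) := by
  rw [injective_iff_map_eq_zero]
  intro p hp
  exact (Cover.mk_eq_zero g (p := p) (q := 0) (by rw [Cover.mk, hp, map_zero, zero_mul, add_zero])).1

theorem Cover.algebraMap_mul_mk (r p q : R) :
    algebraMap R (Cover g) r * Cover.mk g p q = Cover.mk g (r * p) (r * q) := by
  simp only [Cover.mk, map_mul]
  ring

theorem Cover.mk_inj [Nontrivial R] {p q p' q' : R} (h : Cover.mk g p q = Cover.mk g p' q') :
    p = p' ∧ q = q' := by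
  have h0 : Cover.mk g (p - p') (q - q') = 0 := by
    rw [← sub_eq_zero] at h
    rw [← h]
    simp only [Cover.mk, map_sub]
    ring
  exact ⟨sub_eq_zero.mp (Cover.mk_eq_zero g h0).1, sub_eq_zero.mp (Cover.mk_eq_zero g h0).2⟩

section CharTwo

variable [CharP R 2]

theorem Cover.mk_sq (p q : R) :
    Cover.mk g p q ^ 2 = algebraMap R (Cover g) (p ^ 2 + q ^ 2 * g) := by
  rw [Cover.mk, add_sq, Cover.two_eq_zero, map_add, map_mul, map_pow, map_pow, mul_pow,
    Cover.w_sq]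
  ring

/-- The square of p + qw is the norm p² + q²g in the base. It vanishes only for p = q = 0 when g is
not a square of a fraction, and norms are multiplicative. -/
theorem Cover.isDomain [IsDomain R] (hg : ∀ p q : R, p ^ 2 = q ^ 2 * g → q = 0) :
    IsDomain (Cover g) := by
  have hinj := Cover.algebraMap_injective g
  have : Nontrivial (Cover g) := hinj.nontrivial
  have h2 : (2 : R) = 0 := by exact_mod_cast CharP.cast_eq_zero R 2
  have key : ∀ p q : R, p ^ 2 + q ^ 2 * g = 0 → p = 0 ∧ q = 0 := by
    intro p q h
    have hq : q = 0 := hg p q (by linear_combination h - q ^ 2 * g * h2)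
    subst hq
    simpa using h
  have : NoZeroDivisors (Cover g) := by
    refine ⟨fun {x y} hxy => ?_⟩
    obtain ⟨p, q, rfl⟩ := Cover.exists_eq_mk g x
    obtain ⟨p', q', rfl⟩ := Cover.exists_eq_mk g y
    have h := congrArg (· ^ 2) hxy
    simp only [mul_pow, Cover.mk_sq, ← map_mul] at h
    rw [zero_pow two_ne_zero, ← map_zero (algebraMap R (Cover g))] at h
    rcases mul_eq_zero.mp (hinj h) with h | h
    · left
      obtain ⟨rfl, rfl⟩ := key _ _ h
      simp [Cover.mk]
    · right
      obtain ⟨rfl, rfl⟩ := key _ _ h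
      simp [Cover.mk]
  exact NoZeroDivisors.to_isDomain _

variable {F : R} {I : Ideal R} [I.IsPrime] (hI : I = Ideal.span {F})

/-- The function `g` restricts to the square of a rational function on the divisor `F = 0`. -/
def IsSquareOn (F : R) : Prop := ∃ α β : R, ¬ F ∣ α ∧ F ∣ α ^ 2 * g - β ^ 2

include hI

omit [CharP R 2] [I.IsPrime] in
theorem mk_mem_map_iff [Nontrivial R] {p q : R} :
    Cover.mk g p q ∈ I.map (algebraMap R (Cover g)) ↔ F ∣ p ∧ F ∣ q := by
  rw [hI, Ideal.map_span, Set.image_singleton, Ideal.mem_span_singleton]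
  constructor
  · rintro ⟨y, hy⟩
    obtain ⟨p', q', rfl⟩ := Cover.exists_eq_mk g y
    rw [Cover.algebraMap_mul_mk] at hy
    obtain ⟨rfl, rfl⟩ := Cover.mk_inj g hy
    exact ⟨dvd_mul_right _ _, dvd_mul_right _ _⟩
  · rintro ⟨⟨p, rfl⟩, ⟨q, rfl⟩⟩
    exact ⟨Cover.mk g p q, (Cover.algebraMap_mul_mk g F p q).symm⟩

theorem mk_mem_above_iff [Nontrivial R] {p q : R} :
    Cover.mk g p q ∈ above g I ↔ p ^ 2 + q ^ 2 * g ∈ I := by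
  constructor
  · intro h
    have h2 : Cover.mk g p q ^ 2 ∈ above g I := Ideal.pow_mem_of_mem _ h 2 two_pos
    rw [Cover.mk_sq] at h2
    obtain ⟨n, hn⟩ := h2
    rw [← map_pow] at hn
    have h3 : Cover.mk g ((p ^ 2 + q ^ 2 * g) ^ n) 0 ∈ I.map (algebraMap R (Cover g)) := by
      simpa [Cover.mk] using hn
    have h4 := ((mk_mem_map_iff g hI).mp h3).1
    rw [← Ideal.mem_span_singleton, ← hI] at h4
    exact Ideal.IsPrime.mem_of_pow_mem inferInstance _ h4
  · intro h
    refine ⟨2, ?_⟩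
    rw [Cover.mk_sq]
    exact Ideal.mem_map_of_mem _ h

theorem algebraMap_mem_above_iff [Nontrivial R] {r : R} :
    algebraMap R (Cover g) r ∈ above g I ↔ F ∣ r := by
  have h : algebraMap R (Cover g) r = Cover.mk g r 0 := by simp [Cover.mk]
  rw [h, mk_mem_above_iff g hI, ← Ideal.mem_span_singleton, ← hI]
  simp only [ne_eq, OfNat.ofNat_ne_zero, not_false_eq_true, zero_pow, zero_mul, add_zero]
  exact Ideal.IsPrime.pow_mem_iff_mem inferInstance 2 two_pos

/-- An element p + qw of the prime above I with q outside I would exhibit g as the square of p/q on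
the divisor. Hence F alone generates that prime. -/
theorem ringOrd_of_not_isSquareOn [Nontrivial R] (h : ¬ IsSquareOn g F) :
    Ring.ord (Localization.AtPrime (above g I))
      (algebraMap (Cover g) _ (algebraMap R (Cover g) F)) = 1 := by
  have h2 : (2 : R) = 0 := by exact_mod_cast CharP.cast_eq_zero R 2
  apply ringOrd_eq_one
  rw [← Localization.AtPrime.map_eq_maximalIdeal, ← Set.image_singleton, ← Ideal.map_span]
  congr 1
  ext x
  obtain ⟨p, q, rfl⟩ := Cover.exists_eq_mk g x
  have hspan : Ideal.span {algebraMap R (Cover g) F} = I.map (algebraMap R (Cover g)) := by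
    rw [hI, Ideal.map_span, Set.image_singleton]
  rw [hspan, mk_mem_above_iff g hI, mk_mem_map_iff g hI]
  have hmem : ∀ r, r ∈ I ↔ F ∣ r := fun r => by rw [hI, Ideal.mem_span_singleton]
  rw [← hmem, ← hmem]
  constructor
  · intro hN
    have hq : q ∈ I := by
      by_contra hq
      refine h ⟨q, p, by rwa [← hmem], ?_⟩
      rw [← hmem]
      convert hN using 1
      linear_combination -p ^ 2 * h2
    refine ⟨?_, hq⟩
    have : p ^ 2 ∈ I := by
      have := I.sub_mem hN (I.mul_mem_left (q * g) hq)
      convert this using 1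
      ring
    exact Ideal.IsPrime.mem_of_pow_mem inferInstance _ this
  · rintro ⟨hp, hq⟩
    exact I.add_mem (Ideal.pow_mem_of_mem _ hp 2 two_pos)
      (I.mul_mem_right _ (Ideal.pow_mem_of_mem _ hq 2 two_pos))

/-- The function z = β + αw has square divisible by F, so it vanishes on the divisor. Once α is
inverted, F and z generate the maximal ideal, while z is not a multiple of F. -/
theorem ringOrd_of_isSquareOn [Nontrivial R] (h : IsSquareOn g F) :
    Ring.ord (Localization.AtPrime (above g I))
      (algebraMap (Cover g) _ (algebraMap R (Cover g) F)) = 2 := by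
  have h2 : (2 : R) = 0 := by exact_mod_cast CharP.cast_eq_zero R 2
  have hmem : ∀ r, r ∈ I ↔ F ∣ r := fun r => by rw [hI, Ideal.mem_span_singleton]
  have hprime : I.IsPrime := inferInstance
  obtain ⟨α, β, hα, hαβ⟩ := h
  have hN : β ^ 2 + α ^ 2 * g ∈ I := by
    rw [hmem]
    convert hαβ using 1
    linear_combination β ^ 2 * h2
  set O := Localization.AtPrime (above g I)
  set ι := algebraMap (Cover g) O
  have hunit : ∀ r, ¬ F ∣ r → IsUnit (ι (algebraMap R (Cover g) r)) := by
    intro r hr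
    refine IsLocalization.map_units O
      (⟨algebraMap R (Cover g) r, ?_⟩ : (above g I).primeCompl)
    exact fun h => hr ((algebraMap_mem_above_iff g hI).mp h)
  apply ringOrd_eq_two (z := ι (Cover.mk g β α))
  · rw [← Localization.AtPrime.map_eq_maximalIdeal]
    apply le_antisymm
    · rw [Ideal.map_le_iff_le_comap]
      intro x hx
      obtain ⟨p, q, rfl⟩ := Cover.exists_eq_mk g x
      rw [Ideal.mem_comap]
      have hmul : ι (algebraMap R (Cover g) α) * ι (Cover.mk g p q) =
          ι (algebraMap R (Cover g) (α * p - q * β)) +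
            ι (algebraMap R (Cover g) q) * ι (Cover.mk g β α) := by
        simp only [← map_mul, ← map_add]
        congr 1
        simp only [Cover.mk, map_mul, map_sub]
        ring
      have hd : F ∣ α * p - q * β := by
        rw [← hmem]
        apply hprime.mem_of_pow_mem 2
        rw [mk_mem_above_iff g hI] at hx
        have := I.sub_mem (I.mul_mem_left (α ^ 2) hx) (I.mul_mem_left (q ^ 2) hN)
        convert this using 1
        linear_combination (q ^ 2 * β ^ 2 - α * p * q * β) * h2
      obtain ⟨t, ht⟩ := hd
      rw [← Ideal.unit_mul_mem_iff_mem _ (hunit α hα), hmul, ht, Ideal.mem_span_pair]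
      refine ⟨ι (algebraMap R (Cover g) t), ι (algebraMap R (Cover g) q), ?_⟩
      rw [map_mul, map_mul]
      ring
    · rw [Ideal.span_le]
      rintro x hx
      rcases hx with rfl | rfl
      · apply Ideal.mem_map_of_mem
        rw [algebraMap_mem_above_iff g hI]
      · apply Ideal.mem_map_of_mem
        rwa [mk_mem_above_iff g hI]
  · rw [← map_pow, Cover.mk_sq]
    obtain ⟨t, ht⟩ := (hmem _).mp hN
    rw [ht, map_mul, map_mul]
    exact Ideal.mul_mem_right _ _ (Ideal.mem_span_singleton_self _)
  · intro hz
    rw [← Set.image_singleton, ← Ideal.map_span,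
      IsLocalization.mem_map_algebraMap_iff (above g I).primeCompl] at hz
    obtain ⟨⟨⟨y, hy⟩, s⟩, hys⟩ := hz
    rw [← map_mul] at hys
    obtain ⟨c, hc⟩ := IsLocalization.exists_of_eq (M := (above g I).primeCompl) hys
    obtain ⟨y, rfl⟩ := Ideal.mem_span_singleton.mp hy
    have hs' : (c * s : Cover g) ∉ above g I := (c * s).2
    obtain ⟨p, q, hpq⟩ := Cover.exists_eq_mk g (c * s : Cover g)
    rw [hpq, mk_mem_above_iff g hI, hmem] at hs'
    -- Multiplying once more by the local unit c * s replaces it by its norm, a function on the base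
    -- prime to F. Comparing coefficients of w then makes F divide norm times α.
    have hfin : algebraMap R (Cover g) (p ^ 2 + q ^ 2 * g) * Cover.mk g β α =
        algebraMap R (Cover g) F * (Cover.mk g p q * c * y) := by
      rw [← Cover.mk_sq, ← hpq]
      simp only at hc
      linear_combination (c * s : Cover g) * hc
    obtain ⟨p', q', hpq'⟩ := Cover.exists_eq_mk g (Cover.mk g p q * c * y)
    rw [hpq', Cover.algebraMap_mul_mk, Cover.algebraMap_mul_mk] at hfin
    have h3 : F ∣ (p ^ 2 + q ^ 2 * g) * α := ⟨q', (Cover.mk_inj g hfin).2⟩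
    rw [← hmem] at h3 hs' hα
    exact (hprime.mem_or_mem h3).elim hs' hα

theorem ringOrd_of_not_dvd [Nontrivial R] {r : R} (h : ¬ F ∣ r) :
    Ring.ord (Localization.AtPrime (above g I))
      (algebraMap (Cover g) _ (algebraMap R (Cover g) r)) = 0 :=
  Ring.ord_of_isUnit (IsLocalization.map_units (Localization.AtPrime (above g I))
    (⟨algebraMap R (Cover g) r, fun hr => h ((algebraMap_mem_above_iff g hI).mp hr)⟩ :
      (above g I).primeCompl))

theorem ordAbove_of_not_isSquareOn [Nontrivial R] (h : ¬ IsSquareOn g F) :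
    ordAbove g I (algebraMap R (Cover g) F) = 1 := by
  rw [ordAbove, ringOrd_of_not_isSquareOn g hI h]
  rfl

theorem ordAbove_of_isSquareOn [Nontrivial R] (h : IsSquareOn g F) :
    ordAbove g I (algebraMap R (Cover g) F) = 2 := by
  rw [ordAbove, ringOrd_of_isSquareOn g hI h]
  rfl

theorem ordAbove_of_not_dvd [Nontrivial R] {r : R} (h : ¬ F ∣ r) :
    ordAbove g I (algebraMap R (Cover g) r) = 0 := by
  rw [ordAbove, ringOrd_of_not_dvd g hI h]
  rfl

theorem ordAbove_self_ne_zero [Nontrivial R] : ordAbove g I (algebraMap R (Cover g) F) ≠ 0 := by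
  by_cases h : IsSquareOn g F
  · rw [ordAbove_of_isSquareOn g hI h]
    exact two_ne_zero
  · rw [ordAbove_of_not_isSquareOn g hI h]
    exact one_ne_zero

variable [IsDomain R] [WfDvdMonoid R] [IsDomain (Cover g)]

/-- The square of x comes from the base, where it is a power of F times a local unit. Finiteness is
what makes `ordAbove` additive in spite of `toNat`. -/
theorem ringOrd_ne_top (hF : Prime F) {x : Cover g} (hx : x ≠ 0) :
    Ring.ord (Localization.AtPrime (above g I)) (algebraMap (Cover g) _ x) ≠ ⊤ := by
  have hnz : ∀ y : Cover g, y ≠ 0 → algebraMap (Cover g) (Localization.AtPrime (above g I)) y ∈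
      nonZeroDivisors (Localization.AtPrime (above g I)) := by
    intro y hy
    apply mem_nonZeroDivisors_of_ne_zero
    rw [Ne, FaithfulSMul.algebraMap_eq_zero_iff]
    exact hy
  obtain ⟨c, hc⟩ := Cover.exists_sq_eq g x
  have hc0 : c ≠ 0 := by
    rintro rfl
    rw [map_zero] at hc
    exact hx (pow_eq_zero_iff two_ne_zero |>.mp hc)
  obtain ⟨n, r, hr, rfl⟩ := WfDvdMonoid.max_power_factor hc0 hF.irreducible
  have hinj := Cover.algebraMap_injective g
  have h1 : Ring.ord (Localization.AtPrime (above g I)) (algebraMap (Cover g) _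
      (algebraMap R (Cover g) (F ^ n * r))) ≠ ⊤ := by
    have hF0 := hnz (algebraMap R (Cover g) F) (by
      rw [Ne, map_eq_zero_iff _ hinj]; exact hF.ne_zero)
    have hr0 : r ≠ 0 := right_ne_zero_of_mul hc0
    rw [map_mul, map_mul, map_pow, map_pow, Ring.ord_mul _ (hnz _ (by
      rw [Ne, map_eq_zero_iff _ hinj]; exact hr0)), Ring.ord_pow hF0, ringOrd_of_not_dvd g hI hr]
    by_cases h : IsSquareOn g F
    · rw [ringOrd_of_isSquareOn g hI h]
      rw [add_zero, nsmul_eq_mul]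
      exact_mod_cast ENat.natCast_ne_top (n * 2)
    · rw [ringOrd_of_not_isSquareOn g hI h]
      simp
  intro htop
  apply h1
  rw [← hc, pow_two x, map_mul, Ring.ord_mul _ (hnz x hx), htop]
  rfl

theorem ordAbove_mul (hF : Prime F) {x y : Cover g} (hx : x ≠ 0) (hy : y ≠ 0) :
    ordAbove g I (x * y) = ordAbove g I x + ordAbove g I y := by
  have hyz : algebraMap (Cover g) (Localization.AtPrime (above g I)) y ∈
      nonZeroDivisors (Localization.AtPrime (above g I)) := by
    apply mem_nonZeroDivisors_of_ne_zero
    rw [Ne, FaithfulSMul.algebraMap_eq_zero_iff]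
    exact hy
  rw [ordAbove, map_mul, Ring.ord_mul _ hyz,
    ENat.toNat_add (ringOrd_ne_top g hI hF hx) (ringOrd_ne_top g hI hF hy)]
  rfl

theorem ordAbove_pow (hF : Prime F) {x : Cover g} (hx : x ≠ 0) (n : ℕ) :
    ordAbove g I (x ^ n) = n * ordAbove g I x := by
  induction n with
  | zero =>
    rw [pow_zero, zero_mul, ← map_one (algebraMap R (Cover g))]
    exact ordAbove_of_not_dvd g hI fun h => hF.not_isUnit (isUnit_of_dvd_one h)
  | succ n ih =>
    rw [pow_succ, ordAbove_mul g hI hF (pow_ne_zero n hx) hx, ih]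
    ring

theorem ordAbove_pow_mul (hF : Prime F) {r : R} (hr : ¬ F ∣ r) (n : ℕ) :
    ordAbove g I (algebraMap R (Cover g) (F ^ n * r)) =
      n * ordAbove g I (algebraMap R (Cover g) F) := by
  have hinj := Cover.algebraMap_injective g
  have hF0 : algebraMap R (Cover g) F ≠ 0 := by
    rw [Ne, map_eq_zero_iff _ hinj]; exact hF.ne_zero
  have hr0 : algebraMap R (Cover g) r ≠ 0 := by
    rw [Ne, map_eq_zero_iff _ hinj]
    rintro rfl
    exact hr (dvd_zero _)
  rw [map_mul, map_pow, ordAbove_mul g hI hF (pow_ne_zero n hF0) hr0, ordAbove_pow g hI hF hF0,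
    ordAbove_of_not_dvd g hI hr, add_zero]

end CharTwo

end Cover

/-- After localizing at P, the element z lies in the radical of I. Otherwise some prime containing I
avoids the multiplicative set generated by z and the complement of P. -/
theorem exists_mul_pow_mem {R : Type*} [CommRing R] (I P : Ideal R) [P.IsPrime] (z : R)
    (h : ∀ q : Ideal R, q.IsPrime → I ≤ q → q ≤ P → z ∈ q) : ∃ s ∉ P, ∃ n : ℕ, s * z ^ n ∈ I := by
  by_contra! hcon
  have hdisj : Disjoint (I : Set R) (P.primeCompl ⊔ Submonoid.powers z : Submonoid R) := by
    rw [Set.disjoint_left]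
    intro x hxI hx
    obtain ⟨s, hs, y, ⟨n, rfl⟩, rfl⟩ := Submonoid.mem_sup.mp hx
    exact hcon s hs n hxI
  obtain ⟨q, hq, hIq, hqd⟩ := Ideal.exists_le_prime_disjoint I _ hdisj
  rw [Set.disjoint_left] at hqd
  have hqP : q ≤ P := by
    intro x hx
    by_contra hxP
    exact hqd hx (Submonoid.mem_sup_left hxP)
  exact hqd (h q hq hIq hqP) (Submonoid.mem_sup_right (Submonoid.mem_powers z))

/-! ### Reducedness of Z(dG) and non-degeneracy of the Hessian. -/

section Hessian

variable {K : Type*} [Field K]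

theorem eval_mul_of_isHomogeneous {Z : MvPolynomial (Fin 3) K} {n : ℕ} (hZ : Z.IsHomogeneous n)
    (v : Fin 3 → K) (c : K) : eval (fun i => v i * c) Z = eval v Z * c ^ n := by
  have := aeval_mul_of_isHomogeneous hZ v c
  simpa [aeval_eq_eval] using this

/-- A tangent vector of a reduced scheme of dimension zero is zero. -/
theorem tangent_eq_zero {I : Ideal (MvPolynomial (Fin 3) K)}
    (hred : IsReduced (MvPolynomial (Fin 3) K ⧸ I))
    (hdim : Ring.KrullDimLE 0 (MvPolynomial (Fin 3) K ⧸ I)) {v u : Fin 3 → K}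
    (hu : ∀ f ∈ I, ∑ i, u i * eval v (pderiv i f) = 0) : u = 0 := by
  classical
  set P : Ideal (MvPolynomial (Fin 3) K) := RingHom.ker (eval v)
  have hP : P.IsPrime := RingHom.ker_isPrime _
  -- In dimension zero every prime containing I is maximal, so only P can lie between I and P.
  have hPmax : ∀ q : Ideal (MvPolynomial (Fin 3) K), q.IsPrime → I ≤ q → q ≤ P → q = P := by
    intro q hq hIq hqP
    have h1 : (q.map (Ideal.Quotient.mk I)).IsPrime :=
      Ideal.map_isPrime_of_surjective Ideal.Quotient.mk_surjective (by rwa [Ideal.mk_ker])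
    have h2 := h1.isMaximal'
    have h3 := Ideal.comap_isMaximal_of_surjective (Ideal.Quotient.mk I)
      Ideal.Quotient.mk_surjective (K := q.map (Ideal.Quotient.mk I))
    rw [Ideal.comap_map_of_surjective _ Ideal.Quotient.mk_surjective, ← RingHom.ker_eq_comap_bot,
      Ideal.mk_ker, sup_eq_left.mpr hIq] at h3
    exact h3.eq_of_le hP.ne_top hqP
  have hIrad : I.IsRadical := (Ideal.isRadical_iff_quotient_reduced I).mpr hred
  ext l
  obtain ⟨s, hs, n, hsn⟩ := exists_mul_pow_mem I P (X l - C (v l)) (by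
    intro q hq hIq hqP
    rw [hPmax q hq hIq hqP]
    simp [P, RingHom.mem_ker])
  have hsz : s * (X l - C (v l)) ∈ I := by
    apply hIrad
    refine ⟨n + 1, ?_⟩
    have := I.mul_mem_left (s ^ n * (X l - C (v l))) hsn
    rw [mul_pow]
    convert this using 1
    ring
  -- The derivative of s * (X l - v l) at v along u is s(v) * u l, and s(v) is non-zero.
  have h := hu _ hsz
  have hterm : ∀ i, u i * eval v (pderiv i (s * (X l - C (v l)))) =
      if i = l then eval v s * u l else 0 := by
    intro i
    rw [pderiv_mul, map_add, map_mul, map_mul]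
    rcases eq_or_ne i l with rfl | hi
    · simp; ring
    · simp [hi, pderiv_X_of_ne hi.symm]
  simp_rw [hterm] at h
  rw [Finset.sum_ite_eq' Finset.univ l, if_pos (Finset.mem_univ l)] at h
  exact (mul_eq_zero.mp h).resolve_left hs

/-- The second derivative of `F` at `v` in the directions `a`, `b`. -/
def hess (F : MvPolynomial (Fin 3) K) (v a b : Fin 3 → K) : K :=
  ∑ i, ∑ j, b i * a j * eval v (pderiv i (pderiv j F))

theorem eval_pderiv_chartHom_zero (F : MvPolynomial (Fin 3) K) (v a b : Fin 3 → K) :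
    eval (0 : Fin 2 → K) (pderiv 0 (chartHom v a b F)) = ∑ j, a j * eval v (pderiv j F) := by
  rw [chartHom, pderiv_aeval, map_sum]
  refine Finset.sum_congr rfl fun j _ => ?_
  rw [map_mul, ← chartHom, eval_eq_aeval_chartHom, mul_comm]
  simp

theorem eval_pderiv_chartHom_one (F : MvPolynomial (Fin 3) K) (v a b : Fin 3 → K) :
    eval (0 : Fin 2 → K) (pderiv 1 (chartHom v a b F)) = ∑ j, b j * eval v (pderiv j F) := by
  rw [chartHom, pderiv_aeval, map_sum]
  refine Finset.sum_congr rfl fun j _ => ?_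
  rw [map_mul, ← chartHom, eval_eq_aeval_chartHom, mul_comm]
  simp

theorem pderiv_chartHom_zero (F : MvPolynomial (Fin 3) K) (v a b : Fin 3 → K) :
    pderiv 0 (chartHom v a b F) = chartHom v a b (∑ j, C (a j) * pderiv j F) := by
  rw [chartHom, pderiv_aeval, map_sum]
  refine Finset.sum_congr rfl fun j _ => ?_
  rw [map_mul, mul_comm]
  simp [algebraMap_eq]

theorem eval_pderiv_pderiv_chartHom (F : MvPolynomial (Fin 3) K) (v a b : Fin 3 → K) :
    eval (0 : Fin 2 → K) (pderiv 1 (pderiv 0 (chartHom v a b F))) = hess F v a b := by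
  rw [pderiv_chartHom_zero, eval_pderiv_chartHom_one, hess]
  refine Finset.sum_congr rfl fun i _ => ?_
  rw [map_sum, map_sum, Finset.mul_sum]
  refine Finset.sum_congr rfl fun j _ => ?_
  rw [pderiv_C_mul, map_mul, eval_C]
  ring

/-- If the mixed derivative vanished, the vector of second derivatives in direction c would pair to
zero with v (Euler), with a (assumption) and with c (alternating form), so c would be in the kernel.
Modulo v it would then be a non-zero tangent vector of the reduced zero-dimensional scheme Z(dG). -/
theorem hess_ne_zero [CharP K 2] {b : ℕ} {G : MvPolynomial (Fin 3) K} (hG : G ∈ U K b)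
    {v a c : Fin 3 → K} (hw : LinearIndependent K ![v, a, c])
    (hv : ∀ j, eval v (pderiv j G) = 0) : hess G v a c ≠ 0 := by
  classical
  intro h0
  have h2 : (2 : K) = 0 := by exact_mod_cast CharP.cast_eq_zero K 2
  obtain ⟨hGb, hchart⟩ := hG
  have hself : ∀ x i, eval x (pderiv i (pderiv i G)) = 0 := fun x i => by
    rw [pderiv_pderiv_self, map_zero]
  have hcomm : ∀ x i j, eval x (pderiv i (pderiv j G)) = eval x (pderiv j (pderiv i G)) :=
    fun x i j => by rw [pderiv_comm]
  have heuler : ∀ x, (∀ j, eval x (pderiv j G) = 0) → ∀ j,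
      ∑ i, x i * eval x (pderiv i (pderiv j G)) = 0 := by
    intro x hx j
    have h := congrArg (eval x) (hGb.pderiv (i := j)).sum_X_mul_pderiv
    simpa [hx] using h
  have hcol : ∀ j, ∑ i, c i * eval v (pderiv i (pderiv j G)) = 0 := by
    have hmv : (Matrix.of ![v, a, c]).mulVec
        (fun j => ∑ i, c i * eval v (pderiv i (pderiv j G))) = 0 := by
      ext l
      have e0 := heuler v hv 0
      have e1 := heuler v hv 1
      have e2 := heuler v hv 2
      have s0 := hself v 0
      have s1 := hself v 1
      have s2 := hself v 2
      have c1 := hcomm v 1 0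
      have c2 := hcomm v 2 0
      have c3 := hcomm v 2 1
      rw [hess] at h0
      simp only [Fin.sum_univ_three, s0, s1, s2, c1, c2, c3, mul_zero, zero_add, add_zero]
        at e0 e1 e2 h0
      fin_cases l
      · simp only [Matrix.mulVec, dotProduct, Fin.sum_univ_three, s0, s1, s2, c1, c2, c3,
          Matrix.of_apply, Matrix.cons_val, Fin.zero_eta, Pi.zero_apply, mul_zero, zero_add, add_zero]
        linear_combination c 0 * e0 + c 1 * e1 + c 2 * e2
      · simp only [Matrix.mulVec, dotProduct, Fin.sum_univ_three, s0, s1, s2, c1, c2, c3,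
          Matrix.of_apply, Matrix.cons_val, Fin.mk_one, Pi.zero_apply, mul_zero, zero_add, add_zero]
        linear_combination h0
      · simp only [Matrix.mulVec, dotProduct, Fin.sum_univ_three, s0, s1, s2, c1, c2, c3,
          Matrix.of_apply, Matrix.cons_val, Fin.reduceFinMk, Pi.zero_apply, mul_zero, zero_add,
          add_zero]
        linear_combination (c 0 * c 1 * eval v (pderiv 0 (pderiv 1 G)) +
          c 0 * c 2 * eval v (pderiv 0 (pderiv 2 G)) +
          c 1 * c 2 * eval v (pderiv 1 (pderiv 2 G))) * h2
    exact congrFun (Matrix.eq_zero_of_mulVec_eq_zero (isUnit_det_of_linearIndependent hw).ne_zero hmv)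
  have hv0 : v ≠ 0 := hw.ne_zero 0
  obtain ⟨i₀, hi₀⟩ : ∃ i, v i ≠ 0 := Function.ne_iff.mp hv0
  set v' : Fin 3 → K := fun i => v i * (v i₀)⁻¹ with hv'
  have hv'G : ∀ j, eval v' (pderiv j G) = 0 := fun j => by
    rw [hv', eval_mul_of_isHomogeneous hGb.pderiv, hv, zero_mul]
  have hcol' : ∀ j, ∑ i, c i * eval v' (pderiv i (pderiv j G)) = 0 := by
    intro j
    have : ∀ i, c i * eval v' (pderiv i (pderiv j G)) =
        c i * eval v (pderiv i (pderiv j G)) * (v i₀)⁻¹ ^ (b - 1 - 1) := fun i => by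
      rw [hv', eval_mul_of_isHomogeneous hGb.pderiv.pderiv, mul_assoc]
    simp_rw [this]
    rw [← Finset.sum_mul, hcol, zero_mul]
  have heuler' := heuler v' hv'G
  have hv'1 : v' i₀ = 1 := mul_inv_cancel₀ hi₀
  obtain ⟨hred, hdim⟩ := hchart i₀
  -- With v rescaled to v' on the plane X i₀ = 1, subtracting c i₀ times v' makes the vector tangent
  -- to that plane.
  have hu := tangent_eq_zero hred hdim (v := v') (u := fun i => c i - c i₀ * v' i) ?_
  · have h3 : c = (c i₀ * (v i₀)⁻¹) • v := by
      ext i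
      have := congrFun hu i
      simp only [Pi.zero_apply, sub_eq_zero] at this
      rw [this, hv']
      simp only [Pi.smul_apply, smul_eq_mul]
      ring
    rw [linearIndependent_finSucc'] at hw
    apply hw.2
    rw [h3]
    refine Submodule.smul_mem _ _ (Submodule.subset_span ⟨0, ?_⟩)
    simp [Fin.init]
  · intro f hf
    suffices h : eval v' f = 0 ∧ ∑ i, (c i - c i₀ * v' i) * eval v' (pderiv i f) = 0 from h.2
    induction hf using Submodule.span_induction with
    | mem x hx =>
      rcases hx with rfl | ⟨j, -, rfl⟩
      · refine ⟨by simp [hv'1], ?_⟩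
        rw [Finset.sum_eq_single i₀]
        · simp [hv'1]
        · intro i _ hi
          simp [pderiv_X_of_ne hi.symm]
        · simp
      · refine ⟨hv'G j, ?_⟩
        simp_rw [sub_mul, Finset.sum_sub_distrib, mul_assoc]
        rw [hcol', ← Finset.mul_sum, heuler', mul_zero, sub_zero]
    | zero => simp
    | add x y _ _ hx hy =>
      refine ⟨by rw [map_add, hx.1, hy.1, add_zero], ?_⟩
      simp_rw [map_add, mul_add, Finset.sum_add_distrib]
      rw [hx.2, hy.2, add_zero]
    | smul r x _ hx =>
      refine ⟨by rw [smul_eq_mul, map_mul, hx.1, mul_zero], ?_⟩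
      simp only [smul_eq_mul, pderiv_mul, map_add, map_mul, hx.1, mul_zero, zero_add]
      have := congrArg (eval v' r * ·) hx.2
      simp only [Finset.mul_sum, mul_zero] at this
      rw [← this]
      exact Finset.sum_congr rfl fun i _ => by ring

theorem exists_pderiv_ne_zero [CharP K 2] {b : ℕ} {G : MvPolynomial (Fin 3) K} (hG : G ∈ U K b) :
    ∃ j, pderiv j G ≠ 0 := by
  by_contra! h
  obtain ⟨a, c, hw⟩ := exists_basis (v := fun _ => (1 : K))
    (fun h => one_ne_zero (congrFun h 0))
  refine hess_ne_zero hG hw (fun j => by rw [h, map_zero]) ?_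
  simp [hess, h]

/-- Differentiation kills p² and leaves q² times a non-zero derivative of G. This is the input
making `Cover G` a domain. -/
theorem eq_zero_of_sq_eq [CharP K 2] {b : ℕ} {G : MvPolynomial (Fin 3) K} (hG : G ∈ U K b)
    (p q : MvPolynomial (Fin 3) K) (h : p ^ 2 = q ^ 2 * G) : q = 0 := by
  obtain ⟨j, hj⟩ := exists_pderiv_ne_zero hG
  have h1 := congrArg (pderiv j) h
  rw [pderiv_sq, pderiv_sq_mul] at h1
  exact pow_eq_zero_iff two_ne_zero |>.mp ((mul_eq_zero.mp h1.symm).resolve_right hj)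

/-- If π had no zero except possibly the origin, the Nullstellensatz would make it divide every
coordinate. -/
theorem exists_zero_of_prime [IsAlgClosed K] {π : MvPolynomial (Fin 3) K} (hπ : Prime π) :
    ∃ v, v ≠ 0 ∧ eval v π = 0 := by
  by_contra! h
  have hX : ∀ i, π ∣ X i := by
    intro i
    have h1 : X i ∈ vanishingIdeal K (zeroLocus K (Ideal.span {π})) := by
      rw [mem_vanishingIdeal_iff]
      intro v hv
      have hv0 : v = 0 := by
        by_contra hv0
        apply h v hv0
        have := hv π (Ideal.mem_span_singleton_self _)
        simpa [aeval_eq_eval] using this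
      simp [hv0]
    rw [vanishingIdeal_zeroLocus_eq_radical,
      ((Ideal.span_singleton_prime hπ.ne_zero).mpr hπ).radical, Ideal.mem_span_singleton] at h1
    exact h1
  have h0 : (X 0 : MvPolynomial (Fin 3) K) ∣ X 1 :=
    ((hπ.irreducible.associated_of_dvd X_prime.irreducible (hX 0)).symm.dvd).trans (hX 1)
  obtain ⟨t, ht⟩ := h0
  have := congrArg (eval (Pi.single 1 1 : Fin 3 → K)) ht
  simp at this

/-- A factor π² passes unchanged through differentiation, so π² divides every derivative of G, and
both dG and the Hessian vanish at a zero of π. -/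
theorem squarefree_of_mem_affineClass [IsAlgClosed K] [CharP K 2] {b : ℕ}
    {G F : MvPolynomial (Fin 3) K} (hG : G ∈ U K b) (hF : F ∈ affineClass b G) : Squarefree F := by
  obtain ⟨c, H, hc, -, hF⟩ := hF
  have hd : ∀ j, pderiv j F = C c * pderiv j G := by
    intro j
    rw [hF, map_add, pderiv_sq, add_zero, pderiv_C_mul]
  intro x hx
  by_contra hxu
  have hF0 : F ≠ 0 := by
    rintro rfl
    obtain ⟨j, hj⟩ := exists_pderiv_ne_zero hG
    have := hd j
    rw [map_zero] at this
    exact (mul_ne_zero (by simpa using hc) hj) this.symm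
  have hx0 : x ≠ 0 := by
    rintro rfl
    exact hF0 (by simpa using hx)
  obtain ⟨π, hπ, hπx⟩ := WfDvdMonoid.exists_irreducible_factor hxu hx0
  obtain ⟨r, hr⟩ := (mul_dvd_mul hπx hπx).trans hx
  rw [← sq] at hr
  obtain ⟨v, hv0, hv⟩ := exists_zero_of_prime hπ.prime
  have hdG : ∀ j, pderiv j G = C c⁻¹ * (π ^ 2 * pderiv j r) := by
    intro j
    rw [← pderiv_sq_mul, ← hr, hd, ← mul_assoc, ← C_mul, inv_mul_cancel₀ hc, C_1, one_mul]
  obtain ⟨a, d, hw⟩ := exists_basis hv0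
  refine hess_ne_zero hG hw (fun j => by simp [hdG, hv]) ?_
  rw [hess]
  refine Finset.sum_eq_zero fun i _ => Finset.sum_eq_zero fun j _ => ?_
  rw [hdG, pderiv_C_mul, pderiv_sq_mul]
  simp [hv]

end Hessian

/-! ### Factoring a non-degenerate quadratic singularity over power series. -/

section Node

variable {K : Type*} [Field K]

theorem constantCoeff_coe {σ : Type*} (f : MvPolynomial σ K) :
    MvPowerSeries.constantCoeff (f : MvPowerSeries σ K) = eval 0 f := by
  rw [← MvPowerSeries.coeff_zero_eq_constantCoeff_apply, coeff_coe, ← constantCoeff_eq,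
    ← eval_zero]

theorem exists_eq_C_add_X_mul (f : MvPolynomial (Fin 2) K) :
    ∃ p q, f = C (eval 0 f) + X 0 * p + X 1 * q := by
  induction f using MvPolynomial.induction_on with
  | C c => exact ⟨0, 0, by simp⟩
  | add f g hf hg =>
    obtain ⟨p, q, h⟩ := hf
    obtain ⟨p', q', h'⟩ := hg
    refine ⟨p + p', q + q', ?_⟩
    rw [map_add, C_add]
    linear_combination h + h'
  | mul_X f i _ =>
    fin_cases i
    · exact ⟨f, 0, by simp [mul_comm]⟩
    · exact ⟨0, f, by simp [mul_comm]⟩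

theorem exists_eq_quadratic {f : MvPolynomial (Fin 2) K} (h0 : eval 0 (pderiv 0 f) = 0)
    (h1 : eval 0 (pderiv 1 f) = 0) :
    ∃ p q r, f = C (eval 0 f) + X 0 ^ 2 * p + X 0 * X 1 * q + X 1 ^ 2 * r ∧
      eval 0 q = eval 0 (pderiv 1 (pderiv 0 f)) := by
  obtain ⟨f₁, f₂, hf⟩ := exists_eq_C_add_X_mul f
  have e1 : eval 0 f₁ = 0 := by
    rw [hf] at h0
    simpa using h0
  have e2 : eval 0 f₂ = 0 := by
    rw [hf] at h1
    simpa using h1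
  obtain ⟨p, q₁, hf₁⟩ := exists_eq_C_add_X_mul f₁
  obtain ⟨q₂, r, hf₂⟩ := exists_eq_C_add_X_mul f₂
  rw [e1, C_0, zero_add] at hf₁
  rw [e2, C_0, zero_add] at hf₂
  have key : f = C (eval 0 f) + X 0 ^ 2 * p + X 0 * X 1 * (q₁ + q₂) + X 1 ^ 2 * r := by
    linear_combination hf + X 0 * hf₁ + X 1 * hf₂
  refine ⟨p, q₁ + q₂, r, key, ?_⟩
  generalize eval 0 f = t at key
  rw [key]
  simp [pow_two]

theorem coeff_single_mul {σ : Type*} (i : σ) (f g : MvPowerSeries σ K) :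
    MvPowerSeries.coeff (Finsupp.single i 1) (f * g) =
      MvPowerSeries.coeff (Finsupp.single i 1) f * MvPowerSeries.constantCoeff g +
      MvPowerSeries.constantCoeff f * MvPowerSeries.coeff (Finsupp.single i 1) g := by
  classical
  rw [MvPowerSeries.coeff_mul, Finsupp.antidiagonal_single, Finset.sum_map,
    Finset.Nat.antidiagonal_succ]
  simp [add_comm]

variable [CharP K 2]

/-- Let c solve the equation of constant terms, with error s. In characteristic 2 the substitution l
= c + δ leaves s - qδ + pδ² = 0, and δ = (s/q)d reduces this to d = 1 + td² with t = ps/q². The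
Catalan series solves it. -/
theorem exists_root_quadratic [IsAlgClosed K] {σ : Type*} (p q r : MvPowerSeries σ K)
    (hq : MvPowerSeries.constantCoeff q ≠ 0) : ∃ l, p * l ^ 2 - q * l + r = 0 := by
  have h2 : (2 : MvPowerSeries σ K) = 0 := by
    have := congrArg (algebraMap K (MvPowerSeries σ K)) (show (2 : K) = 0 by
      exact_mod_cast CharP.cast_eq_zero K 2)
    rwa [map_ofNat, map_zero] at this
  obtain ⟨c, hc⟩ : ∃ c : K, MvPowerSeries.constantCoeff p * c ^ 2 -
      MvPowerSeries.constantCoeff q * c + MvPowerSeries.constantCoeff r = 0 := by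
    set P : Polynomial K := Polynomial.C (MvPowerSeries.constantCoeff p) * Polynomial.X ^ 2 -
      Polynomial.C (MvPowerSeries.constantCoeff q) * Polynomial.X +
      Polynomial.C (MvPowerSeries.constantCoeff r) with hP
    have hd : P.degree ≠ 0 := by
      intro hd
      have h1 : P.coeff 1 = 0 := Polynomial.coeff_eq_zero_of_degree_lt (by rw [hd]; norm_num)
      rw [hP] at h1
      simp [Polynomial.coeff_C, Polynomial.coeff_X_pow] at h1
      exact hq h1
    obtain ⟨c, hc⟩ := IsAlgClosed.exists_root P hd
    refine ⟨c, ?_⟩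
    simpa [hP, Polynomial.IsRoot] using hc
  set s := p * MvPowerSeries.C c ^ 2 - q * MvPowerSeries.C c + r with hs
  have hs0 : MvPowerSeries.constantCoeff s = 0 := by
    simpa [hs] using hc
  have hqi : q * q⁻¹ = 1 := MvPowerSeries.mul_inv_cancel q hq
  have ht : PowerSeries.HasSubst (p * s * q⁻¹ ^ 2) :=
    PowerSeries.HasSubst.of_constantCoeff_zero (by simp [hs0])
  set S : PowerSeries K := PowerSeries.map (Nat.castRingHom K) PowerSeries.catalanSeries
  have hS : S ^ 2 * PowerSeries.X + 1 = S := by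
    have := congrArg (PowerSeries.map (Nat.castRingHom K)) PowerSeries.catalanSeries_sq_mul_X_add_one
    simpa using this
  set d := PowerSeries.substAlgHom (R := K) ht S with hd
  have hd' : d ^ 2 * (p * s * q⁻¹ ^ 2) + 1 = d := by
    have := congrArg (PowerSeries.substAlgHom (R := K) ht) hS
    rwa [map_add, map_mul, map_pow, map_one, PowerSeries.substAlgHom_X] at this
  refine ⟨MvPowerSeries.C c + s * q⁻¹ * d, ?_⟩
  linear_combination s * hd' + hs.symm - s * d * hqi + p * MvPowerSeries.C c * s * q⁻¹ * d * h2

theorem isOrdinaryNode_of_hess [IsAlgClosed K] {F : MvPolynomial (Fin 3) K} {P : ℙ K (Fin 3 → K)}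
    (hP : IsSingularPoint F P)
    (hF : ∀ a b, LinearIndependent K ![P.rep, a, b] → hess F P.rep a b ≠ 0) :
    IsOrdinaryNode F P := by
  have h2 : (2 : K) = 0 := by exact_mod_cast CharP.cast_eq_zero K 2
  obtain ⟨a, b, hw⟩ := exists_basis P.rep_nonzero
  obtain ⟨p, q, r, hf, hq⟩ := exists_eq_quadratic (f := chartHom P.rep a b F)
    (by rw [eval_pderiv_chartHom_zero]; simp [hP.2]) (by rw [eval_pderiv_chartHom_one]; simp [hP.2])
  rw [eval_pderiv_pderiv_chartHom] at hq
  have hq0 : MvPowerSeries.constantCoeff (q : MvPowerSeries (Fin 2) K) ≠ 0 := by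
    have := hF a b hw
    rwa [← hq, ← constantCoeff_coe] at this
  rw [eval_eq_aeval_chartHom, hP.1, C_0, zero_add] at hf
  obtain ⟨l, hl⟩ := exists_root_quadratic (p : MvPowerSeries (Fin 2) K) q r hq0
  -- With the root l the equation factors as (x + yl)(xp + y(q - pl)). The first factor is η and the
  -- second is η + ξ; modulo 2 their linear parts have determinant q(0).
  refine ⟨a, b, hw, MvPowerSeries.X 0 * (p : MvPowerSeries (Fin 2) K) +
    MvPowerSeries.X 1 * ((q : MvPowerSeries (Fin 2) K) - (p : MvPowerSeries (Fin 2) K) * l) -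
    (MvPowerSeries.X 0 + MvPowerSeries.X 1 * l), MvPowerSeries.X 0 + MvPowerSeries.X 1 * l, 1,
    ⟨by simp, by simp, ?_⟩, isUnit_one, ?_⟩
  · simp only [map_add, map_sub, coeff_single_mul, MvPowerSeries.coeff_X,
      MvPowerSeries.constantCoeff_X, map_mul]
    have h01 : (Finsupp.single (0 : Fin 2) 1 = Finsupp.single (1 : Fin 2) 1) ↔ False := by
      simp [Finsupp.single_left_inj]
    have h10 : (Finsupp.single (1 : Fin 2) 1 = Finsupp.single (0 : Fin 2) 1) ↔ False := by
      simp [Finsupp.single_left_inj]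
    simp only [h01, h10, if_true, if_false]
    intro h
    apply hq0
    linear_combination -h + MvPowerSeries.constantCoeff (p : MvPowerSeries (Fin 2) K) *
      MvPowerSeries.constantCoeff l * h2
  · rw [localEq_eq, hf]
    push_cast
    linear_combination MvPowerSeries.X 1 ^ 2 * hl

end Node

/-! ### Splitting curves and squares on curves. -/

section Splitting

variable {k : Type*} [Field k] [CharP k 2] {G F : MvPolynomial (Fin 3) k}

theorem properTransform_eq_of_isSquareOn (hF : Irreducible F) (h : IsSquareOn G F) :
    properTransform G F = 2 • reducedTransform G F := by
  funext D
  cases D with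
  | strict E =>
    obtain ⟨n, F₀, hn, hF₀, hE⟩ := E.exists_eqn
    simp only [properTransform, Pi.smul_apply, reducedTransform]
    split_ifs with hFE
    · have hF' := hFE
      rw [hE, Ideal.mem_span_singleton] at hF'
      have hass := hF₀.associated_of_dvd hF hF'
      rw [ordAbove_of_isSquareOn G (hE.trans (Ideal.span_singleton_eq_span_singleton.mpr hass)) h]
      rfl
    · rw [hE, Ideal.mem_span_singleton] at hFE
      rw [ordAbove_of_not_dvd G hE hFE]
      rfl
  | exc P hP => simp [properTransform, reducedTransform]

theorem isSquareOn_of_properTransform_eq {n : ℕ} (hn : F.IsHomogeneous n) (hF : Irreducible F)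
    (h : properTransform G F = 2 • reducedTransform G F) : IsSquareOn G F := by
  by_contra hcon
  obtain ⟨E, hE⟩ : ∃ E : IrredCurve k, E.ideal = Ideal.span {F} :=
    ⟨⟨Ideal.span {F}, n, F, hn, hF, rfl⟩, rfl⟩
  have h1 := congrFun h (PrimeDivisor.strict E)
  have hFE : F ∈ E.ideal := hE ▸ Ideal.mem_span_singleton_self F
  simp only [properTransform, Pi.smul_apply, reducedTransform, if_pos hFE] at h1
  rw [ordAbove_of_not_isSquareOn G hE hcon] at h1
  norm_num at h1

/-- Modulo F the relation cG + H² = 0 says that √c and H are the denominator and numerator of a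
square root of G. -/
theorem isSquareOn_of_dvd [IsAlgClosed k] {b : ℕ} {F' : MvPolynomial (Fin 3) k}
    (hF' : F' ∈ affineClass b G) (hF : Irreducible F) (h : F ∣ F') : IsSquareOn G F := by
  obtain ⟨c, H, hc, -, rfl⟩ := hF'
  obtain ⟨d, hd⟩ := IsAlgClosed.exists_pow_nat_eq c two_pos
  refine ⟨C d, H, fun hdvd => ?_, ?_⟩
  · have hd0 : d ≠ 0 := by
      rintro rfl
      exact hc (by rw [← hd]; simp)
    exact hF.not_isUnit (isUnit_of_dvd_unit hdvd ((isUnit_iff_ne_zero.mpr hd0).map C))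
  · convert h using 1
    rw [← hd, C_pow]
    linear_combination -H ^ 2 * mvPolynomial_two_eq_zero (σ := Fin 3) (K := k)

end Splitting

/-! ### Orders along the exceptional curves. -/

section Blowup

variable {k : Type*} [Field k]

/-- The substitution `y = x * t`. -/
def blowupHom : MvPolynomial (Fin 2) k →ₐ[k] MvPolynomial (Fin 2) k := aeval ![X 0, X 0 * X 1]

theorem blowupHom_injective : Function.Injective (blowupHom (k := k)) := by
  let Q := FractionRing (MvPolynomial (Fin 2) k)
  let ι := algebraMap (MvPolynomial (Fin 2) k) Q
  have hι : Function.Injective ι := IsFractionRing.injective _ _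
  have h0 : ι (X 0) ≠ 0 := by
    rw [Ne, map_eq_zero_iff _ hι]
    exact X_ne_zero 0
  have h : (aeval ![ι (X 0), ι (X 1) * (ι (X 0))⁻¹]).comp (blowupHom (k := k)) =
      (Algebra.ofId (MvPolynomial (Fin 2) k) Q).restrictScalars k := by
    ext i
    fin_cases i
    · simp [blowupHom, Algebra.ofId_apply, ι]
    · simp only [blowupHom, AlgHom.comp_apply, aeval_X]
      simp [Algebra.ofId_apply, ι]
      rw [mul_comm, inv_mul_cancel_right₀ h0]
  intro x y hxy
  apply hι
  have hx := DFunLike.congr_fun h x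
  have hy := DFunLike.congr_fun h y
  rw [AlgHom.comp_apply] at hx hy
  rw [hxy] at hx
  exact hx.symm.trans hy

theorem X_zero_dvd_iff {f : MvPolynomial (Fin 2) k} :
    X 0 ∣ blowupHom f ↔ eval 0 f = 0 := by
  obtain ⟨p, q, h⟩ := exists_eq_C_add_X_mul f
  have hd : blowupHom f = C (eval 0 f) + X 0 * (blowupHom p + X 1 * blowupHom q) := by
    conv_lhs => rw [h]
    simp only [map_add, map_mul]
    simp [blowupHom, algebraMap_eq]
    ring
  rw [hd, dvd_add_left (dvd_mul_right _ _)]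
  constructor
  · rintro ⟨t, ht⟩
    have := congrArg (eval 0) ht
    simpa using this
  · intro h0
    rw [h0, C_0]
    exact dvd_zero _

theorem eval_zero_blowupHom (f : MvPolynomial (Fin 2) k) : eval 0 (blowupHom f) = eval 0 f := by
  have h : (aeval (0 : Fin 2 → k)).comp (blowupHom (k := k)) = aeval 0 := by
    ext i
    fin_cases i <;> simp [blowupHom]
  have := DFunLike.congr_fun h f
  simpa [aeval_eq_eval] using this

variable [CharP k 2] {G : MvPolynomial (Fin 3) k} {P : ℙ k (Fin 3 → k)}

theorem nonempty_blowupChart [IsAlgClosed k] (hP : P ∈ zeroDG G) : Nonempty (BlowupChart G P) := by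
  obtain ⟨a, b, hw⟩ := exists_basis P.rep_nonzero
  have hP' : ∀ j, eval P.rep (pderiv j G) = 0 := hP
  obtain ⟨p, q, r, hf, -⟩ := exists_eq_quadratic (f := chartHom P.rep a b G)
    (by rw [eval_pderiv_chartHom_zero]; simp [hP']) (by rw [eval_pderiv_chartHom_one]; simp [hP'])
  obtain ⟨s, hs⟩ := IsAlgClosed.exists_pow_nat_eq (eval 0 (chartHom P.rep a b G)) two_pos
  refine ⟨⟨a, b, hw, s, blowupHom p + X 1 * blowupHom q + X 1 ^ 2 * blowupHom r, ?_⟩⟩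
  rw [localEq_eq, hf, ← hs]
  simp only [blowupHom, map_add, map_mul, map_pow, aeval_X]
  simp [algebraMap_eq]
  ring

variable (c : BlowupChart G P)

/-- The restriction of polynomials to the chart of the blow-up of the plane. -/
def BlowupChart.baseHom : MvPolynomial (Fin 3) k →ₐ[k] MvPolynomial (Fin 2) k :=
  blowupHom.comp (chartHom P.rep c.e₁ c.e₂)

theorem BlowupChart.pullback_algebraMap (r : MvPolynomial (Fin 3) k) :
    c.pullback (algebraMap _ (Cover G) r) = algebraMap _ (Cover c.γ) (c.baseHom r) := by
  exact AdjoinRoot.lift_of _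

theorem BlowupChart.baseHom_ne_zero {r : MvPolynomial (Fin 3) k} {n : ℕ} (hr : r.IsHomogeneous n)
    (h0 : r ≠ 0) : c.baseHom r ≠ 0 := by
  intro h
  have h1 : chartHom P.rep c.e₁ c.e₂ r = 0 := blowupHom_injective (h.trans (map_zero _).symm)
  obtain ⟨N, u, u', hu⟩ := exists_pow_mul_eq_of_chartHom c.linearIndependent hr
    (isHomogeneous_zero _ _ 0) (isHomogeneous_zero _ _ 0) (u := 0) (u' := 0) (by simpa using h1)
  rw [mul_zero, mul_zero, add_zero] at hu
  exact mul_ne_zero (pow_ne_zero _ (dualForm_ne_zero c.linearIndependent 0)) h0 hu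

theorem BlowupChart.X_zero_dvd_baseHom_iff {r : MvPolynomial (Fin 3) k} :
    X 0 ∣ c.baseHom r ↔ OnCurve r P := by
  rw [BlowupChart.baseHom, AlgHom.comp_apply, X_zero_dvd_iff, eval_eq_aeval_chartHom]
  rfl

theorem BlowupChart.eqn' : X 0 ^ 2 * c.γ = c.baseHom G - C c.s ^ 2 := c.eqn

variable {b : ℕ} (hG : G ∈ U k b) (hP : P ∈ zeroDG G)
include hG hP

/-- Differentiating x²γ = g(x, xt) - s² in t, cancelling x and then differentiating in x identifies
∂γ/∂t at the origin with the mixed second derivative of g. -/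
theorem BlowupChart.eval_pderiv_ne_zero : eval 0 (pderiv 1 c.γ) ≠ 0 := by
  set g := chartHom P.rep c.e₁ c.e₂ G with hg
  have h0 : c.baseHom G = blowupHom g := rfl
  have d1 : ∀ f : MvPolynomial (Fin 2) k, pderiv 1 (blowupHom f) = blowupHom (pderiv 1 f) * X 0 := by
    intro f
    rw [blowupHom, pderiv_aeval]
    simp [Fin.sum_univ_two]
  have d0 : ∀ f : MvPolynomial (Fin 2) k, pderiv 0 (blowupHom f) =
      blowupHom (pderiv 0 f) + blowupHom (pderiv 1 f) * X 1 := by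
    intro f
    rw [blowupHom, pderiv_aeval]
    simp [Fin.sum_univ_two]
  have h1 := congrArg (pderiv 1) c.eqn'
  rw [map_sub, pderiv_sq_mul, pderiv_sq, sub_zero, h0, d1, sq, mul_assoc, mul_comm _ (X 0)] at h1
  have h2 := mul_left_cancel₀ (X_ne_zero 0) h1
  have h3 := congrArg (fun f => eval 0 (pderiv 0 f)) h2
  simp only [d0, pderiv_pderiv_self, pderiv_mul, map_add, map_mul, pderiv_X_self, one_mul,
    eval_X, Pi.zero_apply, zero_mul, mul_zero, add_zero, eval_zero_blowupHom] at h3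
  rw [h3, pderiv_comm, hg, eval_pderiv_pderiv_chartHom]
  exact hess_ne_zero hG c.linearIndependent hP

/-- If α²γ were a square modulo x, differentiation in t would make x divide α² ∂γ/∂t. Consequently x
has order one along Γ_P, and orders of functions from the plane are their x-adic orders. -/
theorem BlowupChart.not_isSquareOn : ¬ IsSquareOn c.γ (X 0) := by
  rintro ⟨α, β, hα, t, ht⟩
  have h1 := congrArg (pderiv 1) ht
  rw [map_sub, pderiv_sq_mul, pderiv_sq, sub_zero, pderiv_mul,
    pderiv_X_of_ne (by decide : (0 : Fin 2) ≠ 1), zero_mul, zero_add] at h1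
  have h2 : (X 0 : MvPolynomial (Fin 2) k) ∣ α ^ 2 * pderiv 1 c.γ := ⟨_, h1⟩
  rcases X_prime.dvd_or_dvd h2 with h | h
  · exact hα (X_prime.dvd_of_dvd_pow h)
  · obtain ⟨u, hu⟩ := h
    exact c.eval_pderiv_ne_zero hG hP (by rw [hu]; simp)

theorem BlowupChart.isDomain : IsDomain (Cover c.γ) := by
  refine Cover.isDomain _ fun p q h => ?_
  have h1 := congrArg (pderiv 1) h
  rw [pderiv_sq, pderiv_sq_mul] at h1
  refine pow_eq_zero_iff two_ne_zero |>.mp ((mul_eq_zero.mp h1.symm).resolve_right fun h => ?_)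
  exact c.eval_pderiv_ne_zero hG hP (by rw [h, map_zero])

theorem BlowupChart.ord_algebraMap {r : MvPolynomial (Fin 3) k} {r' : MvPolynomial (Fin 2) k}
    {n : ℕ} (h : c.baseHom r = X 0 ^ n * r') (hr' : ¬ X 0 ∣ r') :
    c.ord (algebraMap _ (Cover G) r) = n := by
  have := c.isDomain hG hP
  rw [BlowupChart.ord, c.pullback_algebraMap, h, ordAbove_pow_mul c.γ rfl X_prime hr',
    ordAbove_of_not_isSquareOn c.γ rfl (c.not_isSquareOn hG hP), mul_one]

theorem BlowupChart.ord_eq_zero {r : MvPolynomial (Fin 3) k} (h : ¬ OnCurve r P) :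
    c.ord (algebraMap _ (Cover G) r) = 0 :=
  c.ord_algebraMap hG hP (r' := c.baseHom r) (by rw [pow_zero, one_mul])
    (by rwa [c.X_zero_dvd_baseHom_iff])

theorem BlowupChart.ord_pos {r : MvPolynomial (Fin 3) k} {n : ℕ} (hr : r.IsHomogeneous n)
    (h0 : r ≠ 0) (h : OnCurve r P) : 0 < c.ord (algebraMap _ (Cover G) r) := by
  obtain ⟨m, r', hr', hm⟩ := WfDvdMonoid.max_power_factor (c.baseHom_ne_zero hr h0)
    (X_prime (R := k) (i := (0 : Fin 2))).irreducible
  rw [c.ord_algebraMap hG hP hm hr', Nat.pos_iff_ne_zero]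
  rintro rfl
  rw [pow_zero, one_mul] at hm
  rw [← hm, c.X_zero_dvd_baseHom_iff] at hr'
  exact hr' h

/-- With d² = c the coefficient of G, the pull-back of F is (ds + H)² + x²d²γ. Vanishing at P makes
x divide ds + H. After removal of x² there remains a square plus d²γ, which x cannot divide because
γ is not a square on x = 0. -/
theorem BlowupChart.ord_eq_two [IsAlgClosed k] {F : MvPolynomial (Fin 3) k}
    (hF : F ∈ affineClass b G) (h : OnCurve F P) : c.ord (algebraMap _ (Cover G) F) = 2 := by
  have h2 := mvPolynomial_two_eq_zero (σ := Fin 2) (K := k)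
  have hdvd := c.X_zero_dvd_baseHom_iff.mpr h
  obtain ⟨a, H, ha, -, rfl⟩ := hF
  obtain ⟨d, hd⟩ := IsAlgClosed.exists_pow_nat_eq a two_pos
  have hCa : c.baseHom (C a) = C d ^ 2 := by
    rw [← C_pow, hd, ← algebraMap_eq, AlgHom.commutes, algebraMap_eq]
  have hσ : c.baseHom (C a * G + H ^ 2) =
      (C d * C c.s + c.baseHom H) ^ 2 + X 0 ^ 2 * (C d ^ 2 * c.γ) := by
    rw [map_add, map_mul, map_pow, hCa]
    linear_combination -C d ^ 2 * c.eqn' - C d * C c.s * c.baseHom H * h2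
  rw [hσ, dvd_add_left ((dvd_pow_self _ two_ne_zero).mul_right _)] at hdvd
  obtain ⟨h', hh'⟩ := X_prime.dvd_of_dvd_pow hdvd
  refine c.ord_algebraMap hG hP (r' := h' ^ 2 + C d ^ 2 * c.γ) (by rw [hσ, hh']; ring) fun hd' => ?_
  refine c.not_isSquareOn hG hP ⟨C d, h', ?_, ?_⟩
  · rintro ⟨t, ht⟩
    have := congrArg (eval 0) ht
    simp at this
    exact ha (by rw [← hd, this]; simp)
  · convert hd' using 1
    linear_combination -h' ^ 2 * h2

end Blowup

/-! ### Divisors on the resolution and the words of splitting curves. -/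

section Word

variable {k : Type*} [Field k] [CharP k 2] {G : MvPolynomial (Fin 3) k} {b : ℕ}

/-- The square of `h` is a non-zero homogeneous polynomial. -/
def HasNorm (h : Cover G) : Prop :=
  ∃ (n : ℕ) (N : MvPolynomial (Fin 3) k), N.IsHomogeneous n ∧ N ≠ 0 ∧ h ^ 2 = algebraMap _ (Cover G) N

theorem HasNorm.mul {x y : Cover G} (hx : HasNorm x) (hy : HasNorm y) : HasNorm (x * y) := by
  obtain ⟨n, N, hn, hN, h⟩ := hx
  obtain ⟨m, M, hm, hM, h'⟩ := hy
  exact ⟨n + m, N * M, hn.mul hm, mul_ne_zero hN hM, by rw [mul_pow, h, h', map_mul]⟩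

theorem hasNorm_algebraMap {r : MvPolynomial (Fin 3) k} {n : ℕ} (hr : r.IsHomogeneous n)
    (h0 : r ≠ 0) : HasNorm (algebraMap _ (Cover G) r) :=
  ⟨n * 2, r ^ 2, hr.pow 2, pow_ne_zero 2 h0, (map_pow _ _ _).symm⟩

theorem HasNorm.pow {x : Cover G} (hx : HasNorm x) (n : ℕ) : HasNorm (x ^ n) := by
  induction n with
  | zero =>
    rw [pow_zero, ← map_one (algebraMap (MvPolynomial (Fin 3) k) (Cover G))]
    exact hasNorm_algebraMap (isHomogeneous_one _ _) one_ne_zero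
  | succ n ih =>
    rw [pow_succ]
    exact ih.mul hx

theorem HasNorm.ne_zero {x : Cover G} (hx : HasNorm x) : x ≠ 0 := by
  rintro rfl
  obtain ⟨n, N, hn, hN, h⟩ := hx
  rw [zero_pow two_ne_zero, ← map_zero (algebraMap (MvPolynomial (Fin 3) k) (Cover G))] at h
  exact hN (Cover.algebraMap_injective G h).symm

theorem Cover.IsHomogeneous.hasNorm (hb : Even b) (hGU : G ∈ U k b) {n : ℕ} {f : Cover G}
    (hf : Cover.IsHomogeneous b n f) (h0 : f ≠ 0) : HasNorm f := by
  have := Cover.isDomain G (eq_zero_of_sq_eq hGU)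
  obtain ⟨p, q, hp, hq, hpq⟩ := hf
  have hsq : f ^ 2 = algebraMap _ (Cover G) (p ^ 2 + q ^ 2 * G) := by
    rw [← Cover.mk_sq, hpq]
    rfl
  refine ⟨n * 2, p ^ 2 + q ^ 2 * G, (hp.pow 2).add ?_, ?_, hsq⟩
  · rcases hq with rfl | ⟨m, hm, hq⟩
    · rw [zero_pow two_ne_zero, zero_mul]
      exact isHomogeneous_zero _ _ _
    · have := (hq.pow 2).mul hGU.1
      rwa [show m * 2 + b = n * 2 by obtain ⟨c, rfl⟩ := hb; omega] at this
  · intro h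
    rw [h, map_zero] at hsq
    exact h0 (pow_eq_zero_iff two_ne_zero |>.mp hsq)

/-- The pull-back sets a linear form equal to 1, so it does kill some inhomogeneous elements; a
non-zero homogeneous norm survives. -/
theorem BlowupChart.pullback_ne_zero {P : ℙ k (Fin 3 → k)} (c : BlowupChart G P) {x : Cover G}
    (hx : HasNorm x) : c.pullback x ≠ 0 := by
  intro h
  obtain ⟨n, N, hn, hN, hxN⟩ := hx
  have h1 := congrArg c.pullback hxN
  rw [map_pow, h, zero_pow two_ne_zero, c.pullback_algebraMap,
    ← map_zero (algebraMap (MvPolynomial (Fin 2) k) (Cover c.γ))] at h1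
  exact c.baseHom_ne_zero hn hN (Cover.algebraMap_injective c.γ h1).symm

variable [IsAlgClosed k]

theorem ordExc_eq {P : ℙ k (Fin 3 → k)} (hP : P ∈ zeroDG G) :
    ∃ c : BlowupChart G P, ∀ h : Cover G, ordExc G P h = c.ord h :=
  ⟨(nonempty_blowupChart hP).some, fun _ => dif_pos (nonempty_blowupChart hP)⟩

theorem divisorOf_mul (hG : G ∈ U k b) {x y : Cover G} (hx : HasNorm x) (hy : HasNorm y)
    (D : PrimeDivisor G) : divisorOf G (x * y) D = divisorOf G x D + divisorOf G y D := by
  cases D with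
  | strict E =>
    have := Cover.isDomain G (eq_zero_of_sq_eq hG)
    obtain ⟨n, F₀, hn, hF₀, hE⟩ := E.exists_eqn
    simp only [divisorOf]
    rw [ordAbove_mul G hE hF₀.prime hx.ne_zero hy.ne_zero]
    push_cast
    rfl
  | exc P hP =>
    obtain ⟨c, hc⟩ := ordExc_eq hP
    have := c.isDomain hG hP
    simp only [divisorOf, hc, BlowupChart.ord]
    rw [map_mul, ordAbove_mul c.γ rfl X_prime (c.pullback_ne_zero hx) (c.pullback_ne_zero hy)]
    push_cast
    rfl

theorem divisorOf_pow (hG : G ∈ U k b) {x : Cover G} (hx : HasNorm x) (n : ℕ)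
    (D : PrimeDivisor G) : divisorOf G (x ^ n) D = n * divisorOf G x D := by
  induction n with
  | zero =>
    have h := divisorOf_mul hG (hx.pow 0) (hx.pow 0) D
    rw [pow_zero, one_mul] at h
    rw [pow_zero]
    push_cast
    linarith
  | succ n ih =>
    rw [pow_succ, divisorOf_mul hG (hx.pow n) hx, ih]
    push_cast
    ring

theorem divisorOf_nonneg (x : Cover G) (D : PrimeDivisor G) : 0 ≤ divisorOf G x D := by
  cases D <;> exact Int.natCast_nonneg _

/-- Each prime factor of u has positive order along its own curve, so it divides u' as well and can
be cancelled from both. -/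
theorem dvd_of_divisorOf_le (hG : G ∈ U k b) (u : MvPolynomial (Fin 3) k) :
    ∀ {n m : ℕ} {u' : MvPolynomial (Fin 3) k}, u.IsHomogeneous n → u'.IsHomogeneous m → u ≠ 0 →
      u' ≠ 0 → (∀ E, divisorOf G (algebraMap _ (Cover G) u) (.strict E) ≤
        divisorOf G (algebraMap _ (Cover G) u') (.strict E)) → u ∣ u' := by
  induction u using UniqueFactorizationMonoid.induction_on_prime with
  | h₁ => intro n m u' _ _ h; exact absurd rfl h
  | h₂ u hu => intro n m u' _ _ _ _ _; exact hu.dvd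
  | h₃ v π hv hπ ih =>
    intro n m u' hn hm h0 h0' hle
    obtain ⟨d, hd⟩ := exists_isHomogeneous_of_dvd hn h0 (dvd_mul_right π v)
    obtain ⟨e, he⟩ := exists_isHomogeneous_of_dvd hn h0 (dvd_mul_left v π)
    have hnπ := hasNorm_algebraMap (G := G) hd hπ.ne_zero
    have hnv := hasNorm_algebraMap (G := G) he hv
    have hmul : ∀ E, divisorOf G (algebraMap _ (Cover G) (π * v)) (.strict E) =
        divisorOf G (algebraMap _ (Cover G) π) (.strict E) +
          divisorOf G (algebraMap _ (Cover G) v) (.strict E) := fun E => by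
      rw [map_mul, divisorOf_mul hG hnπ hnv]
    have hdvd : π ∣ u' := by
      by_contra hcon
      obtain ⟨E, hE⟩ : ∃ E : IrredCurve k, E.ideal = Ideal.span {π} :=
        ⟨⟨Ideal.span {π}, d, π, hd, hπ.irreducible, rfl⟩, rfl⟩
      have h1 := hle E
      have h2 : divisorOf G (algebraMap _ (Cover G) u') (.strict E) = 0 := by
        simp only [divisorOf]
        rw [ordAbove_of_not_dvd G hE hcon]
        rfl
      have h3 : divisorOf G (algebraMap _ (Cover G) π) (.strict E) ≠ 0 := by
        simp only [divisorOf]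
        exact_mod_cast ordAbove_self_ne_zero G hE
      have h4 := divisorOf_nonneg (algebraMap _ (Cover G) π) (.strict E)
      have h5 := divisorOf_nonneg (algebraMap _ (Cover G) v) (.strict E)
      rw [hmul, h2] at h1
      omega
    obtain ⟨v', rfl⟩ := hdvd
    obtain ⟨e', he'⟩ := exists_isHomogeneous_of_dvd hm h0' (dvd_mul_left v' π)
    have hv' : v' ≠ 0 := right_ne_zero_of_mul h0'
    refine mul_dvd_mul_left π (ih he he' hv hv' fun E => ?_)
    have h1 := hle E
    rw [hmul, map_mul, divisorOf_mul hG hnπ (hasNorm_algebraMap he' hv')] at h1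
    linarith

theorem divisorOf_le_of_dvd (hG : G ∈ U k b) {u u' : MvPolynomial (Fin 3) k} {m : ℕ}
    (hm : u'.IsHomogeneous m) (h0 : u' ≠ 0) (h : u ∣ u') (D : PrimeDivisor G) :
    divisorOf G (algebraMap _ (Cover G) u) D ≤ divisorOf G (algebraMap _ (Cover G) u') D := by
  obtain ⟨v, rfl⟩ := h
  obtain ⟨d, hd⟩ := exists_isHomogeneous_of_dvd hm h0 (dvd_mul_right u v)
  obtain ⟨e, he⟩ := exists_isHomogeneous_of_dvd hm h0 (dvd_mul_left v u)
  rw [map_mul, divisorOf_mul hG (hasNorm_algebraMap hd (left_ne_zero_of_mul h0))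
    (hasNorm_algebraMap he (right_ne_zero_of_mul h0))]
  linarith [divisorOf_nonneg (algebraMap _ (Cover G) v) D]

theorem divisorOf_strict_eq_two_smul {F : MvPolynomial (Fin 3) k} (hG : G ∈ U k b)
    (hsq : Squarefree F) (hS : ∀ F', Irreducible F' → F' ∣ F → IsSquareOn G F') (E : IrredCurve k) :
    divisorOf G (algebraMap _ (Cover G) F) (.strict E) = 2 * reducedTransform G F (.strict E) := by
  have := Cover.isDomain G (eq_zero_of_sq_eq hG)
  obtain ⟨n, F₀, hn, hF₀, hE⟩ := E.exists_eqn
  simp only [divisorOf, reducedTransform]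
  split_ifs with hFE
  · rw [hE, Ideal.mem_span_singleton] at hFE
    obtain ⟨M, hM⟩ := id hFE
    have hM' : ¬ F₀ ∣ M := by
      intro h
      exact hF₀.not_isUnit (hsq F₀ (by rw [hM]; exact mul_dvd_mul_left _ h))
    have h1 := ordAbove_pow_mul G hE hF₀.prime hM' 1
    rw [pow_one, ← hM, ordAbove_of_isSquareOn G hE (hS F₀ hF₀ hFE)] at h1
    rw [h1]
    rfl
  · rw [hE, Ideal.mem_span_singleton] at hFE
    rw [ordAbove_of_not_dvd G hE hFE]
    rfl

/-- The function F / X₀ⁿ gives one relation, with coefficient -ord_P(F) at Γ_P. Any other has the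
same coefficients there: after squaring, the rational function comes from the plane, where
polynomials with equal orders along all strict curves divide each other and so have equal orders
along every Γ_P. -/
theorem mem_curveWord_iff (hb : Even b) (hG : G ∈ U k b) {F : MvPolynomial (Fin 3) k} {n : ℕ}
    (hF : F.IsHomogeneous n) (hsq : Squarefree F)
    (hS : ∀ F', Irreducible F' → F' ∣ F → IsSquareOn G F') (P : ℙ k (Fin 3 → k)) :
    P ∈ curveWord b G F ↔ P ∈ zeroDG G ∧ Odd (ordExc G P (algebraMap _ (Cover G) F)) := by
  have hF0 : F ≠ 0 := hsq.ne_zero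
  have hnF := hasNorm_algebraMap (G := G) hF hF0
  have hX : HasNorm (algebraMap (MvPolynomial (Fin 3) k) (Cover G) (X 0)) :=
    hasNorm_algebraMap (G := G) (isHomogeneous_X k 0) (X_ne_zero 0)
  rw [curveWord, word, Set.mem_ofPred_eq]
  refine and_congr_right fun hP => ⟨?_, fun hodd => ?_⟩
  · rintro ⟨a, m, ⟨l, f, f', hf0, hf'0, hf, hf', h⟩, ha⟩
    have hnf := hf.hasNorm hb hG hf0
    have hnf' := hf'.hasNorm hb hG hf'0
    obtain ⟨d, N, hd, hN, hfN⟩ := id hnf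
    obtain ⟨d', N', hd', hN', hfN'⟩ := id hnf'
    -- The integer m is split into its positive and negative parts, so that both sides of the
    -- squared relation are polynomials.
    set u₁ := F ^ 2 * N' * X 0 ^ (2 * (-m).toNat) with hu₁
    set u₂ := N * X 0 ^ (2 * m.toNat) with hu₂
    have hh₁ : u₁.IsHomogeneous _ := ((hF.pow 2).mul hd').mul (isHomogeneous_X_pow 0 _)
    have hh₂ : u₂.IsHomogeneous _ := hd.mul (isHomogeneous_X_pow 0 _)
    have h₁ : u₁ ≠ 0 := mul_ne_zero (mul_ne_zero (pow_ne_zero 2 hF0) hN')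
      (pow_ne_zero _ (X_ne_zero 0))
    have h₂ : u₂ ≠ 0 := mul_ne_zero hN (pow_ne_zero _ (X_ne_zero 0))
    have e₁ : ∀ D, divisorOf G (algebraMap _ (Cover G) u₁) D =
        2 * divisorOf G (algebraMap _ (Cover G) F) D + 2 * divisorOf G f' D +
          2 * (-m).toNat * divisorOf G (algebraMap (MvPolynomial (Fin 3) k) (Cover G) (X 0)) D := by
      intro D
      rw [hu₁, map_mul, map_mul, map_pow, map_pow, ← hfN',
        divisorOf_mul hG ((hnF.pow 2).mul (hnf'.pow 2)) (hX.pow _),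
        divisorOf_mul hG (hnF.pow 2) (hnf'.pow 2), divisorOf_pow hG hnF, divisorOf_pow hG hnf',
        divisorOf_pow hG hX]
      push_cast
      ring
    have e₂ : ∀ D, divisorOf G (algebraMap _ (Cover G) u₂) D =
        2 * divisorOf G f D + 2 * m.toNat * divisorOf G (algebraMap (MvPolynomial (Fin 3) k) (Cover G) (X 0)) D := by
      intro D
      rw [hu₂, map_mul, map_pow, ← hfN, divisorOf_mul hG (hnf.pow 2) (hX.pow _),
        divisorOf_pow hG hnf, divisorOf_pow hG hX]
      push_cast
      ring
    have hm : (m.toNat : ℤ) - (-m).toNat = m := by omega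
    have hstrict : ∀ E, divisorOf G (algebraMap _ (Cover G) u₁) (.strict E) =
        divisorOf G (algebraMap _ (Cover G) u₂) (.strict E) := by
      intro E
      have hE := congrFun h (.strict E)
      simp only [Pi.sub_apply, Pi.add_apply, Pi.smul_apply] at hE
      simp only [excDivisor, zero_add, smul_eq_mul, nsmul_eq_mul, lineDivisor] at hE
      rw [e₁, e₂, divisorOf_strict_eq_two_smul hG hsq hS]
      push_cast at hE
      linear_combination 2 * hE -
        2 * divisorOf G (algebraMap (MvPolynomial (Fin 3) k) (Cover G) (X 0)) (.strict E) * hm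
    have hd₁ := dvd_of_divisorOf_le hG u₁ hh₁ hh₂ h₁ h₂ fun E => (hstrict E).le
    have hd₂ := dvd_of_divisorOf_le hG u₂ hh₂ hh₁ h₂ h₁ fun E => (hstrict E).ge
    have hexc := le_antisymm (divisorOf_le_of_dvd hG hh₂ h₂ hd₁ (.exc P hP))
      (divisorOf_le_of_dvd hG hh₁ h₁ hd₂ (.exc P hP))
    rw [e₁, e₂] at hexc
    have hE := congrFun h (.exc P hP)
    simp only [Pi.sub_apply, Pi.add_apply, Pi.smul_apply] at hE
    simp only [excDivisor, smul_eq_mul, nsmul_eq_mul, lineDivisor, reducedTransform, mul_zero,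
      zero_sub] at hE
    have hfin : (ordExc G P (algebraMap _ (Cover G) F) : ℤ) = -a P := by
      have h3 : divisorOf G (algebraMap _ (Cover G) F) (.exc P hP) =
        (ordExc G P (algebraMap _ (Cover G) F) : ℤ) := rfl
      have h4 : 2 * (divisorOf G (algebraMap _ (Cover G) F) (.exc P hP)) = 2 * (-a P) := by
        linear_combination hexc - 2 * hE +
          2 * divisorOf G (algebraMap (MvPolynomial (Fin 3) k) (Cover G) (X 0)) (.exc P hP) * hm
      rw [← h3]
      exact mul_left_cancel₀ two_ne_zero h4
    rw [← Int.odd_coe_nat, hfin]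
    exact ha.neg
  · refine ⟨fun P => -(ordExc G P (algebraMap _ (Cover G) F) : ℤ), n,
      ⟨n, algebraMap _ (Cover G) F, algebraMap (MvPolynomial (Fin 3) k) (Cover G) (X 0 ^ n), hnF.ne_zero, ?_, ?_, ?_, ?_⟩, ?_⟩
    · rw [map_pow]
      exact (hX.pow n).ne_zero
    · exact ⟨F, 0, hF, Or.inl rfl, by rw [map_zero, zero_mul, add_zero]⟩
    · refine ⟨X 0 ^ n, 0, ?_, Or.inl rfl, by rw [map_zero, zero_mul, add_zero]⟩
      exact isHomogeneous_X_pow 0 n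
    · funext D
      simp only [Pi.sub_apply, Pi.add_apply, Pi.smul_apply]
      simp only [smul_eq_mul, nsmul_eq_mul, lineDivisor]
      rw [map_pow, divisorOf_pow hG hX]
      cases D with
      | strict E =>
        rw [divisorOf_strict_eq_two_smul hG hsq hS]
        simp only [excDivisor]
        push_cast
        ring
      | exc P hP =>
        simp only [excDivisor, reducedTransform, divisorOf]
        ring
    · exact ((Int.odd_coe_nat _).mpr hodd).neg

/-- At a point P of Z(dG) on FF' = 0 the orders of F and F' along Γ_P add up to 2. A curve has
positive order there exactly when it contains P, so odd order means that both do. -/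
theorem curveWord_eq (hb : Even b) (hG : G ∈ U k b) {F F' : MvPolynomial (Fin 3) k} {n n' : ℕ}
    (hF : F.IsHomogeneous n) (hF' : F'.IsHomogeneous n') (h : F * F' ∈ affineClass b G) :
    curveWord b G F = {P | OnCurve F P ∧ OnCurve F' P} := by
  have hsq := squarefree_of_mem_affineClass hG h
  have hF0 : F ≠ 0 := left_ne_zero_of_mul hsq.ne_zero
  have hF'0 : F' ≠ 0 := right_ne_zero_of_mul hsq.ne_zero
  ext P
  rw [mem_curveWord_iff hb hG hF (hsq.of_mul_left)
    fun π hπ hd => isSquareOn_of_dvd h hπ (hd.mul_right F'), Set.mem_ofPred_eq]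
  have key : P ∈ zeroDG G → ∃ c : BlowupChart G P,
      (∀ h : Cover G, ordExc G P h = c.ord h) ∧ (OnCurve (F * F') P →
      c.ord (algebraMap _ (Cover G) F) + c.ord (algebraMap _ (Cover G) F') = 2) := by
    intro hP
    obtain ⟨c, hc⟩ := ordExc_eq hP
    refine ⟨c, hc, fun hon => ?_⟩
    have h1 := divisorOf_mul hG (hasNorm_algebraMap hF hF0) (hasNorm_algebraMap hF' hF'0) (.exc P hP)
    rw [← map_mul] at h1
    simp only [divisorOf, hc] at h1
    rw [c.ord_eq_two hG hP h hon] at h1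
    exact_mod_cast h1.symm
  constructor
  · rintro ⟨hP, hodd⟩
    obtain ⟨c, hc, hc2⟩ := key hP
    rw [hc] at hodd
    have h1 : OnCurve F P := by
      by_contra hcon
      rw [c.ord_eq_zero hG hP hcon] at hodd
      exact Nat.not_odd_zero hodd
    refine ⟨h1, ?_⟩
    by_contra hcon
    have h2 := hc2 (by
      rw [OnCurve, map_mul]
      exact mul_eq_zero_of_left h1 _)
    rw [c.ord_eq_zero hG hP hcon, add_zero] at h2
    rw [h2] at hodd
    exact absurd hodd (by decide)
  · rintro ⟨h1, h2⟩
    -- By the Leibniz rule d(FF'), a non-zero multiple of dG, vanishes at every common point of the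
    -- two curves.
    have hP : P ∈ zeroDG G := by
      obtain ⟨a, H, ha, -, hFF'⟩ := h
      intro j
      have h3 := congrArg (fun f => eval P.rep (pderiv j f)) hFF'
      simp only [map_add, pderiv_sq, add_zero, pderiv_mul, pderiv_C, zero_mul, zero_add, map_mul,
        eval_C] at h3
      rw [OnCurve] at h1 h2
      rw [h1, h2, mul_zero, zero_mul, add_zero] at h3
      exact (mul_eq_zero.mp h3.symm).resolve_left ha
    refine ⟨hP, ?_⟩
    obtain ⟨c, hc, hc2⟩ := key hP
    have h3 := hc2 (by
      rw [OnCurve, map_mul]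
      exact mul_eq_zero_of_left h1 _)
    have h4 := c.ord_pos hG hP hF hF0 h1
    have h5 := c.ord_pos hG hP hF' hF'0 h2
    rw [hc, show c.ord (algebraMap _ (Cover G) F) = 1 by omega]
    exact odd_one

end Word

/-! ### Valuation arguments in a ring with a uniformizer. -/

section Uniformizer

variable {D : Type*} [CommRing D] {τ : D} (hτ : ∀ z : D, IsUnit z ∨ τ ∣ z) (hτu : ¬ IsUnit τ)
  (hτn : ∀ n : ℕ, τ ^ n ≠ 0)
include hτ hτu hτn

/-- The rings in view are those of smooth formal branches. Truncating at order n gives a valuation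
argument without showing that the powers of τ have zero intersection. -/
theorem pow_dvd_or_eq_pow_mul (n : ℕ) (z : D) :
    τ ^ n ∣ z ∨ ∃ j < n, ∃ v, IsUnit v ∧ z = τ ^ j * v := by
  induction n with
  | zero => exact Or.inl (by simp)
  | succ n ih =>
    rcases ih with ⟨y, rfl⟩ | ⟨j, hj, v, hv, rfl⟩
    · rcases hτ y with hy | ⟨t, rfl⟩
      · exact Or.inr ⟨n, n.lt_succ_self, y, hy, rfl⟩
      · exact Or.inl ⟨t, by ring⟩
    · exact Or.inr ⟨j, hj.trans n.lt_succ_self, v, hv, rfl⟩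

theorem pow_mul_sub_ne_zero {v : D} (hv : IsUnit v) (n : ℕ) (d : D) :
    τ ^ n * (v - τ * d) ≠ 0 := by
  intro h
  rcases hτ (v - τ * d) with hu | hd
  · exact hτn n ((hu.mul_left_eq_zero).mp h)
  · have h1 : τ ∣ v := (dvd_sub_left (dvd_mul_right τ d)).mp hd
    exact hτu (isUnit_of_dvd_unit h1 hv)

/-- Dividing a power of τ forces a to have a finite order j. If b had order i < j, then b² would
have order exactly 2i, yet a²g is divisible by τ to the power 2j. -/
theorem dvd_of_sq_mul_eq_sq {a b g : D} {N : ℕ} (ha : a ∣ τ ^ N) (h : a ^ 2 * g = b ^ 2) :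
    a ∣ b := by
  rcases pow_dvd_or_eq_pow_mul hτ hτu hτn (N + 1) a with hd | ⟨j, -, v, hv, rfl⟩
  · obtain ⟨c, hc⟩ := hd.trans ha
    exfalso
    refine pow_mul_sub_ne_zero hτ hτu hτn isUnit_one N c ?_
    linear_combination hc
  · rcases pow_dvd_or_eq_pow_mul hτ hτu hτn j b with hd | ⟨i, hi, v', hv', rfl⟩
    · rwa [hv.mul_right_dvd]
    · exfalso
      obtain ⟨l, rfl⟩ : ∃ l, j = i + 1 + l := ⟨j - i - 1, by omega⟩
      refine pow_mul_sub_ne_zero hτ hτu hτn (hv'.pow 2) (2 * i) (τ * τ ^ (2 * l) * v ^ 2 * g) ?_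
      linear_combination -h

end Uniformizer

/-! ### Power series in two variables: truncation, branches and nodes. -/

section PowerSeries

variable {K : Type*} [Field K]

theorem exists_truncation (f : MvPowerSeries (Fin 2) K) (N : ℕ) :
    ∃ (g : MvPolynomial (Fin 2) K) (p q : MvPowerSeries (Fin 2) K),
      f = (g : MvPowerSeries (Fin 2) K) + MvPowerSeries.X 0 ^ (N + 1) * p + MvPowerSeries.X 1 ^ (N + 1) * q := by
  classical
  set n : Fin 2 →₀ ℕ := Finsupp.equivFunOnFinite.symm fun _ => N
  set g := MvPowerSeries.trunc' K n f with hg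
  let h₀ : MvPowerSeries (Fin 2) K := fun m => if m 0 < N + 1 then 0 else MvPowerSeries.coeff m f
  have hc₀ : ∀ m, MvPowerSeries.coeff m h₀ = if m 0 < N + 1 then 0 else MvPowerSeries.coeff m f :=
    fun m => rfl
  have d₀ : (MvPowerSeries.X 0 : MvPowerSeries (Fin 2) K) ^ (N + 1) ∣ h₀ := by
    rw [MvPowerSeries.X_pow_dvd_iff]
    intro m hm
    rw [hc₀, if_pos hm]
  have d₁ : (MvPowerSeries.X 1 : MvPowerSeries (Fin 2) K) ^ (N + 1) ∣
      f - (g : MvPowerSeries (Fin 2) K) - h₀ := by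
    rw [MvPowerSeries.X_pow_dvd_iff]
    intro m hm
    rw [map_sub, map_sub, hc₀, coeff_coe, hg, MvPowerSeries.coeff_trunc']
    have hle : m ≤ n ↔ m 0 < N + 1 := by
      constructor
      · intro h
        exact Nat.lt_succ_of_le (h 0)
      · intro h i
        fin_cases i
        · exact Nat.le_of_lt_succ h
        · exact Nat.le_of_lt_succ hm
    by_cases h : m 0 < N + 1
    · rw [if_pos (hle.mpr h), if_pos h]; ring
    · rw [if_neg (fun h' => h (hle.mp h')), if_neg h]; ring
  obtain ⟨p, hp⟩ := d₀
  obtain ⟨q, hq⟩ := d₁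
  exact ⟨g, p, q, by rw [← hp, ← hq]; ring⟩

theorem exists_eq_X_mul_add {f : MvPowerSeries (Fin 2) K} (hf : MvPowerSeries.constantCoeff f = 0) :
    ∃ p q, f = MvPowerSeries.X 0 * p + MvPowerSeries.X 1 * q := by
  obtain ⟨g, p, q, h⟩ := exists_truncation f 0
  obtain ⟨p', q', h'⟩ := exists_eq_C_add_X_mul g
  have h0 : eval 0 g = 0 := by
    rw [h] at hf
    simpa [constantCoeff_coe] using hf
  rw [h0, C_0, zero_add] at h'
  refine ⟨p + p', q + q', ?_⟩
  rw [h, h']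
  push_cast
  ring

theorem exists_eq_X_pow_mul_add {Z : MvPolynomial (Fin 2) K} {N : ℕ}
    {p q : MvPowerSeries (Fin 2) K}
    (h : (Z : MvPowerSeries (Fin 2) K) = MvPowerSeries.X 0 ^ N * p + MvPowerSeries.X 1 ^ N * q) :
    ∃ p' q' : MvPolynomial (Fin 2) K, Z = X 0 ^ N * p' + X 1 ^ N * q' := by
  have hmem : Z ∈ Ideal.span ((fun s => monomial s (1 : K)) ''
      {Finsupp.single (0 : Fin 2) N, Finsupp.single 1 N}) := by
    rw [mem_ideal_span_monomial_image]
    intro m hm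
    by_contra! hcon
    simp only [Set.mem_insert_iff, Set.mem_singleton_iff, forall_eq_or_imp, forall_eq,
      Finsupp.single_le_iff, not_le] at hcon
    apply mem_support_iff.mp hm
    rw [← coeff_coe, h, map_add, MvPowerSeries.X_pow_dvd_iff.mp (dvd_mul_right _ _) m hcon.1,
      MvPowerSeries.X_pow_dvd_iff.mp (dvd_mul_right _ _) m hcon.2, add_zero]
  rw [Set.image_pair, ← X_pow_eq_monomial, ← X_pow_eq_monomial, Ideal.mem_span_pair] at hmem
  obtain ⟨a, b, hab⟩ := hmem
  exact ⟨a, b, by rw [← hab]; ring⟩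

/-- The restriction of a power series to a coordinate axis. -/
def axisRestriction (j : Fin 2) (f : MvPowerSeries (Fin 2) K) : PowerSeries K :=
  PowerSeries.mk fun n => MvPowerSeries.coeff (Finsupp.single j n) f

theorem axisRestriction_mul (j : Fin 2) (f g : MvPowerSeries (Fin 2) K) :
    axisRestriction j (f * g) = axisRestriction j f * axisRestriction j g := by
  classical
  ext n
  rw [PowerSeries.coeff_mul, axisRestriction, PowerSeries.coeff_mk, MvPowerSeries.coeff_mul,
    Finsupp.antidiagonal_single, Finset.sum_map]
  refine Finset.sum_congr rfl fun x _ => ?_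
  simp [axisRestriction]

theorem axisRestriction_eq_zero_iff {i j : Fin 2} (hij : i ≠ j) {f : MvPowerSeries (Fin 2) K} :
    axisRestriction j f = 0 ↔ MvPowerSeries.X i ∣ f := by
  rw [MvPowerSeries.X_dvd_iff]
  constructor
  · intro h m hm
    have hms : m = Finsupp.single j (m j) := by
      ext l
      rcases eq_or_ne l j with rfl | hl
      · simp
      · rw [Finsupp.single_eq_of_ne hl, show l = i by omega, hm]
    rw [hms]
    have := congrArg (PowerSeries.coeff (m j)) h
    simpa [axisRestriction] using this
  · intro h
    ext n
    rw [axisRestriction, PowerSeries.coeff_mk, map_zero]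
    exact h _ (Finsupp.single_eq_of_ne hij)

/-- Restriction to the other axis has kernel generated by `X i` and takes values in a domain, so one
factor of `X i` can be cancelled at a time. -/
theorem X_dvd_of_dvd_X_pow {i j : Fin 2} (hij : i ≠ j) {η : MvPowerSeries (Fin 2) K}
    (hη : ¬ IsUnit η) {n : ℕ} (h : η ∣ MvPowerSeries.X i ^ n) : MvPowerSeries.X i ∣ η := by
  induction n with
  | zero => exact absurd (isUnit_of_dvd_one (by simpa using h)) hη
  | succ n ih =>
    obtain ⟨e, he⟩ := h
    have h1 : axisRestriction j (η * e) = 0 := by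
      rw [axisRestriction_eq_zero_iff hij, ← he]
      exact dvd_pow_self _ n.succ_ne_zero
    rw [axisRestriction_mul, mul_eq_zero, axisRestriction_eq_zero_iff hij,
      axisRestriction_eq_zero_iff hij] at h1
    rcases h1 with h1 | ⟨e', rfl⟩
    · exact h1
    · refine ih ⟨e', ?_⟩
      have hX : (MvPowerSeries.X i : MvPowerSeries (Fin 2) K) ≠ 0 := by
        intro h
        have := congrArg (MvPowerSeries.coeff (Finsupp.single i 1)) h
        classical
        simp [MvPowerSeries.coeff_X] at this
      apply mul_left_cancel₀ hX
      linear_combination he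

section Parameters

variable {ξ η : MvPowerSeries (Fin 2) K} (h : IsFormalParameterSystem ξ η)
include h

theorem IsFormalParameterSystem.symm : IsFormalParameterSystem η ξ := by
  refine ⟨h.2.1, h.1, fun h0 => h.2.2 ?_⟩
  linear_combination -h0

theorem IsFormalParameterSystem.not_isUnit : ¬ IsUnit η := by
  rw [MvPowerSeries.isUnit_iff_constantCoeff, h.2.1]
  exact not_isUnit_zero

/-- Cramer's rule: the matrix expressing ξ and η through the coordinates has unit determinant, so ξ
and η generate the maximal ideal. -/
theorem IsFormalParameterSystem.exists_eq {z : MvPowerSeries (Fin 2) K}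
    (hz : MvPowerSeries.constantCoeff z = 0) : ∃ α β, z = ξ * α + η * β := by
  classical
  obtain ⟨ξ₀, ξ₁, hξ⟩ := exists_eq_X_mul_add h.1
  obtain ⟨η₀, η₁, hη⟩ := exists_eq_X_mul_add h.2.1
  have h01 : (Finsupp.single (0 : Fin 2) 1 = Finsupp.single (1 : Fin 2) 1) ↔ False := by
    simp [Finsupp.single_left_inj]
  have h10 : (Finsupp.single (1 : Fin 2) 1 = Finsupp.single (0 : Fin 2) 1) ↔ False := by
    simp [Finsupp.single_left_inj]
  have hdet := h.2.2
  rw [hξ, hη] at hdet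
  simp only [map_add, coeff_single_mul, MvPowerSeries.coeff_X, MvPowerSeries.constantCoeff_X,
    h01, h10, if_true, if_false, zero_mul, one_mul, add_zero, zero_add] at hdet
  have hu : (ξ₀ * η₁ - ξ₁ * η₀) * (ξ₀ * η₁ - ξ₁ * η₀)⁻¹ = 1 :=
    MvPowerSeries.mul_inv_cancel _ (by simpa using hdet)
  obtain ⟨p, q, hpq⟩ := exists_eq_X_mul_add hz
  set d := (ξ₀ * η₁ - ξ₁ * η₀)⁻¹
  refine ⟨(η₁ * p - η₀ * q) * d, (ξ₀ * q - ξ₁ * p) * d, ?_⟩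
  rw [hpq, hξ, hη]
  linear_combination -(MvPowerSeries.X 0 * p + MvPowerSeries.X 1 * q) * hu

/-- Otherwise η divides a power of each coordinate, since the coordinates lie in (ξ, η). Then both
coordinates divide η, and its linear part is zero. -/
theorem IsFormalParameterSystem.not_dvd_pow (n : ℕ) : ¬ η ∣ ξ ^ n := by
  classical
  intro hd
  have hX : ∀ i, η ∣ MvPowerSeries.X i ^ n := by
    intro i
    obtain ⟨α, β, hi⟩ := h.exists_eq (MvPowerSeries.constantCoeff_X i)
    have h1 := sub_dvd_pow_sub_pow (ξ * α + η * β) (ξ * α) n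
    rw [← hi, hi, add_sub_cancel_left, ← hi] at h1
    have h2 : η ∣ (ξ * α) ^ n := by
      rw [mul_pow]
      exact hd.mul_right _
    exact (dvd_sub_left h2).mp ((dvd_mul_right η β).trans h1)
  obtain ⟨p, hp⟩ := X_dvd_of_dvd_X_pow (by decide : (0 : Fin 2) ≠ 1) h.not_isUnit (hX 0)
  obtain ⟨q, hq⟩ := X_dvd_of_dvd_X_pow (by decide : (1 : Fin 2) ≠ 0) h.not_isUnit (hX 1)
  have h01 : (Finsupp.single (0 : Fin 2) 1 = Finsupp.single (1 : Fin 2) 1) ↔ False := by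
    simp [Finsupp.single_left_inj]
  have h10 : (Finsupp.single (1 : Fin 2) 1 = Finsupp.single (0 : Fin 2) 1) ↔ False := by
    simp [Finsupp.single_left_inj]
  have e0 : MvPowerSeries.coeff (Finsupp.single 0 1) η = 0 := by
    rw [hq, coeff_single_mul, MvPowerSeries.coeff_X, MvPowerSeries.constantCoeff_X]
    simp only [h01, if_false, zero_mul, add_zero]
  have e1 : MvPowerSeries.coeff (Finsupp.single 1 1) η = 0 := by
    rw [hp, coeff_single_mul, MvPowerSeries.coeff_X, MvPowerSeries.constantCoeff_X]
    simp only [h10, if_false, zero_mul, add_zero]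
  apply h.2.2
  rw [e0, e1, mul_zero, mul_zero, sub_zero]

theorem IsFormalParameterSystem.isUnit_or_dvd
    (z : MvPowerSeries (Fin 2) K ⧸ Ideal.span {η}) :
    IsUnit z ∨ Ideal.Quotient.mk (Ideal.span {η}) ξ ∣ z := by
  obtain ⟨z, rfl⟩ := Ideal.Quotient.mk_surjective z
  by_cases hz : MvPowerSeries.constantCoeff z = 0
  · right
    obtain ⟨α, β, rfl⟩ := h.exists_eq hz
    refine ⟨Ideal.Quotient.mk _ α, ?_⟩
    rw [← map_mul, Ideal.Quotient.eq, add_sub_cancel_left]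
    exact Ideal.mul_mem_right _ _ (Ideal.mem_span_singleton_self _)
  · left
    exact (MvPowerSeries.isUnit_iff_constantCoeff.mpr (isUnit_iff_ne_zero.mpr hz)).map _

theorem IsFormalParameterSystem.mk_pow_ne_zero (n : ℕ) :
    Ideal.Quotient.mk (Ideal.span {η}) ξ ^ n ≠ 0 := by
  rw [← map_pow, Ne, Ideal.Quotient.eq_zero_iff_mem, Ideal.mem_span_singleton]
  exact h.not_dvd_pow n

theorem IsFormalParameterSystem.not_isUnit_mk :
    ¬ IsUnit (Ideal.Quotient.mk (Ideal.span {η}) ξ) := by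
  rw [isUnit_iff_exists_inv]
  rintro ⟨c, hc⟩
  obtain ⟨c, rfl⟩ := Ideal.Quotient.mk_surjective c
  rw [← map_mul, ← map_one (Ideal.Quotient.mk _), Ideal.Quotient.eq, Ideal.mem_span_singleton] at hc
  obtain ⟨d, hd⟩ := hc
  have := congrArg MvPowerSeries.constantCoeff hd
  simp [h.1, h.2.1] at this

variable {a b g f : MvPowerSeries (Fin 2) K} {N : ℕ}

omit h in
theorem pow_mem_of_X_pow_mem {I : Ideal (MvPowerSeries (Fin 2) K)}
    (h0 : MvPowerSeries.X 0 ^ N ∈ I) (h1 : MvPowerSeries.X 1 ^ N ∈ I)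
    {z : MvPowerSeries (Fin 2) K} (hz : MvPowerSeries.constantCoeff z = 0) :
    z ^ (N + N) ∈ I := by
  obtain ⟨p, q, rfl⟩ := exists_eq_X_mul_add hz
  refine Ideal.add_pow_mem_of_pow_mem_of_le (m := N) (n := N) I ?_ ?_ (Nat.le_succ _)
  · rw [mul_pow]
    exact I.mul_mem_right _ h0
  · rw [mul_pow]
    exact I.mul_mem_right _ h1

/-- On a smooth branch a rational function with regular square is regular. -/
theorem IsFormalParameterSystem.exists_dvd_sub (h0 : MvPowerSeries.X 0 ^ N ∈ Ideal.span {a, η})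
    (h1 : MvPowerSeries.X 1 ^ N ∈ Ideal.span {a, η}) (hf : η ∣ a ^ 2 * g - b ^ 2) :
    ∃ e, η ∣ b - a * e ∧ MvPowerSeries.constantCoeff e ^ 2 = MvPowerSeries.constantCoeff g := by
  set π := Ideal.Quotient.mk (Ideal.span {η}) with hπ
  have hz : ∀ x, π x = 0 ↔ η ∣ x := fun x => by
    rw [hπ, Ideal.Quotient.eq_zero_iff_mem, Ideal.mem_span_singleton]
  have ha : π a ∣ π ξ ^ (N + N) := by
    obtain ⟨c, d, hcd⟩ := Ideal.mem_span_pair.mp (pow_mem_of_X_pow_mem h0 h1 h.1)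
    refine ⟨π c, ?_⟩
    rw [← map_pow, ← map_mul, ← sub_eq_zero, ← map_sub, hz]
    exact ⟨d, by linear_combination -hcd⟩
  have hsq : π a ^ 2 * π g = π b ^ 2 := by
    rw [← sub_eq_zero, ← map_pow, ← map_pow, ← map_mul, ← map_sub, hz]
    exact hf
  obtain ⟨e, he⟩ := dvd_of_sq_mul_eq_sq h.isUnit_or_dvd h.not_isUnit_mk h.mk_pow_ne_zero ha hsq
  obtain ⟨e, rfl⟩ := Ideal.Quotient.mk_surjective e
  refine ⟨e, by rw [← hz, map_sub, map_mul, he, sub_self], ?_⟩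
  -- If the constant terms differed, g - e² would be a unit and a² would vanish on the branch,
  -- although a divides a power of ξ there.
  by_contra hne
  have hu : IsUnit (g - e ^ 2) := by
    rw [MvPowerSeries.isUnit_iff_constantCoeff, map_sub, map_pow, isUnit_iff_ne_zero, sub_ne_zero]
    exact fun h => hne h.symm
  have h2 : π a ^ 2 * π (g - e ^ 2) = 0 := by
    rw [map_sub, map_pow, mul_sub, hsq, he]
    ring
  rw [(hu.map π).mul_left_eq_zero] at h2
  obtain ⟨t, ht⟩ := pow_dvd_pow_of_dvd ha 2
  rw [h2, zero_mul, ← pow_mul] at ht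
  exact h.mk_pow_ne_zero _ ht

/-- The local ring of an ordinary node is closed under extracting square roots of functions in its
total quotient ring. -/
theorem IsFormalParameterSystem.mem_span_of_node [CharP K 2]
    (h0 : MvPowerSeries.X 0 ^ N ∈ Ideal.span {a, ξ * η})
    (h1 : MvPowerSeries.X 1 ^ N ∈ Ideal.span {a, ξ * η}) (hf : ξ * η ∣ a ^ 2 * g - b ^ 2) :
    b ∈ Ideal.span {a, ξ * η} := by
  have hleη : Ideal.span {a, ξ * η} ≤ Ideal.span {a, η} := by
    rw [Ideal.span_le]
    rintro x (rfl | rfl)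
    · exact Ideal.subset_span (by simp)
    · exact Ideal.mul_mem_left _ _ (Ideal.subset_span (by simp))
  have hleξ : Ideal.span {a, ξ * η} ≤ Ideal.span {a, ξ} := by
    rw [Ideal.span_le]
    rintro x (rfl | rfl)
    · exact Ideal.subset_span (by simp)
    · exact Ideal.mul_mem_right _ _ (Ideal.subset_span (by simp))
  obtain ⟨e₁, ⟨t₁, ht₁⟩, hc₁⟩ := h.exists_dvd_sub (hleη h0) (hleη h1) ((dvd_mul_left _ _).trans hf)
  obtain ⟨e₂, ⟨t₂, ht₂⟩, hc₂⟩ :=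
    h.symm.exists_dvd_sub (hleξ h0) (hleξ h1) ((dvd_mul_right _ _).trans hf)
  -- The values of the square root on the two branches both have square g(0), and Frobenius is
  -- injective.
  have hc : MvPowerSeries.constantCoeff (e₁ - e₂) = 0 := by
    rw [map_sub, sub_eq_zero]
    exact frobenius_inj K 2 (by simpa [frobenius_def] using hc₁.trans hc₂.symm)
  obtain ⟨α, β, hαβ⟩ := h.exists_eq hc
  -- The series e₁ - ηβ = e₂ + ξα glues the two branches: it is e₁ modulo η and e₂ modulo ξ.
  have hη : b - a * (e₁ - η * β) = η * (t₁ + a * β) := by linear_combination ht₁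
  have hξ : b - a * (e₁ - η * β) = ξ * (t₂ - a * α) := by
    linear_combination ht₂ - a * hαβ
  -- The difference is ξy with η ∣ ξy. Modulo η, either y is a multiple of a power of ξ high enough
  -- to lie in (a, ξη), or it is a power of ξ times a unit, contradicting η ∣ ξy.
  have hmain : b - a * (e₁ - η * β) ∈ Ideal.span {a, ξ * η} := by
    rcases pow_dvd_or_eq_pow_mul h.isUnit_or_dvd h.not_isUnit_mk h.mk_pow_ne_zero (N + N)
      (Ideal.Quotient.mk (Ideal.span {η}) (t₂ - a * α)) with hd | ⟨j, -, v, hv, hj⟩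
    · obtain ⟨d, hd⟩ := hd
      obtain ⟨d, rfl⟩ := Ideal.Quotient.mk_surjective d
      rw [← map_pow, ← map_mul, Ideal.Quotient.eq, Ideal.mem_span_singleton] at hd
      obtain ⟨u, hu⟩ := hd
      have : b - a * (e₁ - η * β) = (ξ * d) * ξ ^ (N + N) + u * (ξ * η) := by
        linear_combination hξ + ξ * hu
      rw [this]
      exact Ideal.add_mem _ (Ideal.mul_mem_left _ _ (pow_mem_of_X_pow_mem h0 h1 h.1))
        (Ideal.mul_mem_left _ _ (Ideal.subset_span (by simp)))
    · exfalso
      have h2 : Ideal.Quotient.mk (Ideal.span {η}) ξ ^ (j + 1) * v = 0 := by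
        rw [pow_succ, mul_right_comm, ← hj, ← map_mul, Ideal.Quotient.eq_zero_iff_mem,
          Ideal.mem_span_singleton, mul_comm, ← hξ, hη]
        exact dvd_mul_right _ _
      rw [hv.mul_left_eq_zero] at h2
      exact h.mk_pow_ne_zero _ h2
  have : b = (b - a * (e₁ - η * β)) + (e₁ - η * β) * a := by ring
  rw [this]
  exact Ideal.add_mem _ hmain (Ideal.mul_mem_left _ _ (Ideal.subset_span (by simp)))

theorem IsFormalParameterSystem.mem_span (h0 : MvPowerSeries.X 0 ^ N ∈ Ideal.span {a, η})
    (h1 : MvPowerSeries.X 1 ^ N ∈ Ideal.span {a, η}) (hf : η ∣ a ^ 2 * g - b ^ 2) :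
    b ∈ Ideal.span {a, η} := by
  obtain ⟨e, ⟨t, ht⟩, -⟩ := h.exists_dvd_sub h0 h1 hf
  rw [Ideal.mem_span_pair]
  exact ⟨e, t, by linear_combination -ht⟩

end Parameters

end PowerSeries

/-! ### Homogeneous square roots of G on a curve. -/

section Homogeneous

variable {σ K : Type*} [Field K]

theorem dvd_homogeneousComponent {F g : MvPolynomial σ K} {m : ℕ} (hF : F.IsHomogeneous m)
    (h : F ∣ g) (n : ℕ) : F ∣ homogeneousComponent n g := by
  obtain ⟨e, rfl⟩ := h
  rcases le_or_gt m n with hmn | hmn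
  · obtain ⟨l, rfl⟩ := Nat.exists_eq_add_of_le hmn
    rw [homogeneousComponent_mul_of_isHomogeneous hF]
    exact dvd_mul_right _ _
  · rw [homogeneousComponent_mul_of_lt hF e hmn]
    exact dvd_zero _

theorem homogeneousComponent_mem_span_pair {A F g : MvPolynomial σ K} {n m : ℕ}
    (hA : A.IsHomogeneous n) (hF : F.IsHomogeneous m) (h : g ∈ Ideal.span {A, F}) (l : ℕ) :
    homogeneousComponent l g ∈ Ideal.span {A, F} := by
  obtain ⟨p, q, rfl⟩ := Ideal.mem_span_pair.mp h
  obtain ⟨p', hp⟩ := dvd_homogeneousComponent hA (dvd_mul_left A p) l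
  obtain ⟨q', hq⟩ := dvd_homogeneousComponent hF (dvd_mul_left F q) l
  rw [map_add, hp, hq]
  exact Ideal.mem_span_pair.mpr ⟨p', q', by ring⟩

variable [CharP K 2]

/-- Squaring creates no cross terms, so a component of α of degree n and that of β of degree n + b/2
alone determine the part of degree b + 2n. -/
theorem exists_isHomogeneous_of_isSquareOn {G F : MvPolynomial σ K} {b m : ℕ} (hb : Even b)
    (hG : G.IsHomogeneous b) (hF : F.IsHomogeneous m) (h : IsSquareOn G F) :
    ∃ (n : ℕ) (A B : MvPolynomial σ K), A.IsHomogeneous n ∧ B.IsHomogeneous (n + b / 2) ∧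
      ¬ F ∣ A ∧ F ∣ A ^ 2 * G - B ^ 2 := by
  obtain ⟨α, β, hα, hd⟩ := h
  obtain ⟨n, hn⟩ : ∃ n, ¬ F ∣ homogeneousComponent n α := by
    by_contra! hcon
    apply hα
    rw [← sum_homogeneousComponent α]
    exact Finset.dvd_sum fun i _ => hcon i
  refine ⟨n, _, _, homogeneousComponent_isHomogeneous n α,
    homogeneousComponent_isHomogeneous (n + b / 2) β, hn, ?_⟩
  have h1 := dvd_homogeneousComponent hF hd (b + 2 * n)
  have h2 : b + 2 * n = 2 * (n + b / 2) := by
    obtain ⟨r, rfl⟩ := hb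
    omega
  rwa [map_sub, mul_comm (α ^ 2), homogeneousComponent_mul_of_isHomogeneous hG,
    homogeneousComponent_sq, h2, homogeneousComponent_sq, mul_comm G] at h1

/-- Chinese remainders over the components: for M = pa the sums αa + A'p and βa + B'p solve the
congruence modulo both factors. Powers of ℓ, which is prime to M, bring the summands to equal
degree. -/
theorem exists_isRelPrime_of_isSquareOn {G : MvPolynomial σ K} {b : ℕ} (hb : Even b)
    (hG : G.IsHomogeneous b) {ℓ : MvPolynomial σ K} (hℓ : Prime ℓ) (hℓ1 : ℓ.IsHomogeneous 1)
    (M : MvPolynomial σ K) (hM : ∃ m, M.IsHomogeneous m) (hsq : Squarefree M) (hℓM : ¬ ℓ ∣ M)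
    (h : ∀ F, Irreducible F → F ∣ M → IsSquareOn G F) :
    ∃ (n : ℕ) (A B : MvPolynomial σ K), A.IsHomogeneous n ∧ B.IsHomogeneous (n + b / 2) ∧
      IsRelPrime A M ∧ M ∣ A ^ 2 * G - B ^ 2 := by
  induction M using UniqueFactorizationMonoid.induction_on_prime with
  | h₁ => exact absurd (dvd_zero ℓ) hℓM
  | h₂ x hx =>
    exact ⟨0, 1, 0, isHomogeneous_one _ _, isHomogeneous_zero _ _ _, isRelPrime_one_left, hx.dvd⟩
  | h₃ a p ha hp ih =>
    obtain ⟨M, hM⟩ := hM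
    have h0 := hsq.ne_zero
    obtain ⟨m, hm⟩ := exists_isHomogeneous_of_dvd hM h0 (dvd_mul_right p a)
    obtain ⟨m', hm'⟩ := exists_isHomogeneous_of_dvd hM h0 (dvd_mul_left a p)
    obtain ⟨hpa, -, ha'⟩ := squarefree_mul_iff.mp hsq
    obtain ⟨n', A', B', hA', hB', hrel, t', ht'⟩ := ih ⟨m', hm'⟩ ha'
      (fun hd => hℓM (hd.mul_left p)) (fun F hF hFa => h F hF (hFa.mul_left p))
    obtain ⟨n, α, β, hα, hβ, hpα, t, ht⟩ := exists_isHomogeneous_of_isSquareOn hb hG hm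
      (h p hp.irreducible (dvd_mul_right p a))
    have hpℓ : ¬ p ∣ ℓ := fun hd => hℓM
      (((hp.irreducible.associated_of_dvd hℓ.irreducible hd).symm.dvd).mul_right a)
    have hna : ¬ p ∣ a := fun hd => hp.not_isUnit (hpa dvd_rfl hd)
    refine ⟨n + m' + (n' + m), α * a * ℓ ^ (n' + m) + A' * p * ℓ ^ (n + m'),
      β * a * ℓ ^ (n' + m) + B' * p * ℓ ^ (n + m'), ?_, ?_, ?_, ?_⟩
    · have e1 := (hα.mul hm').mul (hℓ1.pow (n' + m))
      have e2 := (hA'.mul hm).mul (hℓ1.pow (n + m'))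
      rw [one_mul] at e1 e2
      rw [add_comm (n' + m)] at e2
      exact e1.add e2
    · have e1 := (hβ.mul hm').mul (hℓ1.pow (n' + m))
      have e2 := (hB'.mul hm).mul (hℓ1.pow (n + m'))
      rw [show n + b / 2 + m' + 1 * (n' + m) = n + m' + (n' + m) + b / 2 by ring] at e1
      rw [show n' + b / 2 + m + 1 * (n + m') = n + m' + (n' + m) + b / 2 by ring] at e2
      exact e1.add e2
    · refine IsRelPrime.mul_right ?_ ?_
      · refine (hp.irreducible.isRelPrime_iff_not_dvd.mpr fun hd => ?_).symm
        have h1 : p ∣ α * a * ℓ ^ (n' + m) :=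
          (dvd_add_left ((dvd_mul_left p A').mul_right _)).mp hd
        rcases hp.dvd_or_dvd h1 with h1 | h1
        · rcases hp.dvd_or_dvd h1 with h1 | h1
          · exact hpα h1
          · exact hna h1
        · exact hpℓ (hp.dvd_of_dvd_pow h1)
      · have hℓa : IsRelPrime (ℓ ^ (n + m')) a :=
          (hℓ.irreducible.isRelPrime_iff_not_dvd.mpr fun hd => hℓM (hd.mul_left p)).pow_left
        have h1 : IsRelPrime (A' * p * ℓ ^ (n + m')) a := (hrel.mul_left hpa).mul_left hℓa
        have h2 := h1.mul_add_left_left (α * ℓ ^ (n' + m))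
        rwa [show a * (α * ℓ ^ (n' + m)) = α * a * ℓ ^ (n' + m) by ring] at h2
    · refine ⟨a * ℓ ^ (2 * (n' + m)) * t + p * ℓ ^ (2 * (n + m')) * t' +
        2 * ℓ ^ (n' + m) * ℓ ^ (n + m') * (α * A' * G - β * B'), ?_⟩
      linear_combination a ^ 2 * ℓ ^ (2 * (n' + m)) * ht + p ^ 2 * ℓ ^ (2 * (n + m')) * ht'

end Homogeneous

/-! ### The prime ideal of a point and isolated intersections. -/

section Line

variable {K : Type*} [Field K]

/-- The restriction of polynomial functions to the line spanned by `v`. -/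
def lineHom (v : Fin 3 → K) : MvPolynomial (Fin 3) K →ₐ[K] Polynomial K :=
  aeval fun i => Polynomial.C (v i) * Polynomial.X

/-- The prime ideal of the point `[v]` of the plane. -/
def pointIdeal (v : Fin 3 → K) : Ideal (MvPolynomial (Fin 3) K) := RingHom.ker (lineHom v)

instance (v : Fin 3 → K) : (pointIdeal v).IsPrime := RingHom.ker_isPrime _

theorem lineHom_of_isHomogeneous {Z : MvPolynomial (Fin 3) K} {n : ℕ} (hZ : Z.IsHomogeneous n)
    (v : Fin 3 → K) : lineHom v Z = Polynomial.C (eval v Z) * Polynomial.X ^ n := by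
  rw [lineHom, aeval_mul_of_isHomogeneous hZ (fun i => Polynomial.C (v i)) Polynomial.X]
  congr 1
  have h : (aeval fun i => (Polynomial.C (v i) : Polynomial K)) =
      (Algebra.ofId K (Polynomial K)).comp (aeval v) := by
    ext i
    simp [Algebra.ofId_apply]
  rw [h, AlgHom.comp_apply, aeval_eq_eval]
  rfl

theorem mem_pointIdeal_of_isHomogeneous {Z : MvPolynomial (Fin 3) K} {n : ℕ}
    (hZ : Z.IsHomogeneous n) (v : Fin 3 → K) : Z ∈ pointIdeal v ↔ eval v Z = 0 := by
  rw [pointIdeal, RingHom.mem_ker, lineHom_of_isHomogeneous hZ]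
  simp

theorem exists_eval_homogeneousComponent_ne_zero {s : MvPolynomial (Fin 3) K} {v : Fin 3 → K}
    (hs : s ∉ pointIdeal v) : ∃ d, eval v (homogeneousComponent d s) ≠ 0 := by
  by_contra! h
  apply hs
  rw [← sum_homogeneousComponent s]
  exact Ideal.sum_mem _ fun d _ => (mem_pointIdeal_of_isHomogeneous
    (homogeneousComponent_isHomogeneous d s) v).mpr (h d)

variable {v a b : Fin 3 → K} (hw : LinearIndependent K ![v, a, b])
include hw

theorem eval_dualForm (l j : Fin 3) :
    eval (![v, a, b] l) (dualForm ![v, a, b] j) = if l = j then 1 else 0 := by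
  have h := aeval_dualForm (S := K) hw (Pi.single l 1) j
  rw [Pi.single_apply] at h
  rw [if_congr eq_comm rfl rfl, ← h, aeval_eq_eval]
  congr 2
  ext i
  simp [Pi.single_apply]

theorem pointIdeal_eq_span :
    pointIdeal v = Ideal.span {dualForm ![v, a, b] 1, dualForm ![v, a, b] 2} := by
  refine le_antisymm (fun Z hZ => ?_) ?_
  · set I := Ideal.span {dualForm ![v, a, b] 1, dualForm ![v, a, b] 2} with hI
    rw [← Ideal.Quotient.eq_zero_iff_mem]
    have h1 : Ideal.Quotient.mk I (dualForm ![v, a, b] 1) = 0 :=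
      Ideal.Quotient.eq_zero_iff_mem.mpr (Ideal.subset_span (by simp))
    have h2 : Ideal.Quotient.mk I (dualForm ![v, a, b] 2) = 0 :=
      Ideal.Quotient.eq_zero_iff_mem.mpr (Ideal.subset_span (by simp))
    have h : (Polynomial.aeval (Ideal.Quotient.mk I (dualForm ![v, a, b] 0))).comp (lineHom v) =
        Ideal.Quotient.mkₐ K I := by
      ext i
      have e := congrArg (Ideal.Quotient.mk I) (sum_C_mul_dualForm hw i)
      rw [Fin.sum_univ_three, map_add, map_add, map_mul, map_mul, map_mul, h1, h2, mul_zero,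
        mul_zero, add_zero, add_zero] at e
      rw [Ideal.Quotient.mkₐ_eq_mk, ← e]
      simp [lineHom]
      rfl
    have h' := DFunLike.congr_fun h Z
    rw [AlgHom.comp_apply, show lineHom v Z = 0 from hZ, map_zero] at h'
    exact h'.symm
  · rw [Ideal.span_le]
    rintro x (rfl | rfl)
    · exact (mem_pointIdeal_of_isHomogeneous (dualForm_isHomogeneous _ _) v).mpr
        (by simpa using eval_dualForm hw 0 1)
    · exact (mem_pointIdeal_of_isHomogeneous (dualForm_isHomogeneous _ _) v).mpr
        (by simpa using eval_dualForm hw 0 2)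

/-- Two curves without common component meet in isolated points. -/
theorem eq_pointIdeal {A F : MvPolynomial (Fin 3) K} (hrel : IsRelPrime A F) (hF : F ≠ 0)
    {q : Ideal (MvPolynomial (Fin 3) K)} (hq : q.IsPrime) (hle : Ideal.span {A, F} ≤ q)
    (hqv : q ≤ pointIdeal v) : q = pointIdeal v := by
  by_contra hne
  have hlt := lt_of_le_of_ne hqv hne
  have hA : A ∈ q := hle (Ideal.subset_span (by simp))
  have hFq : F ∈ q := hle (Ideal.subset_span (by simp))
  obtain ⟨π, hπ, hπF, hπq⟩ : ∃ π, Prime π ∧ π ∣ F ∧ π ∈ q := by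
    have h1 := UniqueFactorizationMonoid.factors_prod hF
    have h2 : (UniqueFactorizationMonoid.factors F).prod ∈ q := by
      obtain ⟨c, hc⟩ := h1.symm.dvd.elim fun c hc => (⟨c, hc⟩ : ∃ c, _ = F * c)
      rw [hc]
      exact q.mul_mem_right _ hFq
    obtain ⟨π, hπ, hπq⟩ := (hq.multiset_prod_mem_iff_exists_mem _).mp h2
    exact ⟨π, UniqueFactorizationMonoid.prime_of_factor π hπ,
      UniqueFactorizationMonoid.dvd_of_mem_factors hπ, hπq⟩
  have hπp : (Ideal.span {π}).IsPrime := (Ideal.span_singleton_prime hπ.ne_zero).mpr hπ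
  -- A strict chain 0 < (π) < q < `pointIdeal v` would give height at least 3, but two linear forms
  -- generate the last ideal.
  have h01 : (⊥ : Ideal (MvPolynomial (Fin 3) K)) < Ideal.span {π} := by
    rw [bot_lt_iff_ne_bot, Ne, Ideal.span_singleton_eq_bot]
    exact hπ.ne_zero
  have h12 : Ideal.span {π} < q := by
    refine lt_of_le_of_ne ((Ideal.span_singleton_le_iff_mem q).mpr hπq) fun h => ?_
    rw [← h, Ideal.mem_span_singleton] at hA
    exact hπ.not_isUnit (hrel hA hπF)
  have hb : (⊥ : Ideal (MvPolynomial (Fin 3) K)).IsPrime := Ideal.isPrime_bot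
  have e1 := Ideal.height_add_one_le_of_lt_of_isPrime h01
  have e2 := Ideal.height_add_one_le_of_lt_of_isPrime h12
  have e3 := Ideal.height_add_one_le_of_lt_of_isPrime hlt
  have e4 : (pointIdeal v).height ≤ 2 := by
    have hmin : pointIdeal v ∈
        (Ideal.span {dualForm ![v, a, b] 1, dualForm ![v, a, b] 2}).minimalPrimes := by
      rw [← pointIdeal_eq_span hw, Ideal.minimalPrimes_eq_subsingleton_self]
      rfl
    refine (Ideal.height_le_card_of_mem_minimalPrimes_span (Set.toFinite _) hmin).trans ?_
    have := Set.ncard_insert_le (dualForm ![v, a, b] 1) {dualForm ![v, a, b] 2}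
    rw [Set.ncard_singleton] at this
    exact_mod_cast this
  have e5 : (0 + 1 + 1 + 1 : ℕ∞) ≤ 2 := by
    refine le_trans ?_ e4
    refine le_trans ?_ e3
    gcongr
    refine le_trans ?_ e2
    gcongr
    refine le_trans ?_ e1
    gcongr
    exact zero_le
  exact absurd e5 (by decide)

/-- Near [v] the curves meet at most in that point, so (A, F) contains powers of the local
coordinates there. Taking components makes the denominator s homogeneous. -/
theorem exists_isHomogeneous_mul_pow_mem {A F : MvPolynomial (Fin 3) K} {n m : ℕ}
    (hA : A.IsHomogeneous n) (hF : F.IsHomogeneous m) (hrel : IsRelPrime A F) (hF0 : F ≠ 0) :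
    ∃ (s : MvPolynomial (Fin 3) K) (d N : ℕ), s.IsHomogeneous d ∧ eval v s ≠ 0 ∧
      ∀ j, j ≠ 0 → ∀ M, N ≤ M → s * dualForm ![v, a, b] j ^ M ∈ Ideal.span {A, F} := by
  have key : ∀ j, j ≠ 0 → ∃ (s : MvPolynomial (Fin 3) K) (d N : ℕ), s.IsHomogeneous d ∧
      eval v s ≠ 0 ∧ s * dualForm ![v, a, b] j ^ N ∈ Ideal.span {A, F} := by
    intro j hj
    have hmem : dualForm ![v, a, b] j ∈ pointIdeal v := by
      rw [mem_pointIdeal_of_isHomogeneous (dualForm_isHomogeneous _ _)]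
      have := eval_dualForm hw 0 j
      rwa [if_neg hj.symm] at this
    obtain ⟨s, hs, N, hN⟩ := exists_mul_pow_mem (Ideal.span {A, F}) (pointIdeal v)
      (dualForm ![v, a, b] j) fun q hq h1 h2 => by rwa [eq_pointIdeal hw hrel hF0 hq h1 h2]
    obtain ⟨d, hd⟩ := exists_eval_homogeneousComponent_ne_zero hs
    refine ⟨_, d, N, homogeneousComponent_isHomogeneous d s, hd, ?_⟩
    have h := homogeneousComponent_mem_span_pair hA hF hN (1 * N + d)
    rwa [mul_comm s, homogeneousComponent_mul_of_isHomogeneous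
      ((dualForm_isHomogeneous _ j).pow N), mul_comm (_ ^ N)] at h
  obtain ⟨s₁, d₁, N₁, h₁, hv₁, hm₁⟩ := key 1 (by decide)
  obtain ⟨s₂, d₂, N₂, h₂, hv₂, hm₂⟩ := key 2 (by decide)
  refine ⟨s₁ * s₂, d₁ + d₂, N₁ + N₂, h₁.mul h₂, by rw [map_mul]; exact mul_ne_zero hv₁ hv₂, ?_⟩
  intro j hj M hM
  obtain rfl | rfl : j = 1 ∨ j = 2 := by omega
  · obtain ⟨t, rfl⟩ : ∃ t, M = N₁ + t := ⟨M - N₁, by omega⟩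
    rw [pow_add, show ∀ x y : MvPolynomial (Fin 3) K, s₁ * s₂ * (x * y) = s₂ * y * (s₁ * x) by
      intros; ring]
    exact Ideal.mul_mem_left _ _ hm₁
  · obtain ⟨t, rfl⟩ : ∃ t, M = N₂ + t := ⟨M - N₂, by omega⟩
    rw [pow_add, show ∀ x y : MvPolynomial (Fin 3) K, s₁ * s₂ * (x * y) = s₁ * y * (s₂ * x) by
      intros; ring]
    exact Ideal.mul_mem_left _ _ hm₂

end Line

/-! ### Regularity at each point, from formal to polynomial. -/

section Local

variable {K : Type*} [Field K]

theorem coe_sub_eq {σ : Type*} (p q : MvPolynomial σ K) :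
    ((p - q : MvPolynomial σ K) : MvPowerSeries σ K) = p - q :=
  map_sub (coeToMvPowerSeries.ringHom (σ := σ) (R := K)) p q

theorem coeff_single_coe (f : MvPolynomial (Fin 2) K) (i : Fin 2) :
    MvPowerSeries.coeff (Finsupp.single i 1) (f : MvPowerSeries (Fin 2) K) =
      eval 0 (pderiv i f) := by
  classical
  obtain ⟨p, q, h⟩ := exists_eq_C_add_X_mul f
  have hs : ∀ i j : Fin 2, (Finsupp.single i 1 = Finsupp.single j 1) ↔ i = j := fun i j => by
    simp [Finsupp.single_left_inj]
  rw [h]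
  push_cast
  rw [map_add, map_add, coeff_single_mul, coeff_single_mul, MvPowerSeries.coeff_C]
  fin_cases i <;> simp [MvPowerSeries.coeff_X, hs, pderiv_X, constantCoeff_coe]

theorem mem_span_of_smooth {a b g f : MvPowerSeries (Fin 2) K} {N : ℕ}
    (hf : MvPowerSeries.constantCoeff f = 0)
    (hf' : MvPowerSeries.coeff (Finsupp.single 0 1) f ≠ 0 ∨
      MvPowerSeries.coeff (Finsupp.single 1 1) f ≠ 0)
    (h0 : MvPowerSeries.X 0 ^ N ∈ Ideal.span {a, f})
    (h1 : MvPowerSeries.X 1 ^ N ∈ Ideal.span {a, f}) (hd : f ∣ a ^ 2 * g - b ^ 2) :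
    b ∈ Ideal.span {a, f} := by
  classical
  have h01 : (Finsupp.single (0 : Fin 2) 1 = Finsupp.single (1 : Fin 2) 1) ↔ False := by
    simp [Finsupp.single_left_inj]
  have h10 : (Finsupp.single (1 : Fin 2) 1 = Finsupp.single (0 : Fin 2) 1) ↔ False := by
    simp [Finsupp.single_left_inj]
  rcases hf' with h | h
  · refine IsFormalParameterSystem.mem_span (ξ := MvPowerSeries.X 1)
      ⟨MvPowerSeries.constantCoeff_X _, hf, ?_⟩ h0 h1 hd
    simpa only [MvPowerSeries.coeff_X, h01, if_false, if_true, zero_mul, one_mul, zero_sub, neg_ne_zero]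
  · refine IsFormalParameterSystem.mem_span (ξ := MvPowerSeries.X 0)
      ⟨MvPowerSeries.constantCoeff_X _, hf, ?_⟩ h0 h1 hd
    simpa only [MvPowerSeries.coeff_X, h10, if_false, if_true, zero_mul, one_mul, sub_zero]

theorem mem_span_of_eq_node [CharP K 2] {ξ η u a b g f : MvPowerSeries (Fin 2) K} {N : ℕ}
    (h : IsFormalParameterSystem ξ η) (hu : IsUnit u) (hf : f = u * (η * (η + ξ)))
    (h0 : MvPowerSeries.X 0 ^ N ∈ Ideal.span {a, f})
    (h1 : MvPowerSeries.X 1 ^ N ∈ Ideal.span {a, f}) (hd : f ∣ a ^ 2 * g - b ^ 2) :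
    b ∈ Ideal.span {a, f} := by
  have hp : IsFormalParameterSystem (η + ξ) η := by
    refine ⟨by rw [map_add, h.1, h.2.1, add_zero], h.2.1, fun h0 => h.2.2 ?_⟩
    rw [map_add, map_add] at h0
    linear_combination h0
  have hfη : f = u * ((η + ξ) * η) := by rw [hf, mul_comm η]
  have hspan : Ideal.span {a, f} = Ideal.span {a, (η + ξ) * η} := by
    rw [Ideal.span_insert, Ideal.span_insert a, hfη, Ideal.span_singleton_mul_left_unit hu]
  rw [hspan] at h0 h1 ⊢
  exact hp.mem_span_of_node h0 h1 ((Dvd.intro_left u hfη.symm).trans hd)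

variable {v a b : Fin 3 → K} {A B F G : MvPolynomial (Fin 3) K} {n m l : ℕ}

/-- A formal relation B = rA + r'F descends by truncating r and r'. The error is a polynomial in the
ideal of the (N + 1)-st powers of the coordinates, and the factor s carries that ideal into (A, F).
-/
theorem exists_mul_mem_span_of_chart (hw : LinearIndependent K ![v, a, b]) (hA : A.IsHomogeneous n)
    (hB : B.IsHomogeneous l) (hF : F.IsHomogeneous m) (hrel : IsRelPrime A F) (hF0 : F ≠ 0)
    (hd : F ∣ A ^ 2 * G - B ^ 2)
    (hloc : ∀ (α β γ : MvPowerSeries (Fin 2) K) (N : ℕ),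
      MvPowerSeries.X 0 ^ N ∈ Ideal.span {α, (chartHom v a b F : MvPowerSeries (Fin 2) K)} →
      MvPowerSeries.X 1 ^ N ∈ Ideal.span {α, (chartHom v a b F : MvPowerSeries (Fin 2) K)} →
      (chartHom v a b F : MvPowerSeries (Fin 2) K) ∣ α ^ 2 * γ - β ^ 2 →
      β ∈ Ideal.span {α, (chartHom v a b F : MvPowerSeries (Fin 2) K)}) :
    ∃ (s : MvPolynomial (Fin 3) K) (d : ℕ), s.IsHomogeneous d ∧ eval v s ≠ 0 ∧
      s * B ∈ Ideal.span {A, F} := by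
  set θ := chartHom v a b with hθ
  obtain ⟨s, d, N, hs, hvs, hN⟩ := exists_isHomogeneous_mul_pow_mem hw hA hF hrel hF0
  have hpoly : ∀ j, j ≠ 0 → ∀ M, N ≤ M → ∃ p q,
      θ s * (![1, X 0, X 1] j : MvPolynomial (Fin 2) K) ^ M = p * θ A + q * θ F := by
    intro j hj M hM
    obtain ⟨p, q, hpq⟩ := Ideal.mem_span_pair.mp (hN j hj M hM)
    refine ⟨θ p, θ q, ?_⟩
    rw [← map_mul, ← map_mul, ← map_add, hpq, map_mul, map_pow, hθ, chartHom_dualForm hw]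
  have hsu : IsUnit (θ s : MvPowerSeries (Fin 2) K) := by
    rw [MvPowerSeries.isUnit_iff_constantCoeff, constantCoeff_coe, hθ, eval_eq_aeval_chartHom]
    exact isUnit_iff_ne_zero.mpr hvs
  have hser : ∀ j, j ≠ 0 → ((![1, X 0, X 1] j : MvPolynomial (Fin 2) K) :
      MvPowerSeries (Fin 2) K) ^ N ∈
        Ideal.span {(θ A : MvPowerSeries (Fin 2) K), (θ F : MvPowerSeries (Fin 2) K)} := by
    intro j hj
    obtain ⟨p, q, hpq⟩ := hpoly j hj N le_rfl
    rw [← Ideal.unit_mul_mem_iff_mem _ hsu, ← coe_pow, ← coe_mul, hpq, coe_add, coe_mul, coe_mul]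
    exact Ideal.mem_span_pair.mpr ⟨_, _, rfl⟩
  have hB' : (θ B : MvPowerSeries (Fin 2) K) ∈
      Ideal.span {(θ A : MvPowerSeries (Fin 2) K), (θ F : MvPowerSeries (Fin 2) K)} := by
    refine hloc _ _ (θ G) N (by simpa using hser 1 (by decide)) (by simpa using hser 2 (by decide)) ?_
    obtain ⟨e, he⟩ := hd
    refine ⟨(θ e : MvPowerSeries (Fin 2) K), ?_⟩
    rw [← coe_mul, ← map_mul, ← he, map_sub, map_mul, map_pow, map_pow, coe_sub_eq, coe_mul, coe_pow,
      coe_pow]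
  obtain ⟨r, r', hr⟩ := Ideal.mem_span_pair.mp hB'
  obtain ⟨g, p, q, hg⟩ := exists_truncation r N
  obtain ⟨g', p', q', hg'⟩ := exists_truncation r' N
  obtain ⟨P, Q, hPQ⟩ := exists_eq_X_pow_mul_add (Z := θ B - g * θ A - g' * θ F) (N := N + 1)
    (p := p * (θ A : MvPowerSeries (Fin 2) K) + p' * (θ F : MvPowerSeries (Fin 2) K))
    (q := q * (θ A : MvPowerSeries (Fin 2) K) + q' * (θ F : MvPowerSeries (Fin 2) K)) (by
      rw [coe_sub_eq, coe_sub_eq, coe_mul, coe_mul, ← hr, hg, hg']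
      ring)
  obtain ⟨x, y, hxy⟩ := hpoly 1 (by decide) (N + 1) (Nat.le_succ N)
  obtain ⟨x', y', hxy'⟩ := hpoly 2 (by decide) (N + 1) (Nat.le_succ N)
  obtain ⟨M, t, t', ht⟩ := exists_pow_mul_eq_of_chartHom hw (hs.mul hB) hA hF
    (u := θ s * g + x * P + x' * Q) (u' := θ s * g' + y * P + y' * Q) (by
      rw [map_mul]
      simp only [Matrix.cons_val_one, Matrix.cons_val_zero, Matrix.cons_val] at hxy hxy'
      linear_combination θ s * hPQ + P * hxy + Q * hxy')
  refine ⟨dualForm ![v, a, b] 0 ^ M * s, _, ((dualForm_isHomogeneous _ 0).pow M).mul hs, ?_, ?_⟩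
  · have h0 := eval_dualForm hw 0 0
    rw [if_pos rfl] at h0
    rw [map_mul, map_pow, show eval v (dualForm ![v, a, b] 0) = 1 from h0, one_pow, one_mul]
    exact hvs
  · rw [mul_assoc, ht]
    exact Ideal.mem_span_pair.mpr ⟨t, t', rfl⟩

theorem exists_pderiv_chartHom_ne_zero (hw : LinearIndependent K ![v, a, b])
    (hF : F.IsHomogeneous m) (hv : eval v F = 0) (hs : ¬ ∀ j, eval v (pderiv j F) = 0) :
    eval 0 (pderiv 0 (chartHom v a b F)) ≠ 0 ∨ eval 0 (pderiv 1 (chartHom v a b F)) ≠ 0 := by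
  rw [eval_pderiv_chartHom_zero, eval_pderiv_chartHom_one]
  by_contra! h
  apply hs
  have hE : ∑ j, v j * eval v (pderiv j F) = 0 := by
    have := congrArg (eval v) hF.sum_X_mul_pderiv
    rw [map_sum, map_nsmul, hv, smul_zero] at this
    simpa using this
  have hm : (Matrix.of ![v, a, b]).mulVec (fun j => eval v (pderiv j F)) = 0 := by
    ext i
    fin_cases i
    · exact hE
    · exact h.1
    · exact h.2
  have hu := isUnit_det_of_linearIndependent hw
  intro j
  exact congrFun (Matrix.eq_zero_of_mulVec_eq_zero hu.ne_zero hm) j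

/-- At each point of a nodal curve, a rational function with regular square is regular. -/
theorem exists_mul_mem_span [CharP K 2] (hA : A.IsHomogeneous n) (hB : B.IsHomogeneous l)
    (hF : F.IsHomogeneous m) (hrel : IsRelPrime A F) (hF0 : F ≠ 0) (hd : F ∣ A ^ 2 * G - B ^ 2)
    (hnode : HasOnlyOrdinaryNodes F) (P : ℙ K (Fin 3 → K)) :
    ∃ (s : MvPolynomial (Fin 3) K) (d : ℕ), s.IsHomogeneous d ∧ eval P.rep s ≠ 0 ∧
      s * B ∈ Ideal.span {A, F} := by
  by_cases hP : eval P.rep F = 0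
  · by_cases hs : IsSingularPoint F P
    · obtain ⟨a, b, hw, ξ, η, u, hξ, hu, h⟩ := hnode P hs
      exact exists_mul_mem_span_of_chart hw hA hB hF hrel hF0 hd fun α β γ N h0 h1 hd =>
        mem_span_of_eq_node hξ hu h h0 h1 hd
    · obtain ⟨a, b, hw⟩ := exists_basis P.rep_nonzero
      refine exists_mul_mem_span_of_chart hw hA hB hF hrel hF0 hd fun α β γ N h0 h1 hd =>
        mem_span_of_smooth ?_ ?_ h0 h1 hd
      · rw [constantCoeff_coe, eval_eq_aeval_chartHom, hP]
      · rw [coeff_single_coe, coeff_single_coe]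
        exact exists_pderiv_chartHom_ne_zero hw hF hP fun h => hs ⟨hP, h⟩
  · exact ⟨F, m, hF, hP, Ideal.mul_mem_right _ _ (Ideal.subset_span (by simp))⟩

end Local

/-! ### Saturation of a complete intersection. -/

section Depth

variable {R : Type*} [CommRing R] [IsDomain R] {ℓ₁ ℓ₂ F A B : R}

-- Modulo (ℓ₁, ℓ₂^N) there is a filtration with all quotients R/(ℓ₁, ℓ₂), a domain in which F is
-- non-zero; so F is a non-zero-divisor.
omit [IsDomain R] in
theorem mem_span_pow_of_mul_mem (h₁ : Prime ℓ₁) (h₁₂ : ¬ ℓ₁ ∣ ℓ₂)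
    (hI : (Ideal.span {ℓ₁, ℓ₂}).IsPrime) (hF : F ∉ Ideal.span {ℓ₁, ℓ₂}) {N : ℕ} {e : R}
    (he : F * e ∈ Ideal.span {ℓ₁, ℓ₂ ^ N}) : e ∈ Ideal.span {ℓ₁, ℓ₂ ^ N} := by
  induction N generalizing e with
  | zero =>
    rw [pow_zero]
    exact Ideal.mem_span_pair.mpr ⟨0, e, by ring⟩
  | succ N ih =>
    obtain ⟨x, y, hxy⟩ := Ideal.mem_span_pair.mp he
    obtain ⟨x', y', rfl⟩ := Ideal.mem_span_pair.mp
      (ih (Ideal.mem_span_pair.mpr ⟨x, y * ℓ₂, by rw [← hxy]; ring⟩))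
    have h1 : ℓ₁ ∣ ℓ₂ ^ N * (F * y' - y * ℓ₂) := ⟨x - F * x', by linear_combination -hxy⟩
    obtain ⟨z, hz⟩ := (h₁.dvd_or_dvd h1).resolve_left fun h => h₁₂ (h₁.dvd_of_dvd_pow h)
    have h2 : F * y' ∈ Ideal.span {ℓ₁, ℓ₂} :=
      Ideal.mem_span_pair.mpr ⟨z, y, by linear_combination -hz⟩
    obtain ⟨p, q, rfl⟩ := Ideal.mem_span_pair.mp ((hI.mem_or_mem h2).resolve_left hF)
    exact Ideal.mem_span_pair.mpr ⟨x' + p * ℓ₂ ^ N, q, by ring⟩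

theorem mem_span_of_pow_mul_mem (h₁ : Prime ℓ₁) (h₁₂ : ¬ ℓ₁ ∣ ℓ₂)
    (hI : (Ideal.span {ℓ₁, ℓ₂}).IsPrime) (hF : F ∉ Ideal.span {ℓ₁, ℓ₂})
    (hrel : ∀ x y, A * x = F * y → F ∣ x) {N n : ℕ}
    (hN : ℓ₂ ^ N * B ∈ Ideal.span {A, F}) (hn : ℓ₁ ^ n * B ∈ Ideal.span {A, F}) :
    B ∈ Ideal.span {A, F} := by
  induction n with
  | zero => simpa using hn
  | succ n ih =>
    apply ih
    obtain ⟨r, r', hr⟩ := Ideal.mem_span_pair.mp hn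
    obtain ⟨t, t', ht⟩ := Ideal.mem_span_pair.mp hN
    -- The two expressions of ℓ₁^(n+1) ℓ₂^N B differ by e times the trivial syzygy of A and F.
    -- Writing e = xℓ₁ + yℓ₂^N, the coefficients r - yF and r' + yA become divisible by ℓ₁, which
    -- lowers the exponent.
    obtain ⟨e, he⟩ := hrel (ℓ₂ ^ N * r - ℓ₁ ^ (n + 1) * t) (ℓ₁ ^ (n + 1) * t' - ℓ₂ ^ N * r') (by
      linear_combination ℓ₂ ^ N * hr - ℓ₁ ^ (n + 1) * ht)
    obtain ⟨x, y, rfl⟩ := Ideal.mem_span_pair.mp (mem_span_pow_of_mul_mem h₁ h₁₂ hI hF (N := N)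
      (e := e) (Ideal.mem_span_pair.mpr ⟨-ℓ₁ ^ n * t, r, by rw [← he]; ring⟩))
    have h1 : ℓ₁ ∣ ℓ₂ ^ N * (r - y * F) := ⟨ℓ₁ ^ n * t + x * F, by linear_combination he⟩
    obtain ⟨r₁, hr₁⟩ := (h₁.dvd_or_dvd h1).resolve_left fun h => h₁₂ (h₁.dvd_of_dvd_pow h)
    have h2 : ℓ₁ ∣ F * (y * A + r') := ⟨ℓ₁ ^ n * B - r₁ * A, by linear_combination hr - A * hr₁⟩
    obtain ⟨z, hz⟩ := (h₁.dvd_or_dvd h2).resolve_left fun ⟨c, hc⟩ =>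
      hF (Ideal.mem_span_pair.mpr ⟨c, 0, by rw [hc]; ring⟩)
    refine Ideal.mem_span_pair.mpr ⟨r₁, z, mul_left_cancel₀ h₁.ne_zero ?_⟩
    linear_combination hr - A * hr₁ - F * hz

end Depth

/-! ### The complementary curve of a nodal splitting curve. -/

section Converse

variable {K : Type*} [Field K] [IsAlgClosed K]

/-- The Nullstellensatz for an ideal whose only possible zero is the origin. -/
theorem mem_radical_of_eval_zero {J : Ideal (MvPolynomial (Fin 3) K)}
    (hJ : ∀ P : ℙ K (Fin 3 → K), ∃ s ∈ J, ∃ d, s.IsHomogeneous d ∧ eval P.rep s ≠ 0)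
    {f : MvPolynomial (Fin 3) K} (hf : eval 0 f = 0) : f ∈ J.radical := by
  suffices h : f ∈ vanishingIdeal K (zeroLocus K J) by
    rwa [vanishingIdeal_zeroLocus_eq_radical] at h
  rw [mem_vanishingIdeal_iff]
  intro v hv
  have hv0 : v = 0 := by
    by_contra hv0
    obtain ⟨s, hs, d, hd, hne⟩ := hJ (Projectivization.mk K v hv0)
    obtain ⟨c, hc⟩ := Projectivization.exists_smul_eq_mk_rep K v hv0
    apply hne
    have h1 : (Projectivization.mk K v hv0).rep = fun i => v i * (c : K) := by
      rw [← hc]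
      ext i
      rw [mul_comm]
      rfl
    have h2 : eval v s = 0 := by simpa [aeval_eq_eval] using hv s hs
    rw [h1, eval_mul_of_isHomogeneous hd, h2, zero_mul]
  rw [hv0, aeval_eq_eval]
  exact hf

theorem exists_eval_ne_zero {F : MvPolynomial (Fin 3) K} (hF : F ≠ 0) :
    ∃ v, v ≠ 0 ∧ eval v F ≠ 0 := by
  by_contra! h
  have : F * X 0 = 0 := by
    refine MvPolynomial.funext fun v => ?_
    rcases eq_or_ne v 0 with rfl | hv
    · simp
    · simp [h v hv]
  exact mul_ne_zero hF (X_ne_zero 0) this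

variable [CharP K 2]

theorem exists_mul_mem_affineClass {b c : ℕ} (hb : Even b) {G F : MvPolynomial (Fin 3) K}
    (hG : G ∈ U K b) (hF : F.IsHomogeneous c) (hsq : Squarefree F) (hnode : HasOnlyOrdinaryNodes F)
    (h : ∀ π, Irreducible π → π ∣ F → IsSquareOn G π) :
    ∃ (d : ℕ) (D : MvPolynomial (Fin 3) K),
      c + d = b ∧ D.IsHomogeneous d ∧ F * D ∈ affineClass b G := by
  -- The point [v] off the curve makes the lines ℓ 1 and ℓ 2 meet outside it, as the saturation
  -- argument requires.
  obtain ⟨v, hv0, hv⟩ := exists_eval_ne_zero hsq.ne_zero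
  obtain ⟨a, b', hw⟩ := exists_basis hv0
  set ℓ := dualForm ![v, a, b'] with hℓ
  have hFI : F ∉ Ideal.span {ℓ 1, ℓ 2} := by
    rw [hℓ, ← pointIdeal_eq_span hw, mem_pointIdeal_of_isHomogeneous hF]
    exact hv
  have hI : (Ideal.span {ℓ 1, ℓ 2}).IsPrime := by
    rw [hℓ, ← pointIdeal_eq_span hw]
    infer_instance
  have h₁₂ : ¬ ℓ 1 ∣ ℓ 2 := by
    rintro ⟨t, ht⟩
    have := congrArg (eval (![v, a, b'] 2)) ht
    rw [map_mul, hℓ, eval_dualForm hw, eval_dualForm hw] at this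
    simp at this
  obtain ⟨n, A, B, hA, hB, hrel, hd⟩ := exists_isRelPrime_of_isSquareOn hb hG.1
    (dualForm_prime hw 1) (dualForm_isHomogeneous _ 1) F ⟨c, hF⟩ hsq
    (fun ⟨t, ht⟩ => hFI (Ideal.mem_span_pair.mpr ⟨t, 0, by rw [ht]; ring⟩)) h
  have hpow : ∀ j, ∃ N, ℓ j ^ N * B ∈ Ideal.span {A, F} := fun j =>
    mem_radical_of_eval_zero
      (J := Submodule.comap (LinearMap.mulRight (MvPolynomial (Fin 3) K) B) (Ideal.span {A, F}))
      (fun P => by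
        obtain ⟨s, d, hs, hsP, hmem⟩ :=
          exists_mul_mem_span hA hB hF hrel hsq.ne_zero hd hnode P
        exact ⟨s, hmem, d, hs, hsP⟩)
      (by
        rw [eval_zero, constantCoeff_eq]
        exact (dualForm_isHomogeneous _ j).coeff_eq_zero (by simp))
  obtain ⟨n₁, h1⟩ := hpow 1
  obtain ⟨n₂, h2⟩ := hpow 2
  have hmem := mem_span_of_pow_mul_mem (dualForm_prime hw 1) h₁₂ hI hFI
    (fun x y hxy => hrel.symm.dvd_of_dvd_mul_left ⟨y, hxy⟩) h2 h1
  obtain ⟨H, e, hHe⟩ := Ideal.mem_span_pair.mp hmem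
  -- Since B is HA modulo F, F divides A²(G - H²), and A is prime to F.
  obtain ⟨D, hD⟩ : F ∣ G - H ^ 2 := by
    refine (hrel.pow_left (m := 2)).symm.dvd_of_dvd_mul_left ?_
    obtain ⟨t, ht⟩ := hd
    exact ⟨t + e * (2 * H * A + e * F), by linear_combination ht - (B + H * A + e * F) * hHe⟩
  have h2 : (2 : MvPolynomial (Fin 3) K) = 0 := mvPolynomial_two_eq_zero
  have hcomp := congrArg (homogeneousComponent b) hD
  have hb2 : b = 2 * (b / 2) := by obtain ⟨r, rfl⟩ := hb; omega
  have hH : homogeneousComponent b (H ^ 2) = homogeneousComponent (b / 2) H ^ 2 := by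
    conv_lhs => rw [hb2]
    exact homogeneousComponent_sq _ _
  rw [map_sub, homogeneousComponent_of_mem hG.1, if_pos rfl, hH] at hcomp
  rcases le_or_gt c b with hcb | hcb
  · obtain ⟨d, rfl⟩ := Nat.exists_eq_add_of_le hcb
    refine ⟨d, _, rfl, homogeneousComponent_isHomogeneous d D, 1, homogeneousComponent ((c + d) / 2) H,
      one_ne_zero, homogeneousComponent_isHomogeneous _ H, ?_⟩
    rw [homogeneousComponent_mul_of_isHomogeneous hF] at hcomp
    rw [← hcomp, C_1]
    linear_combination -homogeneousComponent ((c + d) / 2) H ^ 2 * h2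
  -- If c > b, the product FD has no part of degree b, so G would be a square.
  · rw [homogeneousComponent_mul_of_lt hF D hcb, sub_eq_zero] at hcomp
    exact absurd (eq_zero_of_sq_eq hG (homogeneousComponent (b / 2) H) 1 (by rw [← hcomp]; ring))
      one_ne_zero

end Converse

/-! ### Nodes and splitting for members of the affine class. -/

section Nodes

variable {K : Type*} [Field K] [IsAlgClosed K] [CharP K 2]

/-- First and second derivatives of F are c times those of G, so singular points of F lie in Z(dG)
and their Hessian is non-degenerate. -/
theorem hasOnlyOrdinaryNodes_of_mem_affineClass {b : ℕ} {G F : MvPolynomial (Fin 3) K}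
    (hG : G ∈ U K b) (hF : F ∈ affineClass b G) : HasOnlyOrdinaryNodes F := by
  obtain ⟨c, H, hc, -, hF⟩ := hF
  have hd : ∀ j, pderiv j F = C c * pderiv j G := by
    intro j
    rw [hF, map_add, pderiv_sq, add_zero, pderiv_C_mul]
  intro P hP
  refine isOrdinaryNode_of_hess hP fun a b hw => ?_
  have h1 : hess F P.rep a b = c * hess G P.rep a b := by
    simp only [hess, hd, pderiv_C_mul, map_mul, eval_C, Finset.mul_sum]
    exact Finset.sum_congr rfl fun i _ => Finset.sum_congr rfl fun j _ => by ring
  rw [h1]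
  refine mul_ne_zero hc (hess_ne_zero hG hw fun j => ?_)
  have := hP.2 j
  rw [hd, map_mul, eval_C] at this
  exact (mul_eq_zero.mp this).resolve_left hc

theorem isSplitting_of_mem_affineClass {b : ℕ} {G F F' : MvPolynomial (Fin 3) K}
    (hF : F' ∈ affineClass b G) (h : F ∣ F') : IsSplitting G F := fun _ hπ hd =>
  properTransform_eq_of_isSquareOn hπ (isSquareOn_of_dvd hF hπ (hd.trans h))

end Nodes

end

end InsepCover

theorem proposition5p10 {k : Type*} [Field k] [IsAlgClosed k] [CharP k 2]
    (b : ℕ) (hb : Even b) (hb4 : 4 ≤ b)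
    (G : MvPolynomial (Fin 3) k) (hG : G ∈ InsepCover.U k b) :
    (∀ (c d : ℕ) (GC GD : MvPolynomial (Fin 3) k),
      GC.IsHomogeneous c → GD.IsHomogeneous d → c + d = b →
      GC * GD ∈ InsepCover.affineClass b G →
        (Squarefree GC ∧ Squarefree GD ∧ IsRelPrime GC GD) ∧
        InsepCover.HasOnlyOrdinaryNodes (GC * GD) ∧
        (InsepCover.IsSplitting G GC ∧ InsepCover.IsSplitting G GD) ∧
        InsepCover.curveWord b G GC = {P | InsepCover.OnCurve GC P ∧ InsepCover.OnCurve GD P} ∧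
        InsepCover.curveWord b G GD = {P | InsepCover.OnCurve GC P ∧ InsepCover.OnCurve GD P}) ∧
    (∀ (c : ℕ) (GC : MvPolynomial (Fin 3) k),
      GC.IsHomogeneous c → Squarefree GC → InsepCover.HasOnlyOrdinaryNodes GC →
      InsepCover.IsSplitting G GC →
        ∃ (d : ℕ) (GD : MvPolynomial (Fin 3) k),
          c + d = b ∧ GD.IsHomogeneous d ∧ GC * GD ∈ InsepCover.affineClass b G) := by
  refine ⟨fun c d GC GD hC hD _ hmem => ?_, fun c GC hC hsq hnode hs => ?_⟩
  · have hsq := squarefree_mul_iff.mp (InsepCover.squarefree_of_mem_affineClass hG hmem)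
    refine ⟨⟨hsq.2.1, hsq.2.2, hsq.1⟩, InsepCover.hasOnlyOrdinaryNodes_of_mem_affineClass hG hmem,
      ⟨InsepCover.isSplitting_of_mem_affineClass hmem (dvd_mul_right GC GD),
        InsepCover.isSplitting_of_mem_affineClass hmem (dvd_mul_left GD GC)⟩,
      InsepCover.curveWord_eq hb hG hC hD hmem, ?_⟩
    rw [InsepCover.curveWord_eq hb hG hD hC (by rwa [mul_comm])]
    simp only [and_comm]
  · refine InsepCover.exists_mul_mem_affineClass hb hG hC hsq hnode fun π hπ hd => ?_
    obtain ⟨m, hm⟩ := InsepCover.exists_isHomogeneous_of_dvd hC hsq.ne_zero hd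
    exact InsepCover.isSquareOn_of_properTransform_eq hm hπ (hs π hπ hd)
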